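/- Let $\beta\in\{1,2,4\}$ and let $\mathbb F_\beta=\mathbb R,\mathbb C,\mathbb H$ respectively. Let $N\ge 1$, and for $\mathbf m_0,\dots,\mathbf m_N\in(\mathbb F_\beta)^N$ let $\tilde M=[\mathbf m_k-\mathbf m_0]_{k=1}^N$ be the $N\times N$ matrix with columns $\mathbf m_k-\mathbf m_0$. Here $|\det\tilde M|$ is the product of the singular values of $\tilde M$; for $\beta=1,2$ it is the modulus of the usual determinant, and for $\beta=4$ it is the square root of the modulus of the determinant of the $2N\times 2N$ complex matrix obtained by replacing each entry $a+bi+cj+dk$ by $\begin{bmatrix}z&w\\-\bar w&\bar z\end{bmatrix}$, $z=a+bi$, $w=c+di$. Write $\sigma_l=2\pi^{l/2}/\Gamma(l/2)$ (for a positive integer $l$, the surface area of the unit sphere in $\mathbb R^l$) and $B(x,y)=\Gamma(x)\Gamma(y)/\Gamma(x+y)$ (which is $\int_0^1t^{x-1}(1-t)^{y-1}\,\mathrm dt$ when $\operatorname{Re}x,\operatorname{Re}y>0$). Let $q\in\mathbb C$ with $\operatorname{Re}q>-\beta$ and put $n=N+q/\beta$. Then the integrals below converge absolutely and the following hold. (36)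 (Ball.) If $q\notin\{0,-2,-4,\dots\}$, then $$\Big(\frac{\beta N}{\sigma_{\beta N}}\Big)^{N+1}\int_{\|\mathbf m_i\|\le1}|\det\tilde M|^q\,\mathrm d\mathbf m_0\cdots\mathrm d\mathbf m_N=\frac{2}{\sigma_{\beta(n-N)}\,B\big(\frac\beta2(n-N),\frac\beta2N(n+1)+1\big)}\prod_{i=1}^N\frac{\sigma_{\beta(N-i+1)}}{\sigma_{\beta(n-i+1)}}\Big(\frac{N\sigma_{\beta n}}{n\sigma_{\beta N}}\Big)^{N+1}.$$ (36') (Sphere.) If $q\notin\{0,-2,-4,\dots\}$ and $(N+1)(\operatorname{Re}q+\beta N)>2N$ (a restriction beyond $\operatorname{Re}q>-\beta$ only for $N=1$ and for $N=2,\beta=1$), then, integrating against surface measure on the unit sphere, $$\Big(\frac{1}{\sigma_{\beta N}}\Big)^{N+1}\int_{\|\mathbf m_i\|=1}|\det\tilde M|^q\,\mathrm d\mathbf m_0\cdots\mathrm d\mathbf m_N=\frac{2}{\sigma_{\beta(n-N)}\,B\big(\frac\beta2(n-N),\frac\beta2N(n+1)-N\big)}\prod_{i=1}^N\frac{\sigma_{\beta(N-i+1)}}{\sigma_{\beta(n-i+1)}}\Big(\frac{\sigma_{\beta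 n}}{\sigma_{\beta N}}\Big)^{N+1}.$$ (37) (Gaussian.) $$\Big(\frac1\pi\Big)^{\beta N(N+1)/2}\int_{\mathbf m_l\in(\mathbb F_\beta)^N}e^{-\sum_{l=0}^N\|\mathbf m_l\|^2}|\det\tilde M|^q\,\mathrm d\mathbf m_0\cdots\mathrm d\mathbf m_N=\Big(\frac{N+1}{\pi}\Big)^{\beta(n-N)/2}\prod_{i=1}^N\frac{\sigma_{\beta(N-i+1)}}{\sigma_{\beta(n-i+1)}}\Big(\frac1\pi\Big)^{\beta(N+1)(N-n)/2}.$$ -/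

import Mathlib

open MeasureTheory Metric
open scoped Quaternion ComplexConjugate

noncomputable section

/-- The Borel `σ`-algebra on the real quaternions. -/
instance SimplexMoment.instMeasurableSpaceQuaternion : MeasurableSpace ℍ[ℝ] := borel ℍ[ℝ]

instance SimplexMoment.instBorelSpaceQuaternion : BorelSpace ℍ[ℝ] := ⟨rfl⟩

instance SimplexMoment.instProperSpaceQuaternion : ProperSpace ℍ[ℝ] :=
  FiniteDimensional.proper_real ℍ[ℝ]

namespace SimplexMoment

/-- `σ_l = 2 π^{l/2} / Γ(l/2)`; for a positive integer `l` this is the surface area of the unit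
sphere in `ℝ^l`. -/
def sphereArea (l : ℂ) : ℂ := 2 * (Real.pi : ℂ) ^ (l / 2) / Complex.Gamma (l / 2)

/-- The Euler Beta function `B(x, y) = Γ(x) Γ(y) / Γ(x + y)`. -/
def eulerBeta (x y : ℂ) : ℂ := Complex.Gamma x * Complex.Gamma y / Complex.Gamma (x + y)

/-- `B(x, y) = ∫_0^1 t^{x-1} (1-t)^{y-1} dt` whenever the integral converges. -/
theorem eulerBeta_eq_integral {x y : ℂ} (hx : 0 < x.re) (hy : 0 < y.re) :
    eulerBeta x y = ∫ t : ℝ in 0..1, (t : ℂ) ^ (x - 1) * (1 - (t : ℂ)) ^ (y - 1) := by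
  have hxy : Complex.Gamma (x + y) ≠ 0 := by
    apply Complex.Gamma_ne_zero_of_re_pos
    simpa using add_pos hx hy
  have h := Complex.Gamma_mul_Gamma_eq_betaIntegral hx hy
  rw [eulerBeta, h, mul_div_cancel_left₀ _ hxy, Complex.betaIntegral]

/-- The matrix over `ℂ` obtained from a quaternion matrix by replacing each entry
`a + b i + c j + d k` by the block `[[z, w], [-conj w, conj z]]`, `z = a + b i`, `w = c + d i`. -/
def quaternionToComplex {N : ℕ} (M : Matrix (Fin N) (Fin N) ℍ[ℝ]) :
    Matrix (Fin N × Fin 2) (Fin N × Fin 2) ℂ :=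
  Matrix.of fun a b =>
    let z : ℂ := ⟨(M a.1 b.1).re, (M a.1 b.1).imI⟩
    let w : ℂ := ⟨(M a.1 b.1).imJ, (M a.1 b.1).imK⟩
    (!![z, w; -conj w, conj z] : Matrix (Fin 2) (Fin 2) ℂ) a.2 b.2

/-- The modulus of the determinant of a quaternion matrix, i.e. the product of its singular
values; each of these occurs twice in the complex `2N × 2N` representation, whence the root. -/
def quaternionAbsDet {N : ℕ} (M : Matrix (Fin N) (Fin N) ℍ[ℝ]) : ℝ :=
  √‖(quaternionToComplex M).det‖

/-- The matrix `[m_k - m_0]_{k=1}^N` whose `k`-th column is `m_k - m_0`. -/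
def simplexMatrix {F : Type} [NormedAddCommGroup F] {N : ℕ}
    (m : Fin (N + 1) → EuclideanSpace F (Fin N)) : Matrix (Fin N) (Fin N) F :=
  Matrix.of fun i k => m k.succ i - m 0 i

/-- The product `∏_{i=1}^N σ_{β(N-i+1)} / σ_{β(n-i+1)}`. -/
def areaRatio (β N : ℕ) (n : ℂ) : ℂ :=
  ∏ i ∈ Finset.Icc 1 N, sphereArea (β * ((N : ℂ) - i + 1)) / sphereArea (β * (n - i + 1))

section Moments

variable (F : Type) [NormedAddCommGroup F] [InnerProductSpace ℝ F] [FiniteDimensional ℝ F]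
  [SecondCountableTopology F] [MeasurableSpace F] [BorelSpace F]
  (β N : ℕ) (absDet : Matrix (Fin N) (Fin N) F → ℝ) (q : ℂ)

/-- Convergence and value of the `q`-th moment for independent points uniform in the closed unit
ball of `F^N` (normalised Lebesgue measure). -/
def BallMomentFormula : Prop :=
  IntegrableOn (fun m => (absDet (simplexMatrix m) : ℂ) ^ q)
    {m : Fin (N + 1) → EuclideanSpace F (Fin N) | ∀ i, ‖m i‖ ≤ 1} ∧
  let n : ℂ := N + q / β
  ((β * N : ℂ) / sphereArea (β * N)) ^ (N + 1) *
      (∫ m in {m : Fin (N + 1) → EuclideanSpace F (Fin N) | ∀ i, ‖m i‖ ≤ 1},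
        (absDet (simplexMatrix m) : ℂ) ^ q) =
    2 / (sphereArea (β * (n - N)) *
        eulerBeta (β / 2 * (n - N)) (β / 2 * N * (n + 1) + 1)) *
      areaRatio β N n *
      (N * sphereArea (β * n) / (n * sphereArea (β * N))) ^ (N + 1)

/-- Convergence and value of the `q`-th moment for independent points uniform on the unit sphere
of `F^N` (normalised surface measure). -/
def SphereMomentFormula : Prop :=
  Integrable
    (fun m : Fin (N + 1) → sphere (0 : EuclideanSpace F (Fin N)) 1 =>
      (absDet (simplexMatrix fun i => (m i : EuclideanSpace F (Fin N))) : ℂ) ^ q)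
    (Measure.pi fun _ => (volume : Measure (EuclideanSpace F (Fin N))).toSphere) ∧
  let n : ℂ := N + q / β
  (1 / sphereArea (β * N)) ^ (N + 1) *
      (∫ m : Fin (N + 1) → sphere (0 : EuclideanSpace F (Fin N)) 1,
        (absDet (simplexMatrix fun i => (m i : EuclideanSpace F (Fin N))) : ℂ) ^ q
        ∂(Measure.pi fun _ => (volume : Measure (EuclideanSpace F (Fin N))).toSphere)) =
    2 / (sphereArea (β * (n - N)) *
        eulerBeta (β / 2 * (n - N)) (β / 2 * N * (n + 1) - N)) *
      areaRatio β N n *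
      (sphereArea (β * n) / sphereArea (β * N)) ^ (N + 1)

/-- Convergence and value of the `q`-th moment for independent Gaussian points of `F^N`, each with
density `π^{-βN/2} e^{-‖m‖²}`. -/
def GaussianMomentFormula : Prop :=
  Integrable (fun m : Fin (N + 1) → EuclideanSpace F (Fin N) =>
    (Real.exp (-∑ l, ‖m l‖ ^ 2) : ℂ) * (absDet (simplexMatrix m) : ℂ) ^ q) ∧
  let n : ℂ := N + q / β
  (1 / Real.pi : ℂ) ^ ((β * N * (N + 1) : ℂ) / 2) *
      (∫ m : Fin (N + 1) → EuclideanSpace F (Fin N),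
        (Real.exp (-∑ l, ‖m l‖ ^ 2) : ℂ) * (absDet (simplexMatrix m) : ℂ) ^ q) =
    ((N + 1) / Real.pi : ℂ) ^ (β * (n - N) / 2) *
      areaRatio β N n *
      (1 / Real.pi : ℂ) ^ (β * (N + 1) * (N - n) / 2)

/-- The three moment formulas, each for all `q` at which both of its sides are well defined.
The moments converge for `Re q > -β`, on the sphere under the further condition
`(N + 1)(Re q + βN) > 2N` (which only matters for `N = 1` and for `β = 1`, `N = 2`); the right-hand
sides with a Beta function are undefined at `q = 0, -2, -4, …`, the poles of `Γ(q/2)`. -/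
def MomentFormulas : Prop :=
  -(β : ℝ) < q.re →
    ((∀ k : ℕ, q ≠ -2 * (k : ℂ)) → BallMomentFormula F β N absDet q) ∧
    ((∀ k : ℕ, q ≠ -2 * (k : ℂ)) → 2 * (N : ℝ) < (N + 1) * (q.re + β * N) →
      SphereMomentFormula F β N absDet q) ∧
    GaussianMomentFormula F β N absDet q

end Moments

end SimplexMoment

end

noncomputable section

namespace SimplexMoment

open scoped ENNReal NNReal BoundedContinuousFunction
open Filter Topology

/-! ### Integrals of products over finite product spaces -/

/-! Write `Δ m` for the absolute determinant of the simplex matrix and `d = βN`. All three formulas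
come from one Gaussian integral with free variances: for real `q > -β`, the integral of `exp (-∑ t_i
‖m_i‖²) Δ^q` is `C(q) T^{q/2} ∏ t_i^{-(d+q)/2}`, where `T = ∑ t_i`
(`hasGaussianMoment_simplexMatrix`). After scaling `m_i` by `t_i^{-1/2}`, a Householder reflection
of the index set `{0, …, N}` makes one of the `N + 1` vectors disappear from the differences `m_k -
m_0`. What remains is a square matrix of independent Gaussian columns times a real matrix of known
determinant. The Gaussian moment of a square matrix is computed by reflecting its first column onto
an axis and recursing (`gaussianDetMoment_succ`).

As a function of `t`, the formula is the Laplace transform of the law of `(‖m_0‖², …, ‖m_N‖²)` under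
`Δ^q dm`, and Laplace transforms determine measures on the orthant (`lintegral_comp_eq_of_laplace`).
The factors `t_i^{-(d+q)/2}` belong to independent gamma-type variables, and `T^{q/2}` encodes a
common shift `τ`. For `q < 0` the squared norms have, up to a constant, the law of independent
variables plus `τ`. For `q > 0` they become independent once `τ` is added, and homogeneity of `Δ`
separates `τ` again. Testing with `∏ (1 - ‖m_i‖²)_+^{b-1}` turns both cases into beta integrals. The
ball is `b = 1`. The sphere is the limit `b → 0` after multiplication by `b^{N+1}`, taken by
dominated convergence when `q > 0`, and by Fatou when `q < 0`, where only finiteness is needed.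

Complex `q` is reached by continuation (`integral_cpow_of_real_moments`): the moment is the complex
moment generating function of `log Δ`, analytic on a half-plane, and it agrees with the claimed
formula on positive reals. The factor `Γ(q/2)` cancels before continuation, so the formula is
analytic across `q = 0, -2, …`.

The three algebras are treated at once through the axioms `IsAbsDet`, which suffice for reflections,
column expansion and real changes of basis without a determinant over a noncommutative ring. -/

theorem lintegral_pi_prod {α : Type*} [MeasurableSpace α] (μ : Measure α) [SigmaFinite μ] :
    ∀ {n : ℕ} (f : Fin n → α → ℝ≥0∞), (∀ i, Measurable (f i)) →
      ∫⁻ x, ∏ i, f i (x i) ∂(Measure.pi fun _ : Fin n => μ) = ∏ i, ∫⁻ x, f i x ∂μ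
  | 0, f, _ => by simp
  | n + 1, f, hf => by
    have h := (measurePreserving_piFinSuccAbove (fun _ : Fin (n + 1) => μ) 0).symm
    rw [← h.lintegral_comp_emb (MeasurableEquiv.measurableEmbedding _), Fin.prod_univ_succ,
      ← lintegral_pi_prod μ (fun i => f i.succ) fun i => hf _, ← lintegral_prod_mul]
    · refine lintegral_congr fun x => ?_
      simp [Fin.prod_univ_succ, MeasurableEquiv.piFinSuccAbove]
    · exact (hf 0).aemeasurable
    · exact (Finset.measurable_prod _ fun i _ =>
        (hf i.succ).comp (measurable_pi_apply i)).aemeasurable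

theorem pi_withDensity {α : Type*} [MeasurableSpace α] (μ : Measure α) [SigmaFinite μ]
    {n : ℕ} (f : α → ℝ≥0∞) (hf : Measurable f) [SigmaFinite (μ.withDensity f)] :
    (Measure.pi fun _ : Fin n => μ.withDensity f) =
      (Measure.pi fun _ : Fin n => μ).withDensity fun x => ∏ i, f (x i) := by
  refine (Measure.pi_eq fun s hs => ?_)
  rw [withDensity_apply _ (MeasurableSet.univ_pi hs),
    ← lintegral_indicator (MeasurableSet.univ_pi hs)]
  simp_rw [withDensity_apply _ (hs _), ← lintegral_indicator (hs _)]
  rw [← lintegral_pi_prod μ _ fun i => hf.indicator (hs i)]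
  refine lintegral_congr fun x => ?_
  by_cases hx : x ∈ Set.univ.pi s
  · rw [Set.indicator_of_mem hx]
    exact Finset.prod_congr rfl fun i _ => (Set.indicator_of_mem (hx i trivial) _).symm
  · rw [Set.indicator_of_notMem hx]
    simp only [Set.mem_pi, Set.mem_univ, true_implies, not_forall] at hx
    obtain ⟨i, hi⟩ := hx
    exact (Finset.prod_eq_zero (Finset.mem_univ i) (Set.indicator_of_notMem hi _)).symm

/-! ### Laplace transforms determine measures on an orthant -/

/-- `s ↦ exp (-∑ k_i s_i)` as a bounded continuous function on the orthant. -/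
def expNeg {n : ℕ} (k : Fin n → ℕ) : (Fin n → ℝ≥0) →ᵇ ℝ :=
  BoundedContinuousFunction.mkOfBound
    ⟨fun s => Real.exp (-∑ i, (k i : ℝ) * (s i : ℝ)), by fun_prop⟩ 1 fun x y => by
      have h : ∀ z : Fin n → ℝ≥0, Real.exp (-∑ i, (k i : ℝ) * (z i : ℝ)) ∈ Set.Icc (0 : ℝ) 1 :=
        fun z => ⟨(Real.exp_pos _).le, Real.exp_le_one_iff.2 (by
          have : 0 ≤ ∑ i, (k i : ℝ) * (z i : ℝ) := by positivity
          linarith)⟩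
      exact (Real.dist_le_of_mem_Icc (h x) (h y)).trans (by norm_num)

theorem expNeg_apply {n : ℕ} (k : Fin n → ℕ) (s : Fin n → ℝ≥0) :
    expNeg k s = Real.exp (-∑ i, (k i : ℝ) * (s i : ℝ)) := rfl

theorem expNeg_mul {n : ℕ} (k l : Fin n → ℕ) : expNeg k * expNeg l = expNeg (k + l) := by
  ext s
  simp only [BoundedContinuousFunction.coe_mul, Pi.mul_apply, expNeg_apply, ← Real.exp_add,
    Pi.add_apply, Nat.cast_add, add_mul, Finset.sum_add_distrib]
  congr 1; ring

theorem expNeg_zero {n : ℕ} : expNeg (0 : Fin n → ℕ) = 1 := by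
  ext s; simp [expNeg_apply]

/-- The algebra spanned by the exponentials `expNeg k`. -/
def expAlgebra (n : ℕ) : StarSubalgebra ℝ ((Fin n → ℝ≥0) →ᵇ ℝ) where
  toSubalgebra := (Submodule.span ℝ (Set.range (expNeg (n := n)))).toSubalgebra
    (Submodule.subset_span ⟨0, expNeg_zero⟩) (by
      intro x y hx hy
      induction hx using Submodule.span_induction with
      | mem x hx =>
        obtain ⟨k, rfl⟩ := hx
        induction hy using Submodule.span_induction with
        | mem y hy =>
          obtain ⟨l, rfl⟩ := hy
          exact Submodule.subset_span ⟨k + l, (expNeg_mul k l).symm⟩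
        | zero => simp
        | add y z _ _ hy hz => rw [mul_add]; exact Submodule.add_mem _ hy hz
        | smul c y _ hy => rw [mul_smul_comm]; exact Submodule.smul_mem _ _ hy
      | zero => simp
      | add x z _ _ hx hz => rw [add_mul]; exact Submodule.add_mem _ hx hz
      | smul c x _ hx => rw [smul_mul_assoc]; exact Submodule.smul_mem _ _ hx)
  star_mem' := by
    intro a ha
    have : star a = a := by ext; simp
    rwa [this]

theorem mem_expAlgebra {n : ℕ} {g : (Fin n → ℝ≥0) →ᵇ ℝ} :
    g ∈ expAlgebra n ↔ g ∈ Submodule.span ℝ (Set.range (expNeg (n := n))) := Iff.rfl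

theorem expAlgebra_separatesPoints (n : ℕ) :
    ((expAlgebra n).map
      (BoundedContinuousFunction.toContinuousMapStarₐ ℝ)).SeparatesPoints := by
  intro x y hxy
  obtain ⟨i, hi⟩ := Function.ne_iff.1 hxy
  refine ⟨expNeg (Pi.single i 1), ⟨_, ⟨expNeg (Pi.single i 1),
    mem_expAlgebra.2 (Submodule.subset_span ⟨_, rfl⟩), rfl⟩, rfl⟩, ?_⟩
  have h : ∀ s : Fin n → ℝ≥0, expNeg (Pi.single i 1) s = Real.exp (-(s i : ℝ)) := fun s => by
    rw [expNeg_apply, Finset.sum_eq_single i] <;> simp +contextual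
  rw [h, h]
  intro he
  exact hi (NNReal.coe_injective (neg_injective (Real.exp_injective he)))

/-- The exponentials with natural frequencies are closed under products, contain `1` and separate
points, so their span is an algebra of bounded functions that determines finite measures on this
Polish space. -/
theorem ext_of_integral_expNeg {n : ℕ} {P P' : Measure (Fin n → ℝ≥0)} [IsFiniteMeasure P]
    [IsFiniteMeasure P'] (h : ∀ k : Fin n → ℕ, ∫ s, expNeg k s ∂P = ∫ s, expNeg k s ∂P') :
    P = P' := by
  refine ext_of_forall_mem_subalgebra_integral_eq_of_pseudoEMetric_complete_countable
    (expAlgebra_separatesPoints n) fun g hg => ?_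
  rw [mem_expAlgebra] at hg
  induction hg using Submodule.span_induction with
  | mem x hx => obtain ⟨k, rfl⟩ := hx; exact h k
  | zero => simp
  | add x y _ _ hx hy =>
    simp only [BoundedContinuousFunction.coe_add, Pi.add_apply]
    rw [integral_add (x.integrable P) (y.integrable P),
      integral_add (x.integrable P') (y.integrable P'), hx, hy]
  | smul c x _ hx =>
    simp only [BoundedContinuousFunction.coe_smul]
    rw [integral_smul, integral_smul, hx]

/-- Random vectors in the orthant (for possibly infinite measures) whose Laplace transforms are
finite and agree have the same law. -/
theorem lintegral_comp_eq_of_laplace.{u} {α α' : Type u} [MeasurableSpace α] [MeasurableSpace α']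
    {n : ℕ} {μ : Measure α} {ν : Measure α'} {X : α → Fin n → ℝ} {Y : α' → Fin n → ℝ}
    (hX : Measurable X) (hY : Measurable Y) (hX0 : ∀ᵐ a ∂μ, ∀ i, 0 ≤ X a i)
    (hY0 : ∀ᵐ a ∂ν, ∀ i, 0 ≤ Y a i)
    (hfin : ∀ t : Fin n → ℝ, (∀ i, 0 < t i) →
      ∫⁻ a, ENNReal.ofReal (Real.exp (-∑ i, t i * X a i)) ∂μ ≠ ∞)
    (h : ∀ t : Fin n → ℝ, (∀ i, 0 < t i) →
      ∫⁻ a, ENNReal.ofReal (Real.exp (-∑ i, t i * X a i)) ∂μ =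
        ∫⁻ a, ENNReal.ofReal (Real.exp (-∑ i, t i * Y a i)) ∂ν)
    {g : (Fin n → ℝ) → ℝ≥0∞} (hg : Measurable g) :
    ∫⁻ a, g (X a) ∂μ = ∫⁻ a, g (Y a) ∂ν := by
  -- Tilting by `exp (-∑ s_i)` makes both laws finite and shifts the frequencies from `k ≥ 0` to `k
  -- + 1 > 0`, where the Laplace hypotheses apply. The tilt is undone at the end by absorbing `exp
  -- (∑ s_i)` into the test function.
  set W : (Fin n → ℝ≥0) → ℝ≥0∞ := fun s => ENNReal.ofReal (Real.exp (-∑ i, (s i : ℝ))) with hW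
  have hWm : Measurable W := by fun_prop
  have key : ∀ {γ : Type u} [MeasurableSpace γ] (m : Measure γ) (Z : γ → Fin n → ℝ),
      Measurable Z → (∀ᵐ a ∂m, ∀ i, 0 ≤ Z a i) → ∀ k : Fin n → ℕ,
      ∫⁻ s, ENNReal.ofReal (expNeg k s)
        ∂((m.map fun a i => (Z a i).toNNReal).withDensity W) =
      ∫⁻ a, ENNReal.ofReal (Real.exp (-∑ i, ((k i : ℝ) + 1) * Z a i)) ∂m := by
    intro γ _ m Z hZ hZ0 k
    have h1 : Measurable fun s : Fin n → ℝ≥0 => ENNReal.ofReal (expNeg k s) :=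
      (expNeg k).continuous.measurable.ennreal_ofReal
    rw [lintegral_withDensity_eq_lintegral_mul _ hWm h1,
      lintegral_map (hWm.mul h1) (by fun_prop)]
    refine lintegral_congr_ae (hZ0.mono fun a ha => ?_)
    simp only [Pi.mul_apply, hW, expNeg_apply]
    rw [← ENNReal.ofReal_mul (Real.exp_pos _).le, ← Real.exp_add]
    congr 2
    simp only [Real.coe_toNNReal _ (ha _), add_mul, one_mul, Finset.sum_add_distrib]
    ring
  set P := (μ.map fun a i => (X a i).toNNReal).withDensity W with hP
  set P' := (ν.map fun a i => (Y a i).toNNReal).withDensity W with hP'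
  have e1 := key μ X hX hX0
  have e2 := key ν Y hY hY0
  have hpos : ∀ k : Fin n → ℕ, ∀ i, (0 : ℝ) < (k i : ℝ) + 1 := fun k i => by positivity
  have hEq : ∀ k : Fin n → ℕ, ∫⁻ s, ENNReal.ofReal (expNeg k s) ∂P =
      ∫⁻ s, ENNReal.ofReal (expNeg k s) ∂P' := fun k => by
    rw [e1, e2, h _ (hpos k)]
  have f1 : ∀ k : Fin n → ℕ, ∫⁻ s, ENNReal.ofReal (expNeg k s) ∂P ≠ ∞ := fun k => by
    rw [e1]; exact hfin _ (hpos k)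
  have hone : ∀ s : Fin n → ℝ≥0, ENNReal.ofReal (expNeg 0 s) = 1 := by
    intro s; rw [expNeg_zero]; simp
  have : IsFiniteMeasure P := ⟨by simpa [hone] using (f1 0).lt_top⟩
  have : IsFiniteMeasure P' := ⟨by
    have := f1 0
    rw [hEq] at this
    simpa [hone] using this.lt_top⟩
  have hPP : P = P' := by
    refine ext_of_integral_expNeg fun k => ?_
    have hnn : ∀ s, 0 ≤ expNeg k s := fun s => (Real.exp_pos _).le
    rw [integral_eq_lintegral_of_nonneg_ae (ae_of_all _ hnn)
      (expNeg k).continuous.aestronglyMeasurable,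
      integral_eq_lintegral_of_nonneg_ae (ae_of_all _ hnn)
      (expNeg k).continuous.aestronglyMeasurable, hEq]
  have fin : ∀ {γ : Type u} [MeasurableSpace γ] (m : Measure γ) (Z : γ → Fin n → ℝ),
      Measurable Z → (∀ᵐ a ∂m, ∀ i, 0 ≤ Z a i) →
      ∫⁻ a, g (Z a) ∂m = ∫⁻ s, ENNReal.ofReal (Real.exp (∑ i, (s i : ℝ))) * g (fun i => s i)
        ∂((m.map fun a i => (Z a i).toNNReal).withDensity W) := by
    intro γ _ m Z hZ hZ0
    have h1 : Measurable fun s : Fin n → ℝ≥0 =>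
        ENNReal.ofReal (Real.exp (∑ i, (s i : ℝ))) * g (fun i => s i) :=
      Measurable.mul (by fun_prop) (hg.comp (by fun_prop))
    rw [lintegral_withDensity_eq_lintegral_mul _ hWm h1,
      lintegral_map (hWm.mul h1) (by fun_prop)]
    refine lintegral_congr_ae (hZ0.mono fun a ha => ?_)
    simp only [Pi.mul_apply, hW]
    rw [← mul_assoc, ← ENNReal.ofReal_mul (Real.exp_pos _).le, ← Real.exp_add]
    simp [Real.coe_toNNReal _ (ha _)]
  rw [fin μ X hX hX0, fin ν Y hY hY0, ← hP, ← hP', hPP]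

/-! ### Power weights on the half-line -/

/-- The measure `x ^ (p - 1) dx` on `(0, ∞)`. -/
def powMeasure (p : ℝ) : Measure ℝ :=
  (volume.restrict (Set.Ioi 0)).withDensity fun x => ENNReal.ofReal (x ^ (p - 1))

instance (p : ℝ) : SigmaFinite (powMeasure p) := SigmaFinite.withDensity_ofReal _

theorem lintegral_powMeasure (p : ℝ) {f : ℝ → ℝ≥0∞} (hf : Measurable f) :
    ∫⁻ x, f x ∂powMeasure p =
      ∫⁻ x in Set.Ioi 0, ENNReal.ofReal (x ^ (p - 1)) * f x := by
  rw [powMeasure, lintegral_withDensity_eq_lintegral_mul _ (by fun_prop) hf]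
  rfl

theorem ae_powMeasure_pos (p : ℝ) : ∀ᵐ x ∂powMeasure p, 0 < x :=
  (withDensity_absolutelyContinuous _ _).ae_le (ae_restrict_mem measurableSet_Ioi)

theorem lintegral_exp_powMeasure {p t : ℝ} (hp : 0 < p) (ht : 0 < t) :
    ∫⁻ x, ENNReal.ofReal (Real.exp (-(t * x))) ∂powMeasure p =
      ENNReal.ofReal (t ^ (-p) * Real.Gamma p) := by
  have h := Real.integral_rpow_mul_exp_neg_mul_Ioi hp ht
  have hpos : 0 < (1 / t) ^ p * Real.Gamma p :=
    mul_pos (Real.rpow_pos_of_pos (by positivity) _) (Real.Gamma_pos_of_pos hp)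
  rw [lintegral_powMeasure p (by fun_prop), Real.rpow_neg ht.le, ← Real.inv_rpow ht.le,
    ← one_div, ← h, ofReal_integral_eq_lintegral_ofReal]
  · refine setLIntegral_congr_fun measurableSet_Ioi fun x (hx : 0 < x) => ?_
    exact (ENNReal.ofReal_mul (Real.rpow_nonneg hx.le _)).symm
  -- Integrability comes from the value: a non-integrable function has Bochner integral `0`, but the
  -- value is positive.
  · by_contra hc
    exact hpos.ne' (h ▸ integral_undef hc)
  · exact (ae_restrict_mem measurableSet_Ioi).mono fun x (hx : 0 < x) =>
      mul_nonneg (Real.rpow_nonneg hx.le _) (Real.exp_pos _).le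

/-- The truncated power `s ↦ (1 - s)_+ ^ (b - 1)`. -/
def betaWeight (b s : ℝ) : ℝ≥0∞ :=
  (Set.Iio 1).indicator (fun s => ENNReal.ofReal ((1 - s) ^ (b - 1))) s

@[fun_prop]
theorem measurable_betaWeight (b : ℝ) : Measurable (betaWeight b) :=
  Measurable.indicator (by fun_prop) measurableSet_Iio

theorem betaWeight_of_lt {b s : ℝ} (hs : s < 1) :
    betaWeight b s = ENNReal.ofReal ((1 - s) ^ (b - 1)) := by
  simp [betaWeight, hs]

theorem betaWeight_of_le {b s : ℝ} (hs : 1 ≤ s) : betaWeight b s = 0 := by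
  simp [betaWeight, hs]

theorem lintegral_betaWeight {a b : ℝ} (ha : 0 < a) (hb : 0 < b) :
    ∫⁻ x, betaWeight b x ∂powMeasure a = ENNReal.ofReal (ProbabilityTheory.beta a b) := by
  have hB := ProbabilityTheory.beta_pos ha hb
  have h := ProbabilityTheory.lintegral_betaPDF_eq_one ha hb
  rw [ProbabilityTheory.lintegral_betaPDF] at h
  rw [lintegral_powMeasure a (by fun_prop)]
  have e : ∫⁻ x in Set.Ioi (0 : ℝ), ENNReal.ofReal (x ^ (a - 1)) * betaWeight b x =
      ∫⁻ x in Set.Ioo (0 : ℝ) 1, ENNReal.ofReal (ProbabilityTheory.beta a b) *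
        ENNReal.ofReal (1 / ProbabilityTheory.beta a b * x ^ (a - 1) * (1 - x) ^ (b - 1)) := by
    rw [← lintegral_indicator measurableSet_Ioi, ← lintegral_indicator measurableSet_Ioo]
    refine lintegral_congr fun x => ?_
    by_cases h0 : 0 < x
    · by_cases h1 : x < 1
      · rw [Set.indicator_of_mem (show x ∈ Set.Ioi 0 from h0),
          Set.indicator_of_mem (show x ∈ Set.Ioo 0 1 from ⟨h0, h1⟩), betaWeight_of_lt h1,
          ← ENNReal.ofReal_mul (Real.rpow_nonneg h0.le _), ← ENNReal.ofReal_mul hB.le]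
        congr 1
        field_simp
      · rw [Set.indicator_of_mem (show x ∈ Set.Ioi 0 from h0),
          Set.indicator_of_notMem (fun h => h1 h.2), betaWeight_of_le (not_lt.1 h1), mul_zero]
    · rw [Set.indicator_of_notMem (show x ∉ Set.Ioi 0 from h0),
        Set.indicator_of_notMem (fun h => h0 h.1)]
  rw [e, lintegral_const_mul _ (by fun_prop), h, mul_one]

theorem lintegral_Ioi_comp_mul {c : ℝ} (hc : 0 < c) {f : ℝ → ℝ≥0∞} (hf : Measurable f) :
    ∫⁻ x in Set.Ioi 0, f x = ENNReal.ofReal c * ∫⁻ x in Set.Ioi 0, f (c * x) := by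
  have h := Real.smul_map_volume_mul_left hc.ne'
  rw [← lintegral_indicator measurableSet_Ioi, ← lintegral_indicator measurableSet_Ioi,
    abs_of_pos hc] at *
  conv_lhs => rw [← h, lintegral_smul_measure,
    lintegral_map (hf.indicator measurableSet_Ioi) (by fun_prop)]
  congr 1
  refine lintegral_congr fun x => ?_
  simp [Set.indicator_apply, hc]

/-- This is the semigroup law of fractional integration: a power of order `b`, integrated to order
`a`, has order `a + b`. For `τ < 1` the substitution `x ↦ (1 - τ) x` factors `1 - x - τ` as `(1 -
τ)(1 - x)`; for `τ ≥ 1` both sides vanish. -/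
theorem lintegral_betaWeight_add {a b τ : ℝ} (ha : 0 < a) (hb : 0 < b) :
    ∫⁻ x, betaWeight b (x + τ) ∂powMeasure a =
      ENNReal.ofReal (ProbabilityTheory.beta a b) * betaWeight (a + b) τ := by
  rcases lt_or_ge τ 1 with hτ | hτ
  · have hc : 0 < 1 - τ := by linarith
    rw [betaWeight_of_lt hτ, ← lintegral_betaWeight ha hb, lintegral_powMeasure a (by fun_prop),
      lintegral_powMeasure a (by fun_prop), lintegral_Ioi_comp_mul hc (by fun_prop),
      ← lintegral_const_mul _ (by fun_prop), ← lintegral_mul_const _ (by fun_prop)]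
    refine setLIntegral_congr_fun measurableSet_Ioi fun x (hx : 0 < x) => ?_
    rcases lt_or_ge x 1 with h1 | h1
    · have h2 : (1 - τ) * x + τ < 1 := by nlinarith
      rw [betaWeight_of_lt h1, betaWeight_of_lt h2,
        ← ENNReal.ofReal_mul (by positivity), ← ENNReal.ofReal_mul hc.le,
        ← ENNReal.ofReal_mul (by positivity), ← ENNReal.ofReal_mul (by
          have : 0 < 1 - x := by linarith
          positivity)]
      congr 1
      rw [show 1 - ((1 - τ) * x + τ) = (1 - τ) * (1 - x) by ring,
        Real.mul_rpow hc.le hx.le, Real.mul_rpow hc.le (by linarith),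
        show a + b - 1 = 1 + (a - 1) + (b - 1) by ring, Real.rpow_add hc, Real.rpow_add hc,
        Real.rpow_one]
      ring
    · have h2 : 1 ≤ (1 - τ) * x + τ := by nlinarith
      rw [betaWeight_of_le h1, betaWeight_of_le h2]
      simp
  · rw [betaWeight_of_le hτ, mul_zero]
    refine (lintegral_congr_ae ((ae_powMeasure_pos a).mono fun x hx => ?_)).trans lintegral_zero
    exact betaWeight_of_le (by linarith)

/-! ### Polar coordinates -/

section Polar

variable {E : Type*} [NormedAddCommGroup E] [InnerProductSpace ℝ E] [FiniteDimensional ℝ E]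
  [MeasurableSpace E] [BorelSpace E] [Nontrivial E]

theorem lintegral_eq_lintegral_toSphere {f : E → ℝ≥0∞} (hf : Measurable f) :
    ∫⁻ x, f x = ∫⁻ ω, ∫⁻ r in Set.Ioi (0 : ℝ),
      ENNReal.ofReal (r ^ (Module.finrank ℝ E - 1)) * f (r • (ω : E))
        ∂volume ∂(volume : Measure E).toSphere := by
  have h1 : ∫⁻ x, f x = ∫⁻ x : ({(0 : E)}ᶜ : Set E), f x.1 ∂(volume.comap Subtype.val) := by
    rw [lintegral_subtype_comap (measurableSet_singleton _).compl, restrict_compl_singleton]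
  have hm : Measurable fun z : sphere (0 : E) 1 × Set.Ioi (0 : ℝ) =>
      f ((z.2 : ℝ) • (z.1 : E)) := hf.comp (by fun_prop)
  have h2 := (volume : Measure E).measurePreserving_homeomorphUnitSphereProd.lintegral_comp hm
  rw [h1, lintegral_prod _ hm.aemeasurable] at *
  rw [← (show _ = ∫⁻ x : ({(0 : E)}ᶜ : Set E), f x.1 ∂(volume.comap Subtype.val) from
    lintegral_congr fun x => ?_), h2]
  · refine lintegral_congr fun ω => ?_
    have hω : Measurable fun r : Set.Ioi (0 : ℝ) => f ((r : ℝ) • (ω : E)) :=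
      hf.comp (by fun_prop)
    rw [Measure.volumeIoiPow]
    refine (lintegral_withDensity_eq_lintegral_mul _ (by fun_prop) hω).trans ?_
    exact lintegral_subtype_comap measurableSet_Ioi (fun r : ℝ =>
      ENNReal.ofReal (r ^ (Module.finrank ℝ E - 1)) * f (r • (ω : E)))
  · congr 1
    have hx : ‖(x : E)‖ ≠ 0 := norm_ne_zero_iff.2 x.2
    simp [smul_smul, hx]

theorem lintegral_exp_neg_norm_sq_mul_norm_rpow {t q : ℝ} (ht : 0 < t)
    (hq : -(Module.finrank ℝ E : ℝ) < q) :
    ∫⁻ x : E, ENNReal.ofReal (Real.exp (-(t * ‖x‖ ^ 2))) * ENNReal.ofReal ‖x‖ ^ q =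
      ENNReal.ofReal (Real.pi ^ ((Module.finrank ℝ E : ℝ) / 2) *
        (Real.Gamma ((Module.finrank ℝ E + q) / 2) / Real.Gamma ((Module.finrank ℝ E : ℝ) / 2)) *
        t ^ (-((Module.finrank ℝ E + q) / 2))) := by
  set d := Module.finrank ℝ E with hd
  have hd0 : 0 < d := Module.finrank_pos
  have hd1 : (0 : ℝ) < d := Nat.cast_pos.2 hd0
  have hG : 0 < Real.Gamma ((d : ℝ) / 2) := Real.Gamma_pos_of_pos (by positivity)
  have hG' : 0 < Real.Gamma ((d + q : ℝ) / 2) := Real.Gamma_pos_of_pos (by linarith)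
  have hI := integral_rpow_mul_exp_neg_mul_rpow (p := 2) (q := d - 1 + q) (b := t) two_pos
    (by linarith) ht
  rw [show (d - 1 + q + 1 : ℝ) = d + q by ring] at hI
  have hpos : 0 < t ^ (-(d + q : ℝ) / 2) * (1 / 2) * Real.Gamma ((d + q) / 2) := by positivity
  have hval : ∫⁻ r in Set.Ioi (0 : ℝ), ENNReal.ofReal (r ^ (d - 1)) *
      (ENNReal.ofReal (Real.exp (-(t * r ^ 2))) * ENNReal.ofReal r ^ q) =
      ENNReal.ofReal (t ^ (-(d + q : ℝ) / 2) * (1 / 2) * Real.Gamma ((d + q) / 2)) := by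
    rw [← hI, ofReal_integral_eq_lintegral_ofReal]
    · refine setLIntegral_congr_fun measurableSet_Ioi fun r (hr : 0 < r) => ?_
      rw [ENNReal.ofReal_rpow_of_pos hr, ← ENNReal.ofReal_mul (Real.exp_pos _).le,
        ← ENNReal.ofReal_mul (by positivity)]
      congr 1
      rw [Real.rpow_add hr, ← Nat.cast_pred hd0, Real.rpow_natCast, Real.rpow_two, neg_mul]
      ring
    · by_contra hc
      exact hpos.ne' (hI ▸ integral_undef hc)
    · exact (ae_restrict_mem measurableSet_Ioi).mono fun x (hx : 0 < x) =>
        mul_nonneg (Real.rpow_nonneg hx.le _) (Real.exp_pos _).le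
  rw [lintegral_eq_lintegral_toSphere (by fun_prop)]
  have hcongr : ∀ ω : sphere (0 : E) 1, ∫⁻ r in Set.Ioi (0 : ℝ), ENNReal.ofReal (r ^ (d - 1)) *
      (ENNReal.ofReal (Real.exp (-(t * ‖r • (ω : E)‖ ^ 2))) * ENNReal.ofReal ‖r • (ω : E)‖ ^ q) =
      ENNReal.ofReal (t ^ (-(d + q : ℝ) / 2) * (1 / 2) * Real.Gamma ((d + q) / 2)) := by
    intro ω
    rw [← hval]
    refine setLIntegral_congr_fun measurableSet_Ioi fun r (hr : 0 < r) => ?_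
    have : ‖r • (ω : E)‖ = r := by simp [norm_smul, abs_of_pos hr]
    simp only [this]
  simp only [hcongr, lintegral_const, Measure.toSphere_apply_univ, InnerProductSpace.volume_ball,
    ← hd]
  rw [ENNReal.ofReal_one, one_pow, one_mul, ← ENNReal.ofReal_natCast d,
    ← ENNReal.ofReal_mul hd1.le, ← ENNReal.ofReal_mul hpos.le]
  congr 1
  rw [Real.Gamma_add_one (by positivity), Real.sqrt_eq_rpow, ← Real.rpow_natCast,
    ← Real.rpow_mul Real.pi_pos.le, neg_div, show (1 / 2 * (d : ℝ)) = d / 2 by ring]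
  field_simp

end Polar

/-! ### From Gaussian moments to beta moments, by uniqueness of Laplace transforms. -/

section LaplaceMoments

variable {E : Type} [NormedAddCommGroup E] [InnerProductSpace ℝ E] [FiniteDimensional ℝ E]
  [MeasurableSpace E] [BorelSpace E] {n : ℕ}

/-- The `q`-th moment of `Δ` with respect to centred Gaussians of arbitrary variances is
`C (∑ t_i)^{q/2} ∏ t_i^{-(d+q)/2}`. -/
def HasGaussianMoment (Δ : (Fin n → E) → ℝ) (C q : ℝ) : Prop :=
  ∀ t : Fin n → ℝ, (∀ i, 0 < t i) →
    ∫⁻ m, ENNReal.ofReal (Real.exp (-∑ i, t i * ‖m i‖ ^ 2)) * ENNReal.ofReal (Δ m) ^ q =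
      ENNReal.ofReal (C * (∑ i, t i) ^ (q / 2) *
        ∏ i, t i ^ (-((Module.finrank ℝ E + q) / 2)))

/-- The (unnormalised) `q`-th moment of `Δ` for independent points with density
`(1 - ‖m‖²)_+ ^ (b - 1)`. -/
def betaMoment (Δ : (Fin n → E) → ℝ) (q b : ℝ) : ℝ≥0∞ :=
  ∫⁻ m : Fin n → E, (∏ i, betaWeight b (‖m i‖ ^ 2)) * ENNReal.ofReal (Δ m) ^ q

theorem lintegral_pi_comp_smul {c : ℝ} (hc : 0 < c) {F : (Fin n → E) → ℝ≥0∞}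
    (hF : Measurable F) :
    ∫⁻ m, F m = ENNReal.ofReal (c ^ (n * Module.finrank ℝ E : ℝ)) * ∫⁻ m, F (c • m) := by
  have h := Measure.map_addHaar_smul (volume : Measure (Fin n → E)) hc.ne'
  have hd : Module.finrank ℝ (Fin n → E) = n * Module.finrank ℝ E := by
    simp [Module.finrank_pi_fintype]
  have h2 : ∫⁻ m, F (c • m) = ENNReal.ofReal |(c ^ (n * Module.finrank ℝ E))⁻¹| * ∫⁻ m, F m := by
    rw [← lintegral_map hF (by fun_prop), h, lintegral_smul_measure, hd, smul_eq_mul]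
  rw [h2, ← mul_assoc, ← ENNReal.ofReal_mul (by positivity), abs_of_pos (by positivity),
    ← Nat.cast_mul, Real.rpow_natCast, mul_inv_cancel₀ (by positivity), ENNReal.ofReal_one,
    one_mul]

variable {Δ : (Fin n → E) → ℝ} {C q b : ℝ}

theorem prod_rpow_neg_mul {t : Fin n → ℝ} (a x : ℝ) :
    ∏ i, (t i ^ (-a) * x) = (∏ i, t i ^ (-a)) * x ^ n := by
  simp [Finset.prod_mul_distrib]

theorem lintegral_exp_pi_powMeasure {a : ℝ} (ha : 0 < a) {t : Fin n → ℝ} (ht : ∀ i, 0 < t i) :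
    ∫⁻ x, ENNReal.ofReal (Real.exp (-∑ i, t i * x i))
      ∂(Measure.pi fun _ : Fin n => powMeasure a) =
      ENNReal.ofReal ((∏ i, t i ^ (-a)) * Real.Gamma a ^ n) := by
  have h := lintegral_pi_prod (powMeasure a) (fun (i : Fin n) x =>
    ENNReal.ofReal (Real.exp (-(t i * x)))) fun i => by fun_prop
  simp_rw [← Finset.sum_neg_distrib, Real.exp_sum,
    ENNReal.ofReal_prod_of_nonneg fun i _ => (Real.exp_pos _).le]
  rw [h, ← prod_rpow_neg_mul, ENNReal.ofReal_prod_of_nonneg fun i _ => mul_nonneg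
    (Real.rpow_nonneg (ht i).le _) (Real.Gamma_pos_of_pos ha).le]
  exact Finset.prod_congr rfl fun i _ => lintegral_exp_powMeasure ha (ht i)

/-- A common shift `τ` of all coordinates enters the exponent only through `T τ` with `T = ∑ t_i`,
so it factors out as a one-dimensional gamma integral. This is how powers of `T` are produced or
removed. -/
theorem lintegral_exp_prod_powMeasure {α : Type*} [MeasurableSpace α] (μ : Measure α) [SFinite μ]
    {X : α → Fin n → ℝ} (hX : Measurable X) {p : ℝ} (hp : 0 < p) {t : Fin n → ℝ}
    (hT : 0 < ∑ i, t i) :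
    ∫⁻ z, ENNReal.ofReal (Real.exp (-∑ i, t i * (X z.1 i + z.2))) ∂(μ.prod (powMeasure p)) =
      (∫⁻ a, ENNReal.ofReal (Real.exp (-∑ i, t i * X a i)) ∂μ) *
        ENNReal.ofReal ((∑ i, t i) ^ (-p) * Real.Gamma p) := by
  rw [← lintegral_exp_powMeasure hp hT, ← lintegral_prod_mul (by fun_prop) (by fun_prop)]
  refine lintegral_congr fun z => ?_
  rw [← ENNReal.ofReal_mul (Real.exp_pos _).le, ← Real.exp_add]
  congr 2
  simp only [mul_add, Finset.sum_add_distrib, ← Finset.sum_mul]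
  ring

theorem lintegral_prod_betaWeight_add {a τ : ℝ} (ha : 0 < a) (hb : 0 < b) :
    ∫⁻ x, ∏ i, betaWeight b (x i + τ) ∂(Measure.pi fun _ : Fin n => powMeasure a) =
      ENNReal.ofReal (ProbabilityTheory.beta a b) ^ n * betaWeight (a + b) τ ^ n := by
  rw [lintegral_pi_prod (powMeasure a) (fun _ x => betaWeight b (x + τ)) fun i => by fun_prop]
  simp [lintegral_betaWeight_add ha hb, mul_pow]

theorem prod_betaWeight_pow {a y τ : ℝ} (hn : 0 < n) (hy : y = n * (a - 1) + 1) :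
    betaWeight a τ ^ n = betaWeight y τ := by
  rcases lt_or_ge τ 1 with h | h
  · have h1 : 0 < 1 - τ := by linarith
    rw [betaWeight_of_lt h, betaWeight_of_lt h, ← ENNReal.ofReal_pow (by positivity),
      ← Real.rpow_natCast, ← Real.rpow_mul h1.le, hy]
    ring_nf
  · simp [betaWeight_of_le h, hn.ne']

/-- For `q < 0` the factor `T^{q/2}` is itself a Laplace transform, that of a common shift `τ` with
density `τ^{-q/2-1}` up to a constant. The squared norms under `Δ^q dm` are therefore distributed
like independent variables plus `τ`. Integrating the product of beta weights first over these
variables and then over `τ` gives the beta functions; `hy` is convergence of the last integral. -/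
theorem HasGaussianMoment.betaMoment_of_neg (h : HasGaussianMoment Δ C q) (hΔ : Measurable Δ)
    (hC : 0 < C) (hn : 0 < n) (hq : q < 0) (ha : 0 < (Module.finrank ℝ E + q) / 2) (hb : 0 < b)
    (hy : 0 < n * ((Module.finrank ℝ E + q) / 2 + b - 1) + 1) :
    betaMoment Δ q b =
      ENNReal.ofReal (C / (Real.Gamma ((Module.finrank ℝ E + q) / 2) ^ n *
        Real.Gamma (-q / 2))) *
      (ENNReal.ofReal (ProbabilityTheory.beta ((Module.finrank ℝ E + q) / 2) b) ^ n *
      ENNReal.ofReal (ProbabilityTheory.beta (-q / 2)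
        (n * ((Module.finrank ℝ E + q) / 2 + b - 1) + 1))) := by
  set a := (Module.finrank ℝ E + q) / 2
  have hp : 0 < -q / 2 := by linarith
  have hGa := Real.Gamma_pos_of_pos ha
  have hGp := Real.Gamma_pos_of_pos hp
  set k := C / (Real.Gamma a ^ n * Real.Gamma (-q / 2)) with hk
  have hkp : 0 < k := by positivity
  have hΔq : Measurable fun m => ENNReal.ofReal (Δ m) ^ q := by fun_prop
  set μ : Measure (Fin n → E) := volume.withDensity fun m => ENNReal.ofReal (Δ m) ^ q with hμ
  set ν : Measure ((Fin n → ℝ) × ℝ) := ENNReal.ofReal k •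
    ((Measure.pi fun _ : Fin n => powMeasure a).prod (powMeasure (-q / 2))) with hν
  have hμi : ∀ {f : (Fin n → E) → ℝ≥0∞}, Measurable f →
      ∫⁻ m, f m ∂μ = ∫⁻ m, f m * ENNReal.ofReal (Δ m) ^ q := fun {f} hf => by
    rw [hμ, lintegral_withDensity_eq_lintegral_mul _ hΔq hf]
    exact lintegral_congr fun m => mul_comm _ _
  have hν0 : ∀ᵐ z ∂ν, ∀ i, 0 ≤ z.1 i + z.2 := by
    refine Measure.smul_absolutelyContinuous.ae_le ?_
    have h1 : ∀ᵐ x ∂(Measure.pi fun _ : Fin n => powMeasure a), ∀ i, 0 < x i :=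
      ae_all_iff.2 fun i => (Measure.quasiMeasurePreserving_eval _ i).ae (ae_powMeasure_pos a)
    filter_upwards [Measure.quasiMeasurePreserving_fst.ae h1,
      Measure.quasiMeasurePreserving_snd.ae (ae_powMeasure_pos (-q / 2))] with z hz hz' i
    linarith [hz i]
  have hL : ∀ t : Fin n → ℝ, (∀ i, 0 < t i) →
      ∫⁻ m, ENNReal.ofReal (Real.exp (-∑ i, t i * ‖m i‖ ^ 2)) ∂μ =
        ENNReal.ofReal (C * (∑ i, t i) ^ (q / 2) * ∏ i, t i ^ (-a)) := fun t ht => by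
    rw [hμi (by fun_prop)]; exact h t ht
  have hR : ∀ t : Fin n → ℝ, (∀ i, 0 < t i) →
      ∫⁻ z, ENNReal.ofReal (Real.exp (-∑ i, t i * (z.1 i + z.2))) ∂ν =
        ENNReal.ofReal (C * (∑ i, t i) ^ (q / 2) * ∏ i, t i ^ (-a)) := fun t ht => by
    have hT : 0 < ∑ i, t i := Finset.sum_pos (fun i _ => ht i) ⟨⟨0, hn⟩, Finset.mem_univ _⟩
    have hP : 0 < ∏ i, t i ^ (-a) := Finset.prod_pos fun i _ => Real.rpow_pos_of_pos (ht i) _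
    rw [hν, lintegral_smul_measure, lintegral_exp_prod_powMeasure _ (X := fun x => x)
      measurable_id hp hT,
      lintegral_exp_pi_powMeasure ha ht, smul_eq_mul,
      ← ENNReal.ofReal_mul (by positivity), ← ENNReal.ofReal_mul hkp.le]
    congr 1
    rw [hk, show -(-q / 2) = q / 2 by ring]
    generalize Real.Gamma (-q / 2) = g at hGp ⊢
    field_simp
  have key := lintegral_comp_eq_of_laplace (μ := μ) (ν := ν) (X := fun m i => ‖m i‖ ^ 2)
    (Y := fun z i => z.1 i + z.2) (by fun_prop) (by fun_prop)
    (ae_of_all _ fun m i => by positivity) hν0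
    (fun t ht => by rw [hL t ht]; exact ENNReal.ofReal_ne_top)
    (fun t ht => by rw [hL t ht, hR t ht])
    (g := fun s => ∏ i, betaWeight b (s i))
    (Finset.measurable_prod _ fun i _ => by fun_prop)
  rw [hμi (Finset.measurable_prod _ fun i _ => by fun_prop)] at key
  rw [betaMoment, key, hν, lintegral_smul_measure, smul_eq_mul]
  congr 1
  rw [lintegral_prod_symm _ (Finset.measurable_prod _ fun i _ => by fun_prop).aemeasurable]
  simp_rw [lintegral_prod_betaWeight_add ha hb,
    prod_betaWeight_pow (a := a + b) hn rfl]
  rw [lintegral_const_mul _ (by fun_prop), lintegral_betaWeight hp hy]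

/-- Scaling `m` by `√(1 - τ)` pulls out a power of `1 - τ`. Its exponent `y - 1` collects `N q / 2`
from `Δ^q`, `d / 2` per point from Lebesgue measure (with `d` the dimension of `E`) and `b - 1` per
point from the weights. -/
theorem lintegral_prod_betaWeight_norm_sq_add {N : ℕ} (hΔ : Measurable Δ)
    (hhom : ∀ (c : ℝ) m, 0 ≤ c → Δ (c • m) = c ^ N * Δ m)
    (hn : 0 < n) (hq : 0 < q) {y : ℝ}
    (hy : y = N * q / 2 + n * (Module.finrank ℝ E / 2 + b - 1) + 1) (τ : ℝ) :
    ∫⁻ m : Fin n → E, (∏ i, betaWeight b (‖m i‖ ^ 2 + τ)) * ENNReal.ofReal (Δ m) ^ q =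
      betaMoment Δ q b * betaWeight y τ := by
  have hm : Measurable fun m : Fin n → E =>
      (∏ i, betaWeight b (‖m i‖ ^ 2 + τ)) * ENNReal.ofReal (Δ m) ^ q :=
    (Finset.measurable_prod _ fun i _ => by fun_prop).mul (by fun_prop)
  have hm' : Measurable fun m : Fin n → E =>
      (∏ i, betaWeight b (‖m i‖ ^ 2)) * ENNReal.ofReal (Δ m) ^ q :=
    (Finset.measurable_prod _ fun i _ => by fun_prop).mul (by fun_prop)
  rcases lt_or_ge τ 1 with hτ | hτ
  · have h1 : 0 < 1 - τ := by linarith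
    have hc : 0 < √(1 - τ) := Real.sqrt_pos.2 h1
    have hw : ∀ x : ℝ, betaWeight b ((1 - τ) * x + τ) =
        ENNReal.ofReal ((1 - τ) ^ (b - 1)) * betaWeight b x := fun x => by
      rcases lt_or_ge x 1 with hx | hx
      · rw [betaWeight_of_lt hx, betaWeight_of_lt (by nlinarith),
          ← ENNReal.ofReal_mul (by positivity), ← Real.mul_rpow h1.le (by linarith)]
        ring_nf
      · rw [betaWeight_of_le hx, betaWeight_of_le (by nlinarith), mul_zero]
    rw [lintegral_pi_comp_smul hc hm, betaMoment,
      ← lintegral_const_mul' _ _ ENNReal.ofReal_ne_top,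
      ← lintegral_mul_const _ hm']
    refine lintegral_congr fun m => ?_
    have e1 : ∀ i, ‖(√(1 - τ) • m) i‖ ^ 2 + τ = (1 - τ) * ‖m i‖ ^ 2 + τ := fun i => by
      rw [Pi.smul_apply, norm_smul, mul_pow, Real.norm_of_nonneg hc.le, Real.sq_sqrt h1.le]
    simp_rw [e1, hw, hhom _ _ hc.le, Finset.prod_mul_distrib, Finset.prod_const, Finset.card_univ,
      Fintype.card_fin]
    rw [ENNReal.ofReal_mul (by positivity), ENNReal.mul_rpow_of_nonneg _ _ hq.le,
      ENNReal.ofReal_rpow_of_nonneg (by positivity) hq.le, ← ENNReal.ofReal_pow (by positivity),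
      betaWeight_of_lt hτ]
    have e2 : ENNReal.ofReal ((1 - τ) ^ (y - 1)) =
        ENNReal.ofReal (√(1 - τ) ^ (n * Module.finrank ℝ E : ℝ)) *
          (ENNReal.ofReal (((1 - τ) ^ (b - 1)) ^ n) *
            ENNReal.ofReal ((√(1 - τ) ^ N) ^ q)) := by
      rw [← ENNReal.ofReal_mul (by positivity), ← ENNReal.ofReal_mul (by positivity)]
      congr 1
      rw [Real.sqrt_eq_rpow, ← Real.rpow_natCast, ← Real.rpow_natCast, ← Real.rpow_mul h1.le,
        ← Real.rpow_mul h1.le, ← Real.rpow_mul h1.le, ← Real.rpow_mul h1.le, ← Real.rpow_add h1,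
        ← Real.rpow_add h1, hy]
      congr 1
      ring
    rw [e2]
    ring
  · rw [betaWeight_of_le hτ, mul_zero]
    refine (lintegral_congr fun m => ?_).trans lintegral_zero
    have h0 : betaWeight b (‖m ⟨0, hn⟩‖ ^ 2 + τ) = 0 :=
      betaWeight_of_le (by nlinarith [sq_nonneg ‖m ⟨0, hn⟩‖])
    rw [Finset.prod_eq_zero (Finset.mem_univ (⟨0, hn⟩ : Fin n)) h0, zero_mul]

/-- For `q > 0` the factor `T^{q/2}` is removed rather than represented: adding to every `‖m_i‖²` a
common `τ` with density `τ^{q/2-1}` cancels it and leaves independent coordinates. By homogeneity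
the `τ`-integral splits off as a beta function, which is why it multiplies the unknown moment. -/
theorem HasGaussianMoment.betaMoment_mul_of_pos {N : ℕ} (h : HasGaussianMoment Δ C q)
    (hΔ : Measurable Δ) (hhom : ∀ (c : ℝ) m, 0 ≤ c → Δ (c • m) = c ^ N * Δ m)
    (hC : 0 < C) (hn : 0 < n) (hq : 0 < q) (hb : 0 < b)
    (hy : 0 < N * q / 2 + n * (Module.finrank ℝ E / 2 + b - 1) + 1) :
    betaMoment Δ q b * ENNReal.ofReal (ProbabilityTheory.beta (q / 2)
        (N * q / 2 + n * (Module.finrank ℝ E / 2 + b - 1) + 1)) =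
      ENNReal.ofReal (C * Real.Gamma (q / 2) /
        Real.Gamma ((Module.finrank ℝ E + q) / 2) ^ n) *
      ENNReal.ofReal (ProbabilityTheory.beta ((Module.finrank ℝ E + q) / 2) b) ^ n := by
  have ha : 0 < (Module.finrank ℝ E + q) / 2 := by positivity
  set a := (Module.finrank ℝ E + q) / 2
  have hp : 0 < q / 2 := by linarith
  have hGa := Real.Gamma_pos_of_pos ha
  have hGp := Real.Gamma_pos_of_pos hp
  set k := C * Real.Gamma (q / 2) / Real.Gamma a ^ n with hk
  have hkp : 0 < k := by positivity
  have hΔq : Measurable fun m => ENNReal.ofReal (Δ m) ^ q := by fun_prop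
  set μ₀ : Measure (Fin n → E) := volume.withDensity fun m => ENNReal.ofReal (Δ m) ^ q with hμ₀
  set μ : Measure ((Fin n → E) × ℝ) := μ₀.prod (powMeasure (q / 2)) with hμ
  set ν : Measure (Fin n → ℝ) := ENNReal.ofReal k •
    (Measure.pi fun _ : Fin n => powMeasure a) with hν
  have hμi : ∀ {f : (Fin n → E) → ℝ≥0∞}, Measurable f →
      ∫⁻ m, f m ∂μ₀ = ∫⁻ m, f m * ENNReal.ofReal (Δ m) ^ q := fun {f} hf => by
    rw [hμ₀, lintegral_withDensity_eq_lintegral_mul _ hΔq hf]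
    exact lintegral_congr fun m => mul_comm _ _
  have hμ0 : ∀ᵐ z ∂μ, ∀ i, 0 ≤ ‖z.1 i‖ ^ 2 + z.2 := by
    filter_upwards [Measure.quasiMeasurePreserving_snd.ae (ae_powMeasure_pos (q / 2))] with z hz i
    positivity
  have hν0 : ∀ᵐ x ∂ν, ∀ i, 0 ≤ x i :=
    Measure.smul_absolutelyContinuous.ae_le (ae_all_iff.2 fun i =>
      (Measure.quasiMeasurePreserving_eval _ i).ae ((ae_powMeasure_pos a).mono fun _ => le_of_lt))
  have hR : ∀ t : Fin n → ℝ, (∀ i, 0 < t i) →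
      ∫⁻ x, ENNReal.ofReal (Real.exp (-∑ i, t i * x i)) ∂ν =
        ENNReal.ofReal (C * Real.Gamma (q / 2) * ∏ i, t i ^ (-a)) := fun t ht => by
    have hP : 0 < ∏ i, t i ^ (-a) := Finset.prod_pos fun i _ => Real.rpow_pos_of_pos (ht i) _
    rw [hν, lintegral_smul_measure, lintegral_exp_pi_powMeasure ha ht, smul_eq_mul,
      ← ENNReal.ofReal_mul hkp.le]
    congr 1
    rw [hk]
    field_simp
  have hL : ∀ t : Fin n → ℝ, (∀ i, 0 < t i) →
      ∫⁻ z, ENNReal.ofReal (Real.exp (-∑ i, t i * (‖z.1 i‖ ^ 2 + z.2))) ∂μ =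
        ENNReal.ofReal (C * Real.Gamma (q / 2) * ∏ i, t i ^ (-a)) := fun t ht => by
    have hT : 0 < ∑ i, t i := Finset.sum_pos (fun i _ => ht i) ⟨⟨0, hn⟩, Finset.mem_univ _⟩
    have hP : 0 < ∏ i, t i ^ (-a) := Finset.prod_pos fun i _ => Real.rpow_pos_of_pos (ht i) _
    rw [hμ, lintegral_exp_prod_powMeasure _ (X := fun (m : Fin n → E) i => ‖m i‖ ^ 2) (by fun_prop)
      hp hT,
      hμi (by fun_prop), h t ht, ← ENNReal.ofReal_mul (by positivity)]
    congr 1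
    have : (∑ i, t i) ^ (q / 2) * (∑ i, t i) ^ (-(q / 2)) = 1 := by
      rw [← Real.rpow_add hT]; simp
    linear_combination (C * Real.Gamma (q / 2) * ∏ i, t i ^ (-a)) * this
  have key := lintegral_comp_eq_of_laplace (μ := μ) (ν := ν) (X := fun z i => ‖z.1 i‖ ^ 2 + z.2)
    (Y := fun x => x) (by fun_prop) (by fun_prop) hμ0 hν0
    (fun t ht => by rw [hL t ht]; exact ENNReal.ofReal_ne_top)
    (fun t ht => by rw [hL t ht, hR t ht])
    (g := fun s => ∏ i, betaWeight b (s i))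
    (Finset.measurable_prod _ fun i _ => by fun_prop)
  rw [hμ, lintegral_prod_symm _
    (Finset.measurable_prod _ fun i _ => by fun_prop).aemeasurable] at key
  have e3 : ∀ τ : ℝ, ∫⁻ m, ∏ i, betaWeight b (‖m i‖ ^ 2 + τ) ∂μ₀ = betaMoment Δ q b *
      betaWeight (N * q / 2 + n * (Module.finrank ℝ E / 2 + b - 1) + 1) τ := fun τ => by
    rw [hμi (Finset.measurable_prod _ fun i _ => by fun_prop)]
    exact lintegral_prod_betaWeight_norm_sq_add hΔ hhom hn hq rfl τ
  simp_rw [e3] at key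
  rw [lintegral_const_mul _ (by fun_prop), lintegral_betaWeight hp hy] at key
  rw [key, hν, lintegral_smul_measure, smul_eq_mul]
  congr 1
  rw [lintegral_pi_prod (powMeasure a) (fun _ x => betaWeight b x) fun i => by fun_prop]
  simp [lintegral_betaWeight ha hb]

end LaplaceMoments

/-! ### Absolute determinants over a division algebra -/

/-- The matrix whose columns are the given vectors. -/
def colMatrix {F : Type} {n k : ℕ} (x : Fin k → EuclideanSpace F (Fin n)) :
    Matrix (Fin n) (Fin k) F :=
  Matrix.of fun i j => x j i

section AbsDet

variable {F : Type} [NormedDivisionRing F] [StarRing F] [InnerProductSpace ℝ F]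

/-- The properties of the modulus of the determinant that determine its moments: `F` is a normed
division algebra with involution whose norm is given by the real inner product `Re (a * star b)`,
and `D` is multiplicative, continuous, correct on real matrices, and satisfies the expansion rule
for a first column supported on its first entry. -/
structure IsAbsDet (D : ∀ n : ℕ, Matrix (Fin n) (Fin n) F → ℝ) : Prop where
  inner_mul_left : ∀ a b c : F, inner ℝ (a * b) c = inner ℝ b (star a * c)
  smul_mul : ∀ (r : ℝ) (a b : F), (r • a) * b = r • (a * b)
  mul_smul : ∀ (r : ℝ) (a b : F), a * (r • b) = r • (a * b)
  star_smul : ∀ (r : ℝ) (a : F), star (r • a) = r • star a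
  star_mul_self : ∀ a : F, star a * a = (‖a‖ ^ 2) • (1 : F)
  continuous : ∀ n, Continuous (D n)
  nonneg : ∀ n M, 0 ≤ D n M
  of_isEmpty : ∀ M, D 0 M = 1
  map_mul : ∀ n M M', D n (M * M') = D n M * D n M'
  map_real : ∀ n (S : Matrix (Fin n) (Fin n) ℝ), D n (S.map fun r => r • (1 : F)) = |S.det|
  expand : ∀ n (M : Matrix (Fin (n + 1)) (Fin (n + 1)) F), (∀ i : Fin n, M i.succ 0 = 0) →
    D (n + 1) M = ‖M 0 0‖ * D n (M.submatrix Fin.succ Fin.succ)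

variable {D : ∀ n : ℕ, Matrix (Fin n) (Fin n) F → ℝ}

namespace IsAbsDet

theorem map_one (hD : IsAbsDet D) (n : ℕ) : D n 1 = 1 := by
  have h := hD.map_real n 1
  rw [Matrix.map_one (fun r : ℝ => r • (1 : F)) (zero_smul _ _) (one_smul _ _)] at h
  simpa using h

theorem norm_mul_sq (hD : IsAbsDet D) (a b : F) : ‖a * b‖ ^ 2 = ‖a‖ ^ 2 * ‖b‖ ^ 2 := by
  rw [← real_inner_self_eq_norm_sq, hD.inner_mul_left, ← mul_assoc, hD.star_mul_self,
    hD.smul_mul, one_mul, real_inner_smul_right, real_inner_self_eq_norm_sq]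

/-- Householder reflection carrying a nonzero vector to a multiple of the first basis vector. -/
theorem exists_reflection (hD : IsAbsDet D) {n : ℕ} (g : Fin (n + 1) → F) (hg : g ≠ 0) :
    ∃ U : Matrix (Fin (n + 1)) (Fin (n + 1)) F, U * U = 1 ∧
      (∀ y : Fin (n + 1) → F, ∑ i, ‖(U.mulVec y) i‖ ^ 2 = ∑ i, ‖y i‖ ^ 2) ∧
      ∀ i : Fin n, (U.mulVec g) i.succ = 0 := by
  set ρ : ℝ := √(∑ i, ‖g i‖ ^ 2) with hρ
  have hsum : 0 < ∑ i, ‖g i‖ ^ 2 := by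
    obtain ⟨i, hi⟩ := Function.ne_iff.1 hg
    exact Finset.sum_pos' (fun i _ => by positivity)
      ⟨i, Finset.mem_univ _, by have := norm_pos_iff.2 hi; positivity⟩
  have hρ0 : 0 < ρ := Real.sqrt_pos.2 hsum
  have hρ2 : ρ ^ 2 = ∑ i, ‖g i‖ ^ 2 := Real.sq_sqrt hsum.le
  obtain ⟨u, hu1, hu⟩ : ∃ u : F, ‖u‖ = 1 ∧ g 0 = ‖g 0‖ • u := by
    by_cases h0 : g 0 = 0
    · exact ⟨1, by simp, by simp [h0]⟩
    · have h1 : ‖g 0‖ ≠ 0 := norm_ne_zero_iff.2 h0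
      exact ⟨‖g 0‖⁻¹ • g 0, by rw [norm_smul]; simp [h1], by rw [smul_smul]; simp [h1]⟩
  -- The added vector has the phase `u` of `g 0`, so nothing cancels: `‖w‖² = 2 (ρ² + ρ ‖g 0‖)` is
  -- positive even when `g` already lies on the axis.
  set w : Fin (n + 1) → F := g + Pi.single 0 (ρ • u) with hw
  set ν : ℝ := 2 * (ρ ^ 2 + ρ * ‖g 0‖) with hν
  have hν0 : 0 < ν := by positivity
  set σ : (Fin (n + 1) → F) → F := fun y => ∑ j, star (w j) * y j with hσ
  have hw0 : w 0 = (‖g 0‖ + ρ) • u := by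
    rw [hw, Pi.add_apply, Pi.single_eq_same, hu, add_smul, norm_smul, hu1]
    simp
  have hws : ∀ i : Fin n, w i.succ = g i.succ := fun i => by simp [hw]
  have hnw : ∑ i, ‖w i‖ ^ 2 = ν := by
    rw [Fin.sum_univ_succ] at hρ2 ⊢
    simp only [hws, hw0, norm_smul, hu1, mul_one, Real.norm_eq_abs, sq_abs]
    rw [hν]
    linarith
  have hσw : σ w = ν • (1 : F) := by
    simp only [hσ, hD.star_mul_self, ← Finset.sum_smul, hnw]
  -- The pairing of `w` with `g` is real and equals half of `‖w‖²`, so the reflection sends `g` to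
  -- `g - w = -ρ u e_0`. That these scalars are real is what makes the computation work in a
  -- noncommutative algebra.
  have hσg : σ g = (ν / 2) • (1 : F) := by
    have e0 : star (w 0) * g 0 = ((‖g 0‖ + ρ) * ‖g 0‖) • (1 : F) := by
      rw [hw0]
      conv_lhs => rw [hu]
      rw [hD.star_smul, hD.smul_mul, hD.mul_smul, hD.star_mul_self, hu1, norm_smul, hu1]
      simp [smul_smul]
    rw [Fin.sum_univ_succ] at hρ2
    simp only [hσ]
    rw [Fin.sum_univ_succ, e0]
    simp only [hws, hD.star_mul_self, ← Finset.sum_smul, ← add_smul]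
    congr 1
    rw [hν]
    linarith
  set U : Matrix (Fin (n + 1)) (Fin (n + 1)) F :=
    Matrix.of fun i j => (1 : Matrix (Fin (n + 1)) (Fin (n + 1)) F) i j -
      (2 / ν) • (w i * star (w j)) with hU
  have hUy : ∀ y i, (U.mulVec y) i = y i - (2 / ν) • (w i * σ y) := fun y i => by
    simp only [hU, Matrix.mulVec, dotProduct, Matrix.of_apply, sub_mul, Finset.sum_sub_distrib,
      Matrix.one_apply, ite_mul, one_mul, zero_mul, Finset.sum_ite_eq, Finset.mem_univ, if_true,
      hD.smul_mul, ← Finset.smul_sum, hσ, Finset.mul_sum, mul_assoc]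
  have hσU : ∀ y, σ (U.mulVec y) = -σ y := fun y => by
    have : σ (U.mulVec y) = σ y - (2 / ν) • (σ w * σ y) := by
      simp only [hσ, hUy, mul_sub, Finset.sum_sub_distrib, hD.mul_smul, ← Finset.smul_sum,
        Finset.sum_mul, mul_assoc]
    rw [this, hσw, hD.smul_mul, smul_smul, one_mul, div_mul_cancel₀ _ hν0.ne', two_smul]
    abel
  have hUU : ∀ y, U.mulVec (U.mulVec y) = y := fun y => by
    ext i
    rw [hUy, hσU, hUy]
    simp
  refine ⟨U, ?_, fun y => ?_, fun i => ?_⟩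
  · ext i k
    have := congrFun (hUU (Pi.single k 1)) i
    rw [Matrix.mulVec_mulVec, Matrix.mulVec_single_one] at this
    rw [← Matrix.col_apply (U * U), this, Matrix.one_apply, Pi.single_apply]
  · have e : ∀ i, ‖(U.mulVec y) i‖ ^ 2 = ‖y i‖ ^ 2 -
        2 * (2 / ν) * inner ℝ (σ y) (star (w i) * y i) + (2 / ν) ^ 2 * (‖w i‖ ^ 2 * ‖σ y‖ ^ 2) := by
      intro i
      rw [hUy, norm_sub_sq_real, norm_smul, mul_pow, hD.norm_mul_sq, real_inner_smul_right,
        real_inner_comm, hD.inner_mul_left, Real.norm_eq_abs, sq_abs]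
      ring
    simp only [e, Finset.sum_add_distrib, Finset.sum_sub_distrib, ← Finset.mul_sum,
      ← Finset.sum_mul, ← inner_sum, hnw]
    rw [show ∑ i, star (w i) * y i = σ y from rfl, real_inner_self_eq_norm_sq]
    field_simp
    ring
  · rw [hUy, hσg, hD.mul_smul, smul_smul, mul_one, hws]
    have : 2 / ν * (ν / 2) = 1 := by field_simp
    rw [this, one_smul, sub_self]

theorem map_reflection (hD : IsAbsDet D) {n : ℕ} {U : Matrix (Fin n) (Fin n) F}
    (hU : U * U = 1) : D n U = 1 := by
  have h := hD.map_mul n U U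
  rw [hU, hD.map_one] at h
  nlinarith [hD.nonneg n U]

end IsAbsDet

end AbsDet

/-! ### Gaussian integrals and linear changes of variables -/

theorem lintegral_exp_neg_mul_norm_sq {E : Type*} [NormedAddCommGroup E] [InnerProductSpace ℝ E]
    [FiniteDimensional ℝ E] [MeasurableSpace E] [BorelSpace E] {t : ℝ} (ht : 0 < t) :
    ∫⁻ x : E, ENNReal.ofReal (Real.exp (-(t * ‖x‖ ^ 2))) =
      ENNReal.ofReal ((Real.pi / t) ^ ((Module.finrank ℝ E : ℝ) / 2)) := by
  have h := GaussianFourier.integral_rexp_neg_mul_sq_norm (V := E) ht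
  have hpos : 0 < (Real.pi / t) ^ ((Module.finrank ℝ E : ℝ) / 2) :=
    Real.rpow_pos_of_pos (div_pos Real.pi_pos ht) _
  rw [← h, ofReal_integral_eq_lintegral_ofReal]
  · simp_rw [neg_mul]
  · by_contra hc
    exact hpos.ne' (h ▸ integral_undef hc)
  · exact ae_of_all _ fun _ => (Real.exp_pos _).le

theorem ofReal_exp_neg_sum {ι : Type*} (s : Finset ι) (f : ι → ℝ) :
    ENNReal.ofReal (Real.exp (-∑ i ∈ s, f i)) = ∏ i ∈ s, ENNReal.ofReal (Real.exp (-f i)) := by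
  rw [← Finset.sum_neg_distrib, Real.exp_sum,
    ENNReal.ofReal_prod_of_nonneg fun i _ => (Real.exp_pos _).le]

theorem lintegral_pi_exp_neg_mul_norm_sq {E : Type*} [NormedAddCommGroup E]
    [InnerProductSpace ℝ E] [FiniteDimensional ℝ E] [MeasurableSpace E] [BorelSpace E] {n : ℕ}
    {t : Fin n → ℝ} (ht : ∀ i, 0 < t i) :
    ∫⁻ m : Fin n → E, ENNReal.ofReal (Real.exp (-∑ i, t i * ‖m i‖ ^ 2)) =
      ENNReal.ofReal (∏ i, (Real.pi / t i) ^ ((Module.finrank ℝ E : ℝ) / 2)) := by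
  simp_rw [ofReal_exp_neg_sum]
  rw [volume_pi, lintegral_pi_prod volume (fun (i : Fin n) (x : E) =>
    ENNReal.ofReal (Real.exp (-(t i * ‖x‖ ^ 2)))) fun i => by fun_prop,
    ENNReal.ofReal_prod_of_nonneg fun i _ =>
      Real.rpow_nonneg (div_pos Real.pi_pos (ht i)).le _]
  exact Finset.prod_congr rfl fun i _ => lintegral_exp_neg_mul_norm_sq (ht i)

/-- Linear change of variables, the Jacobian being determined by a test function `w`. -/
theorem lintegral_mul_eq_of_linearEquiv {W W' : Type*} [NormedAddCommGroup W] [NormedSpace ℝ W]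
    [FiniteDimensional ℝ W] [MeasurableSpace W] [BorelSpace W] [NormedAddCommGroup W']
    [NormedSpace ℝ W'] [FiniteDimensional ℝ W'] [MeasurableSpace W'] [BorelSpace W']
    (μ : Measure W) [μ.IsAddHaarMeasure] (μ' : Measure W') [μ'.IsAddHaarMeasure]
    (L : W' ≃ₗ[ℝ] W) {w h : W → ℝ≥0∞} (hw : Measurable w) (hh : Measurable h) {Z Z' : ℝ≥0∞}
    (hZ : ∫⁻ x, w x ∂μ = Z) (hZ' : ∫⁻ x, w (L x) ∂μ' = Z') (h0 : Z' ≠ 0) (ht : Z' ≠ ∞) :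
    ∫⁻ x, w x * h x ∂μ = Z / Z' * ∫⁻ x, w (L x) * h (L x) ∂μ' := by
  -- By uniqueness of Haar measure `μ` is a constant multiple of the image of `μ'`; applying this to
  -- `w` alone identifies the constant as `Z / Z'`.
  have hc := Measure.isAddLeftInvariant_eq_smul μ (μ'.map L.toContinuousLinearEquiv)
  have hm : Measurable (L.toContinuousLinearEquiv : W' → W) :=
    L.toContinuousLinearEquiv.continuous.measurable
  set c := Measure.addHaarScalarFactor μ (μ'.map L.toContinuousLinearEquiv)
  have key : ∀ f : W → ℝ≥0∞, Measurable f → ∫⁻ x, f x ∂μ = c * ∫⁻ x, f (L x) ∂μ' := by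
    intro f hf
    conv_lhs => rw [hc]
    rw [lintegral_smul_measure, lintegral_map hf hm]
    rfl
  rw [key (fun x => w x * h x) (hw.mul hh)]
  congr 1
  rw [← hZ, key w hw, hZ', ENNReal.mul_div_cancel_right h0 ht]

theorem isAddHaarMeasure_volume_pi (E : Type*) [NormedAddCommGroup E] [InnerProductSpace ℝ E]
    [FiniteDimensional ℝ E] [MeasurableSpace E] [BorelSpace E] (n : ℕ) :
    (volume : Measure (Fin n → E)).IsAddHaarMeasure := inferInstance

/-! ### Gaussian moments of the absolute determinant of a square matrix. -/

section GaussianDet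

variable {F : Type} [NormedDivisionRing F] [StarRing F] [InnerProductSpace ℝ F]
  [FiniteDimensional ℝ F] [SecondCountableTopology F] [MeasurableSpace F] [BorelSpace F]
  {D : ∀ n : ℕ, Matrix (Fin n) (Fin n) F → ℝ}

omit [StarRing F] [SecondCountableTopology F] [MeasurableSpace F] [BorelSpace F] in
theorem finrank_euclideanSpace_real (n : ℕ) :
    Module.finrank ℝ (EuclideanSpace F (Fin n)) = n * Module.finrank ℝ F := by
  rw [(WithLp.linearEquiv 2 ℝ (Fin n → F)).finrank_eq, Module.finrank_pi_fintype]
  simp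

/-- The Gaussian integral of `D ^ q` over square matrices. -/
def gaussianDetMoment (D : ∀ n : ℕ, Matrix (Fin n) (Fin n) F → ℝ) (n : ℕ) (q : ℝ) : ℝ≥0∞ :=
  ∫⁻ x : Fin n → EuclideanSpace F (Fin n),
    ENNReal.ofReal (Real.exp (-∑ i, ‖x i‖ ^ 2)) * ENNReal.ofReal (D n (colMatrix x)) ^ q

/-- The linear equivalence adding a first row to a matrix given by its columns and multiplying
by `U`, an involution, from the left. -/
def consRowEquiv (hD : IsAbsDet D) {n k : ℕ} {U : Matrix (Fin (n + 1)) (Fin (n + 1)) F}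
    (hU : U * U = 1) :
    ((Fin k → F) × (Fin k → EuclideanSpace F (Fin n))) ≃ₗ[ℝ]
      (Fin k → EuclideanSpace F (Fin (n + 1))) where
  toFun z j := WithLp.toLp 2 (U.mulVec (Fin.cons (z.1 j) (z.2 j)))
  invFun m := (fun j => U.mulVec (m j) 0, fun j => WithLp.toLp 2 fun i => U.mulVec (m j) i.succ)
  map_add' z z' := by
    ext j i
    have : (Fin.cons (z.1 j + z'.1 j) ((z.2 j).ofLp + (z'.2 j).ofLp) : Fin (n + 1) → F) =
        Fin.cons (z.1 j) (z.2 j) + Fin.cons (z'.1 j) (z'.2 j) := by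
      ext i; refine Fin.cases ?_ (fun i => ?_) i <;> simp
    simp [this, Matrix.mulVec_add]
  map_smul' r z := by
    ext j i
    simp only [Matrix.mulVec, dotProduct, Prod.smul_fst, Prod.smul_snd, Pi.smul_apply,
      RingHom.id_apply, PiLp.smul_apply, Finset.smul_sum, ← hD.mul_smul]
    refine Finset.sum_congr rfl fun l _ => ?_
    refine Fin.cases ?_ (fun i => ?_) l <;> simp
  left_inv z := by
    have h : ∀ j, U.mulVec (U.mulVec (Fin.cons (z.1 j) (z.2 j))) = Fin.cons (z.1 j) (z.2 j) :=
      fun j => by rw [Matrix.mulVec_mulVec, hU, Matrix.one_mulVec]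
    refine Prod.ext ?_ ?_
    · ext j; simp [h]
    · ext j i; simp [h]
  right_inv m := by
    ext j i
    have h : (Fin.cons (U.mulVec (m j) 0) fun i => U.mulVec (m j) (Fin.succ i) :
        Fin (n + 1) → F) = U.mulVec (m j) := by
      ext i; refine Fin.cases ?_ (fun i => ?_) i <;> simp
    simp [h, Matrix.mulVec_mulVec, hU]

omit [FiniteDimensional ℝ F] [SecondCountableTopology F] [MeasurableSpace F] [BorelSpace F] in
theorem consRowEquiv_apply (hD : IsAbsDet D) {n k : ℕ}
    {U : Matrix (Fin (n + 1)) (Fin (n + 1)) F} (hU : U * U = 1)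
    (z : (Fin k → F) × (Fin k → EuclideanSpace F (Fin n))) (j : Fin k) :
    (consRowEquiv hD hU z j).ofLp = U.mulVec (Fin.cons (z.1 j) (z.2 j)) := rfl

omit [FiniteDimensional ℝ F] in
theorem IsAbsDet.measurable_colMatrix (hD : IsAbsDet D) (n : ℕ) :
    Measurable fun x : Fin n → EuclideanSpace F (Fin n) => D n (colMatrix x) := by
  refine ((hD.continuous n).comp ?_).measurable
  unfold colMatrix
  fun_prop

/-- Reflecting all columns by a `U` that moves `g` onto the first axis preserves the Gaussian weight
and, since `U² = 1` forces absolute determinant `1`, also `D`. Expansion along the first column then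
leaves `‖g‖` times a minor that does not involve the first row; this row contributes only its
Gaussian mass. -/
theorem lintegral_gaussian_cons (hD : IsAbsDet D) (n : ℕ) (q : ℝ)
    (g : EuclideanSpace F (Fin (n + 1))) (hg : g ≠ 0) :
    ∫⁻ m : Fin n → EuclideanSpace F (Fin (n + 1)), ENNReal.ofReal (Real.exp (-∑ i, ‖m i‖ ^ 2)) *
      ENNReal.ofReal (D (n + 1) (colMatrix (Fin.cons g m : Fin (n + 1) → _))) ^ q =
      ENNReal.ofReal ‖g‖ ^ q * (ENNReal.ofReal (Real.pi ^ ((Module.finrank ℝ F : ℝ) / 2)) ^ n *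
        gaussianDetMoment D n q) := by
  obtain ⟨U, hU, hnorm, hUg⟩ := hD.exists_reflection g.ofLp (by simpa using hg)
  have hUD : D (n + 1) U = 1 := hD.map_reflection hU
  set L := consRowEquiv (k := n) hD hU with hL
  have hUU : ∀ y, U.mulVec (U.mulVec y) = y := fun y => by
    rw [Matrix.mulVec_mulVec, hU, Matrix.one_mulVec]
  have hLn : ∀ z j, ‖L z j‖ ^ 2 = ‖z.1 j‖ ^ 2 + ‖z.2 j‖ ^ 2 := fun z j => by
    rw [PiLp.norm_sq_eq_of_L2, consRowEquiv_apply, hnorm, Fin.sum_univ_succ,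
      PiLp.norm_sq_eq_of_L2]
    simp
  have hg0 : ‖U.mulVec g 0‖ = ‖g‖ := by
    have h := hnorm g
    rw [← PiLp.norm_sq_eq_of_L2, Fin.sum_univ_succ] at h
    simp only [hUg, norm_zero, ne_eq, OfNat.ofNat_ne_zero, not_false_eq_true, zero_pow,
      Finset.sum_const_zero, add_zero] at h
    exact (sq_eq_sq₀ (norm_nonneg _) (norm_nonneg _)).1 h
  have hLD : ∀ z, D (n + 1) (colMatrix (Fin.cons g (L z) : Fin (n + 1) → _)) =
      ‖g‖ * D n (colMatrix z.2) := fun z => by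
    set M : Matrix (Fin (n + 1)) (Fin (n + 1)) F := Matrix.of fun i j =>
      Fin.cases (U.mulVec g i) (fun j => (Fin.cons (z.1 j) (z.2 j) : Fin (n + 1) → F) i) j with hM
    have e : colMatrix (Fin.cons g (L z) : Fin (n + 1) → _) = U * M := by
      ext i j
      refine Fin.cases ?_ (fun j => ?_) j
      · change g i = (U.mulVec (U.mulVec g)) i
        rw [hUU]
      · rfl
    rw [e, hD.map_mul, hUD, one_mul, hD.expand n M (fun i => by simpa [hM] using hUg i)]
    congr 1
  have hgm : Measurable fun m : Fin n → EuclideanSpace F (Fin (n + 1)) =>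
      ENNReal.ofReal (D (n + 1) (colMatrix (Fin.cons g m : Fin (n + 1) → _))) ^ q := by
    refine (Measurable.ennreal_ofReal ?_).pow_const q
    exact (hD.measurable_colMatrix (n + 1)).comp (Continuous.measurable (by fun_prop))
  have hw : ∀ z, ENNReal.ofReal (Real.exp (-∑ i, ‖L z i‖ ^ 2)) =
      ENNReal.ofReal (Real.exp (-∑ i, ‖z.1 i‖ ^ 2)) *
        ENNReal.ofReal (Real.exp (-∑ i, ‖z.2 i‖ ^ 2)) := fun z => by
    rw [← ENNReal.ofReal_mul (Real.exp_pos _).le, ← Real.exp_add]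
    simp only [hLn, Finset.sum_add_distrib, neg_add]
  have c1 : ∀ (E : Type) [NormedAddCommGroup E] [InnerProductSpace ℝ E]
      [FiniteDimensional ℝ E] [MeasurableSpace E] [BorelSpace E],
      ∫⁻ m : Fin n → E, ENNReal.ofReal (Real.exp (-∑ i, ‖m i‖ ^ 2)) =
        ENNReal.ofReal ((Real.pi ^ ((Module.finrank ℝ E : ℝ) / 2)) ^ n) := by
    intro E _ _ _ _ _
    simpa using lintegral_pi_exp_neg_mul_norm_sq (E := E) (n := n) (t := fun _ => 1)
      fun _ => one_pos
  have hm2 : Measurable fun x : Fin n → F => ENNReal.ofReal (Real.exp (-∑ i, ‖x i‖ ^ 2)) := by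
    fun_prop
  have hm3 : Measurable fun x : Fin n → EuclideanSpace F (Fin n) =>
      ENNReal.ofReal (Real.exp (-∑ i, ‖x i‖ ^ 2)) := by fun_prop
  have hZ' : ∫⁻ z, ENNReal.ofReal (Real.exp (-∑ i, ‖L z i‖ ^ 2))
      ∂(volume.prod volume) =
      ENNReal.ofReal ((Real.pi ^ ((Module.finrank ℝ (EuclideanSpace F (Fin (n + 1))) : ℝ) / 2))
        ^ n) := by
    simp_rw [hw]
    rw [lintegral_prod_mul hm2.aemeasurable hm3.aemeasurable, c1, c1,
      ← ENNReal.ofReal_mul (by positivity), ← mul_pow, ← Real.rpow_add Real.pi_pos]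
    simp only [finrank_euclideanSpace_real]
    push_cast
    ring_nf
  have hpi : 0 < Real.pi ^ ((Module.finrank ℝ (EuclideanSpace F (Fin (n + 1))) : ℝ) / 2) :=
    Real.rpow_pos_of_pos Real.pi_pos _
  have i1 := isAddHaarMeasure_volume_pi F n
  have i2 := isAddHaarMeasure_volume_pi (EuclideanSpace F (Fin n)) n
  have i3 := isAddHaarMeasure_volume_pi (EuclideanSpace F (Fin (n + 1))) n
  have i4 : ((volume : Measure (Fin n → F)).prod
      (volume : Measure (Fin n → EuclideanSpace F (Fin n)))).IsAddHaarMeasure :=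
    Measure.prod.instIsAddHaarMeasure _ _
  -- The Jacobian is `1`, because both total Gaussian masses are the same power of `π`.
  rw [lintegral_mul_eq_of_linearEquiv volume (volume.prod volume) L (by fun_prop) hgm (c1 _)
    hZ'
    (ENNReal.ofReal_pos.2 (pow_pos hpi n)).ne' ENNReal.ofReal_ne_top,
    ENNReal.div_self (ENNReal.ofReal_pos.2 (pow_pos hpi n)).ne' ENNReal.ofReal_ne_top, one_mul]
  have e : ∀ z, ENNReal.ofReal (Real.exp (-∑ i, ‖L z i‖ ^ 2)) *
      ENNReal.ofReal (D (n + 1) (colMatrix (Fin.cons g (L z) : Fin (n + 1) → _))) ^ q =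
      ENNReal.ofReal ‖g‖ ^ q * (ENNReal.ofReal (Real.exp (-∑ i, ‖z.1 i‖ ^ 2)) *
        (ENNReal.ofReal (Real.exp (-∑ i, ‖z.2 i‖ ^ 2)) *
          ENNReal.ofReal (D n (colMatrix z.2)) ^ q)) := fun z => by
    rw [hw, hLD, ENNReal.ofReal_mul (norm_nonneg _),
      ENNReal.mul_rpow_of_ne_top ENNReal.ofReal_ne_top ENNReal.ofReal_ne_top]
    ring
  have hm1 : Measurable fun x : Fin n → EuclideanSpace F (Fin n) =>
      ENNReal.ofReal (Real.exp (-∑ i, ‖x i‖ ^ 2)) * ENNReal.ofReal (D n (colMatrix x)) ^ q :=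
    Measurable.mul (by fun_prop) ((hD.measurable_colMatrix n).ennreal_ofReal.pow_const q)
  simp_rw [e]
  have hgt : ENNReal.ofReal ‖g‖ ^ q ≠ ∞ := by
    rw [ENNReal.ofReal_rpow_of_pos (norm_pos_iff.2 hg)]
    exact ENNReal.ofReal_ne_top
  rw [lintegral_const_mul' _ _ hgt, lintegral_prod_mul hm2.aemeasurable hm1.aemeasurable, c1,
    ENNReal.ofReal_pow (by positivity)]
  rfl

end GaussianDet

theorem lintegral_pi_succ {E : Type*} [MeasureSpace E] [SigmaFinite (volume : Measure E)] {n : ℕ}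
    {f : (Fin (n + 1) → E) → ℝ≥0∞} (hf : Measurable f) :
    ∫⁻ x, f x = ∫⁻ g : E, ∫⁻ m : Fin n → E, f (Fin.cons g m) := by
  have h := (volume_preserving_piFinSuccAbove (fun _ : Fin (n + 1) => E) 0).symm
  rw [← h.lintegral_comp_emb (MeasurableEquiv.measurableEmbedding _), Measure.volume_eq_prod,
    lintegral_prod
      (fun z => f ((MeasurableEquiv.piFinSuccAbove (fun _ : Fin (n + 1) => E) 0).symm z))
      (hf.comp (MeasurableEquiv.measurable _)).aemeasurable]
  refine lintegral_congr fun g => lintegral_congr fun m => ?_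
  simp [MeasurableEquiv.piFinSuccAbove, Fin.insertNthEquiv]

section GaussianDet

variable {F : Type} [NormedDivisionRing F] [StarRing F] [InnerProductSpace ℝ F]
  [FiniteDimensional ℝ F] [SecondCountableTopology F] [MeasurableSpace F] [BorelSpace F]
  {D : ∀ n : ℕ, Matrix (Fin n) (Fin n) F → ℝ}

theorem gaussianDetMoment_succ (hD : IsAbsDet D) (n : ℕ) {q : ℝ}
    (hq : -(Module.finrank ℝ F : ℝ) < q) :
    gaussianDetMoment D (n + 1) q =
      ENNReal.ofReal (Real.pi ^ (((n + 1 : ℕ) * Module.finrank ℝ F : ℝ) / 2) *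
        (Real.Gamma (((n + 1 : ℕ) * Module.finrank ℝ F + q) / 2) /
          Real.Gamma (((n + 1 : ℕ) * Module.finrank ℝ F : ℝ) / 2))) *
      (ENNReal.ofReal (Real.pi ^ ((Module.finrank ℝ F : ℝ) / 2)) ^ n *
        gaussianDetMoment D n q) := by
  have hβ : (0 : ℝ) ≤ Module.finrank ℝ F := Nat.cast_nonneg _
  have hn : (1 : ℝ) ≤ (n + 1 : ℕ) := by simp
  have hm : Measurable fun x : Fin (n + 1) → EuclideanSpace F (Fin (n + 1)) =>
      ENNReal.ofReal (Real.exp (-∑ i, ‖x i‖ ^ 2)) *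
        ENNReal.ofReal (D (n + 1) (colMatrix x)) ^ q :=
    Measurable.mul (by fun_prop) ((hD.measurable_colMatrix _).ennreal_ofReal.pow_const q)
  rw [gaussianDetMoment, lintegral_pi_succ hm]
  set K := ENNReal.ofReal (Real.pi ^ ((Module.finrank ℝ F : ℝ) / 2)) ^ n *
    gaussianDetMoment D n q with hK
  -- The reflection needs `g ≠ 0`, which excludes only a null set.
  have e : ∀ᵐ g : EuclideanSpace F (Fin (n + 1)),
      ∫⁻ m : Fin n → EuclideanSpace F (Fin (n + 1)),
        ENNReal.ofReal (Real.exp (-∑ i, ‖(Fin.cons g m : Fin (n + 1) → _) i‖ ^ 2)) *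
          ENNReal.ofReal (D (n + 1) (colMatrix (Fin.cons g m : Fin (n + 1) → _))) ^ q =
        ENNReal.ofReal (Real.exp (-(1 * ‖g‖ ^ 2))) * ENNReal.ofReal ‖g‖ ^ q * K := by
    filter_upwards [Measure.ae_ne volume (0 : EuclideanSpace F (Fin (n + 1)))] with g hg
    rw [mul_assoc, hK, ← lintegral_gaussian_cons hD n q g hg,
      ← lintegral_const_mul' _ _ ENNReal.ofReal_ne_top]
    refine lintegral_congr fun m => ?_
    rw [← mul_assoc, ← ENNReal.ofReal_mul (Real.exp_pos _).le, ← Real.exp_add,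
      Fin.sum_univ_succ, Fin.cons_zero, neg_add, one_mul]
    simp only [Fin.cons_succ]
  rw [lintegral_congr_ae e, lintegral_mul_const _ (by fun_prop),
    lintegral_exp_neg_norm_sq_mul_norm_rpow one_pos (by
      rw [finrank_euclideanSpace_real]; push_cast at hn ⊢; nlinarith), finrank_euclideanSpace_real]
  simp

/-- The value of `gaussianDetMoment` for a division algebra of real dimension `β`. -/
def gaussianDetValue (β : ℕ) (n : ℕ) (q : ℝ) : ℝ :=
  ∏ i ∈ Finset.range n, (Real.pi ^ (((i + 1 : ℕ) * β : ℝ) / 2) *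
    (Real.Gamma (((i + 1 : ℕ) * β + q) / 2) / Real.Gamma (((i + 1 : ℕ) * β : ℝ) / 2)) *
      (Real.pi ^ ((β : ℝ) / 2)) ^ i)

theorem gaussianDetValue_pos {β : ℕ} (hβ : 0 < β) (n : ℕ) {q : ℝ} (hq : -(β : ℝ) < q) :
    0 < gaussianDetValue β n q := by
  have hβ' : (0 : ℝ) < β := Nat.cast_pos.2 hβ
  refine Finset.prod_pos fun i _ => ?_
  have h1 : (1 : ℝ) ≤ (i + 1 : ℕ) := by simp
  have h2 := Real.Gamma_pos_of_pos (s := ((i + 1 : ℕ) * β + q) / 2) (by nlinarith)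
  have h3 := Real.Gamma_pos_of_pos (s := ((i + 1 : ℕ) * β : ℝ) / 2) (by positivity)
  have := Real.pi_pos
  positivity

theorem gaussianDetMoment_eq (hD : IsAbsDet D) {q : ℝ} (hq : -(Module.finrank ℝ F : ℝ) < q) :
    ∀ n, gaussianDetMoment D n q = ENNReal.ofReal (gaussianDetValue (Module.finrank ℝ F) n q)
  | 0 => by
    simp only [gaussianDetMoment, hD.of_isEmpty, gaussianDetValue, volume_pi]
    simp
  | n + 1 => by
    have hβ : 0 < Module.finrank ℝ F := Module.finrank_pos
    have := gaussianDetValue_pos hβ (n + 1) hq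
    rw [gaussianDetMoment_succ hD n hq, gaussianDetMoment_eq hD hq n, gaussianDetValue,
      gaussianDetValue, Finset.prod_range_succ, ← ENNReal.ofReal_pow (by positivity),
      ← ENNReal.ofReal_mul (by positivity), ← ENNReal.ofReal_mul' (by
        have := (gaussianDetValue_pos hβ n hq).le
        rw [gaussianDetValue] at this
        positivity)]
    congr 1
    ring

end GaussianDet

/-! ### Gaussian moments of the simplex determinant with arbitrary variances. -/

/-- Since `2 / |w|² = 1 / c`, the map is the real reflection along `w` acting on the index set,
hence an isometry of the direct sum of `n` copies of `E`. -/
theorem sum_norm_sq_sub_smul {E : Type*} [NormedAddCommGroup E] [InnerProductSpace ℝ E] {n : ℕ}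
    (w : Fin n → ℝ) {c : ℝ} (hc : c ≠ 0) (hw : ∑ i, w i ^ 2 = 2 * c) (x : Fin n → E) :
    ∑ i, ‖x i - (w i / c) • ∑ j, w j • x j‖ ^ 2 = ∑ i, ‖x i‖ ^ 2 := by
  set z := ∑ j, w j • x j with hz
  have e : ∀ i, ‖x i - (w i / c) • z‖ ^ 2 =
      ‖x i‖ ^ 2 - 2 / c * inner ℝ (w i • x i) z + w i ^ 2 * (‖z‖ ^ 2 / c ^ 2) := fun i => by
    rw [norm_sub_sq_real, inner_smul_right, real_inner_smul_left, norm_smul, mul_pow,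
      Real.norm_eq_abs, sq_abs]
    field_simp
  simp only [e, Finset.sum_add_distrib, Finset.sum_sub_distrib, ← Finset.mul_sum,
    ← Finset.sum_mul, hw, ← sum_inner, ← hz, real_inner_self_eq_norm_sq]
  field_simp
  ring

/-- The matrix factors as `(1 + c s sᵀ) diag(s)⁻¹`, and the first factor has determinant `1 + c
|s|²`. -/
theorem det_diagonal_add_rank_one {n : ℕ} (s : Fin n → ℝ) (hs : ∀ i, s i ≠ 0) (c : ℝ) :
    (Matrix.of fun j k : Fin n => (if j = k then (s k)⁻¹ else 0) + c * s j).det =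
      (1 + c * ∑ i, s i ^ 2) * ∏ i, (s i)⁻¹ := by
  have h : (Matrix.of fun j k : Fin n => (if j = k then (s k)⁻¹ else 0) + c * s j) =
      (1 + Matrix.replicateCol Unit s * Matrix.replicateRow Unit (c • s)) *
        Matrix.diagonal fun i => (s i)⁻¹ := by
    ext j k
    rw [Matrix.mul_diagonal, Matrix.add_apply, Matrix.mul_apply, Matrix.one_apply]
    have := hs k
    by_cases hjk : j = k
    · simp [hjk, add_mul]
      field_simp
    · simp [hjk]
      field_simp
  rw [h, Matrix.det_mul, Matrix.det_one_add_replicateCol_mul_replicateRow, Matrix.det_diagonal]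
  congr 2
  simp only [dotProduct, Pi.smul_apply, smul_eq_mul, Finset.mul_sum]
  exact Finset.sum_congr rfl fun i _ => by ring

section GaussianSimplex

variable {F : Type} [NormedDivisionRing F] [StarRing F] [InnerProductSpace ℝ F]
  [FiniteDimensional ℝ F] [SecondCountableTopology F] [MeasurableSpace F] [BorelSpace F]
  {D : ∀ n : ℕ, Matrix (Fin n) (Fin n) F → ℝ}

omit [StarRing F] [InnerProductSpace ℝ F] [FiniteDimensional ℝ F] [SecondCountableTopology F]
  [MeasurableSpace F] [BorelSpace F] in
theorem continuous_simplexMatrix (N : ℕ) :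
    Continuous fun m : Fin (N + 1) → EuclideanSpace F (Fin N) => simplexMatrix m := by
  unfold simplexMatrix
  fun_prop

/-- Householder transformation of the index set, combined with the scaling by `t_i^{-1/2}`. -/
def scaledReflection (E : Type*) [AddCommGroup E] [Module ℝ E] {n : ℕ} (s w : Fin n → ℝ) (c : ℝ) :
    (Fin n → E) →ₗ[ℝ] (Fin n → E) where
  toFun x i := (s i)⁻¹ • (x i - (w i / c) • ∑ j, w j • x j)
  map_add' x y := by
    ext i
    change (s i)⁻¹ • (x i + y i - (w i / c) • ∑ j, w j • (x j + y j)) = _ • _ + _ • _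
    rw [← smul_add]
    congr 1
    simp only [smul_add, Finset.sum_add_distrib]
    abel
  map_smul' r x := by
    ext i
    simp only [Pi.smul_apply, RingHom.id_apply, smul_comm _ r, ← Finset.smul_sum, ← smul_sub]

-- With `w = s / R + e_0`, where `|w|² = 2 w 0`, the reflection takes `e_0` to `-s / R`. After
-- division by `s_i` this direction becomes a common translation of all points, so `x 0` drops out
-- of the differences. The other `x k` are multiplied by a real matrix, a diagonal one plus a matrix
-- of rank one; the constant `c` makes its determinant `R ∏ s_i⁻¹`.
omit [FiniteDimensional ℝ F] [SecondCountableTopology F] [MeasurableSpace F] [BorelSpace F] in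
theorem absDet_simplexMatrix_scaledReflection (hD : IsAbsDet D) {N : ℕ} {s w : Fin (N + 1) → ℝ}
    (hs : ∀ i, 0 < s i) {R : ℝ} (hR : 0 < R) (hRs : R ^ 2 = ∑ i, s i ^ 2)
    (hw0 : w 0 = s 0 / R + 1) (hw : ∀ i : Fin N, w i.succ = s i.succ / R)
    (x : Fin (N + 1) → EuclideanSpace F (Fin N)) :
    D N (simplexMatrix (scaledReflection _ s w (w 0) x)) =
      D N (colMatrix fun k => x k.succ) * (R * ∏ i, (s i)⁻¹) := by
  have hs0 := hs 0
  set c : ℝ := (s 0 * (s 0 + R))⁻¹ with hc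
  set S : Matrix (Fin N) (Fin N) ℝ :=
    Matrix.of fun j k => (if j = k then (s k.succ)⁻¹ else 0) + c * s j.succ with hS
  have hdet : S.det = R * ∏ i, (s i)⁻¹ := by
    rw [hS, det_diagonal_add_rank_one (fun i => s i.succ) (fun i => (hs _).ne') c,
      Fin.prod_univ_succ, ← mul_assoc]
    congr 1
    rw [Fin.sum_univ_succ] at hRs
    rw [show ∑ i : Fin N, s i.succ ^ 2 = R ^ 2 - s 0 ^ 2 by linarith, hc]
    field_simp
    ring
  have hpos : 0 ≤ R * ∏ i, (s i)⁻¹ :=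
    mul_nonneg hR.le (Finset.prod_nonneg fun i _ => (inv_pos.2 (hs i)).le)
  have hM : simplexMatrix (scaledReflection _ s w (w 0) x) =
      colMatrix (fun k => x k.succ) * S.map fun r => r • (1 : F) := by
    ext i k
    have e1 : (scaledReflection _ s w (w 0) x k.succ - scaledReflection _ s w (w 0) x 0) =
        (s k.succ)⁻¹ • x k.succ + ∑ j : Fin N, (c * s j.succ) • x j.succ := by
      set y := ∑ j : Fin N, w j.succ • x j.succ with hy
      have ey : ∑ j : Fin N, (c * s j.succ) • x j.succ = (c * R) • y := by
        rw [hy, Finset.smul_sum]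
        refine Finset.sum_congr rfl fun j _ => ?_
        rw [hw, smul_smul]
        congr 1
        field_simp
      have hsk := hs k.succ
      have hw0' : 0 < w 0 := by rw [hw0]; positivity
      rw [ey]
      simp only [scaledReflection, LinearMap.coe_mk, AddHom.coe_mk, Fin.sum_univ_succ, ← hy]
      match_scalars
      · ring
      · rw [hw]
        field_simp
        rw [hw0]
        field_simp
        ring
      · rw [hw, hc]
        field_simp
        rw [hw0]
        field_simp
        ring
    have e2 : (simplexMatrix (scaledReflection _ s w (w 0) x)) i k =
        (scaledReflection _ s w (w 0) x k.succ - scaledReflection _ s w (w 0) x 0) i := rfl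
    rw [e2, e1, Matrix.mul_apply]
    simp only [colMatrix, Matrix.of_apply, Matrix.map_apply, hD.mul_smul, mul_one, hS, add_smul,
      mul_add, mul_ite, mul_zero,
      Finset.sum_add_distrib, ite_smul, zero_smul, Finset.sum_ite_eq', Finset.mem_univ, if_true,
      PiLp.add_apply, PiLp.smul_apply, WithLp.ofLp_sum, Finset.sum_apply]
  rw [hM, hD.map_mul, hD.map_real, hdet, abs_of_nonneg hpos]

/-- With `s_i = √t_i` and `R = √T`, the scaled reflection turns `∑ t_i ‖m_i‖²` into `∑ ‖x_i‖²`. The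
Jacobian contributes `∏ t_i^{-d/2}`, the determinant `(R ∏ s_i⁻¹)^q = T^{q/2} ∏ t_i^{-q/2}`, and the
free vector `x 0` the mass `π^{d/2}`. -/
theorem hasGaussianMoment_simplexMatrix (hD : IsAbsDet D) (N : ℕ) {q : ℝ}
    (hq : -(Module.finrank ℝ F : ℝ) < q) :
    HasGaussianMoment (fun m : Fin (N + 1) → EuclideanSpace F (Fin N) => D N (simplexMatrix m))
      (Real.pi ^ ((N * Module.finrank ℝ F : ℝ) / 2) *
        gaussianDetValue (Module.finrank ℝ F) N q) q := by
  intro t ht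
  set d : ℝ := ((Module.finrank ℝ (EuclideanSpace F (Fin N)) : ℕ) : ℝ) with hd
  have hd' : (N * Module.finrank ℝ F : ℝ) = d := by
    rw [hd, finrank_euclideanSpace_real]; push_cast; rfl
  have hJ := gaussianDetValue_pos (Module.finrank_pos (R := ℝ) (M := F)) N hq
  set T := ∑ i, t i with hT
  have hT0 : 0 < T := Finset.sum_pos (fun i _ => ht i) Finset.univ_nonempty
  set s : Fin (N + 1) → ℝ := fun i => √(t i) with hs
  have hs0 : ∀ i, 0 < s i := fun i => Real.sqrt_pos.2 (ht i)
  have hs2 : ∀ i, s i ^ 2 = t i := fun i => Real.sq_sqrt (ht i).le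
  set R := √T with hR
  have hR0 : 0 < R := Real.sqrt_pos.2 hT0
  have hR2 : R ^ 2 = ∑ i, s i ^ 2 := by rw [hR, Real.sq_sqrt hT0.le]; simp [hs2, hT]
  set w : Fin (N + 1) → ℝ := Fin.cons (s 0 / R + 1) fun i => s i.succ / R with hw
  have hw0 : w 0 = s 0 / R + 1 := rfl
  have hws : ∀ i : Fin N, w i.succ = s i.succ / R := fun i => rfl
  have hw0' : w 0 ≠ 0 := by have := hs0 0; rw [hw0]; positivity
  have hw2 : ∑ i, w i ^ 2 = 2 * w 0 := by
    rw [Fin.sum_univ_succ] at hR2 ⊢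
    simp only [hws, hw0, div_pow, ← Finset.sum_div]
    rw [show ∑ i : Fin N, s i.succ ^ 2 = R ^ 2 - s 0 ^ 2 by linarith]
    field_simp
    ring
  set L₀ := scaledReflection (EuclideanSpace F (Fin N)) s w (w 0) with hL₀
  have hLn : ∀ x, ∑ i, t i * ‖L₀ x i‖ ^ 2 = ∑ i, ‖x i‖ ^ 2 := fun x => by
    rw [← sum_norm_sq_sub_smul w hw0' hw2 x]
    refine Finset.sum_congr rfl fun i _ => ?_
    have : L₀ x i = (s i)⁻¹ • (x i - (w i / w 0) • ∑ j, w j • x j) := rfl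
    rw [this, norm_smul, mul_pow, Real.norm_eq_abs, sq_abs, ← hs2, ← mul_assoc, ← mul_pow,
      mul_inv_cancel₀ (hs0 i).ne', one_pow, one_mul]
  have hinj : Function.Injective L₀ := by
    rw [← LinearMap.ker_eq_bot, LinearMap.ker_eq_bot']
    intro x hx
    have h := hLn x
    simp only [hx, Pi.zero_apply, norm_zero, ne_eq, OfNat.ofNat_ne_zero, not_false_eq_true,
      zero_pow, mul_zero, Finset.sum_const_zero] at h
    have h' := (Finset.sum_eq_zero_iff_of_nonneg fun i _ => by positivity).1 h.symm
    ext1 i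
    simpa using h' i (Finset.mem_univ i)
  set L := LinearEquiv.ofInjectiveEndo L₀ hinj with hL
  have hLL : ∀ x, L x = L₀ x := fun x => rfl
  have hm0 : Measurable fun m : Fin (N + 1) → EuclideanSpace F (Fin N) =>
      ENNReal.ofReal (D N (simplexMatrix m)) ^ q :=
    (((hD.continuous N).comp (continuous_simplexMatrix N)).measurable.ennreal_ofReal).pow_const q
  have hZ := lintegral_pi_exp_neg_mul_norm_sq (E := EuclideanSpace F (Fin N)) ht
  have hZ' := lintegral_pi_exp_neg_mul_norm_sq (E := EuclideanSpace F (Fin N))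
    (t := fun _ : Fin (N + 1) => (1 : ℝ)) fun _ => one_pos
  simp only [div_one, one_mul, Finset.prod_const, Finset.card_univ, Fintype.card_fin, ← hd] at hZ'
  have hpi : 0 < Real.pi ^ (d / 2) := Real.rpow_pos_of_pos Real.pi_pos _
  have i1 := isAddHaarMeasure_volume_pi (EuclideanSpace F (Fin N)) (N + 1)
  rw [lintegral_mul_eq_of_linearEquiv volume volume L (by fun_prop) hm0 hZ
    (by simp_rw [hLL, hLn]; exact hZ') (ENNReal.ofReal_pos.2 (pow_pos hpi _)).ne'
    ENNReal.ofReal_ne_top]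
  have hP : 0 < ∏ i, (s i)⁻¹ := Finset.prod_pos fun i _ => inv_pos.2 (hs0 i)
  have hRP : 0 < R * ∏ i, (s i)⁻¹ := mul_pos hR0 hP
  have e : ∀ x, ENNReal.ofReal (Real.exp (-∑ i, t i * ‖L x i‖ ^ 2)) *
      ENNReal.ofReal (D N (simplexMatrix (L x))) ^ q =
      ENNReal.ofReal (Real.exp (-∑ i, ‖x i‖ ^ 2)) *
        ENNReal.ofReal (D N (colMatrix fun k => x k.succ)) ^ q *
        ENNReal.ofReal ((R * ∏ i, (s i)⁻¹) ^ q) := fun x => by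
    rw [hLL, hLn, absDet_simplexMatrix_scaledReflection hD hs0 hR0 hR2 hw0 hws,
      ENNReal.ofReal_mul (hD.nonneg _ _), ENNReal.mul_rpow_of_ne_top ENNReal.ofReal_ne_top
        ENNReal.ofReal_ne_top, ENNReal.ofReal_rpow_of_pos hRP, mul_assoc]
  have hm1 : Measurable fun x : Fin N → EuclideanSpace F (Fin N) =>
      ENNReal.ofReal (Real.exp (-∑ i, ‖x i‖ ^ 2)) * ENNReal.ofReal (D N (colMatrix x)) ^ q :=
    Measurable.mul (by fun_prop) ((hD.measurable_colMatrix N).ennreal_ofReal.pow_const q)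
  have hm2 : Measurable fun x : Fin (N + 1) → EuclideanSpace F (Fin N) =>
      ENNReal.ofReal (Real.exp (-∑ i, ‖x i‖ ^ 2)) *
        ENNReal.ofReal (D N (colMatrix fun k => x k.succ)) ^ q :=
    Measurable.mul (by fun_prop) (((hD.measurable_colMatrix N).comp
      (measurable_pi_lambda _ fun k => measurable_pi_apply k.succ)).ennreal_ofReal.pow_const q)
  have hfub : ∫⁻ x : Fin (N + 1) → EuclideanSpace F (Fin N),
      ENNReal.ofReal (Real.exp (-∑ i, ‖x i‖ ^ 2)) *
        ENNReal.ofReal (D N (colMatrix fun k => x k.succ)) ^ q =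
      ENNReal.ofReal (Real.pi ^ (d / 2)) *
        ENNReal.ofReal (gaussianDetValue (Module.finrank ℝ F) N q) := by
    have h1 := lintegral_exp_neg_mul_norm_sq (E := EuclideanSpace F (Fin N)) one_pos
    simp only [one_mul, div_one, ← hd] at h1
    rw [lintegral_pi_succ hm2, ← gaussianDetMoment_eq hD hq N, ← h1,
      ← lintegral_mul_const _ (by fun_prop)]
    refine lintegral_congr fun g => ?_
    rw [gaussianDetMoment, ← lintegral_const_mul _ hm1]
    refine lintegral_congr fun m => ?_
    simp only [Fin.sum_univ_succ, Fin.cons_zero, Fin.cons_succ, neg_add, Real.exp_add]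
    rw [ENNReal.ofReal_mul (Real.exp_pos _).le, mul_assoc]
  simp_rw [e]
  rw [lintegral_mul_const _ hm2, hfub, ← ENNReal.ofReal_mul hpi.le,
    ← ENNReal.ofReal_mul (by positivity), ← ENNReal.ofReal_div_of_pos (pow_pos hpi _),
    ← ENNReal.ofReal_mul (by
      refine div_nonneg (Finset.prod_nonneg fun i _ => Real.rpow_nonneg ?_ _) (by positivity)
      exact (div_pos Real.pi_pos (ht i)).le), hd']
  congr 1
  have hs' : ∀ i, (s i)⁻¹ = t i ^ (-(1 / 2 : ℝ)) := fun i => by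
    rw [Real.rpow_neg (ht i).le, ← Real.sqrt_eq_rpow]
  have hprod : (∏ i, (s i)⁻¹) ^ q = ∏ i, t i ^ (-(q / 2)) := by
    rw [← Real.finsetProd_rpow _ _ fun i _ => (inv_pos.2 (hs0 i)).le]
    refine Finset.prod_congr rfl fun i _ => ?_
    rw [hs', ← Real.rpow_mul (ht i).le]
    ring_nf
  have hRq : R ^ q = T ^ (q / 2) := by
    rw [hR, Real.sqrt_eq_rpow, ← Real.rpow_mul hT0.le]; ring_nf
  have hprod2 : ∏ i, (Real.pi / t i) ^ (d / 2) =
      (Real.pi ^ (d / 2)) ^ (N + 1) * ∏ i, t i ^ (-(d / 2)) := by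
    simp_rw [Real.div_rpow Real.pi_pos.le (ht _).le, div_eq_mul_inv,
      ← Real.rpow_neg (ht _).le, Finset.prod_mul_distrib]
    simp
  have hprod3 : ∏ i, t i ^ (-((d + q) / 2)) =
      (∏ i, t i ^ (-(d / 2))) * ∏ i, t i ^ (-(q / 2)) := by
    rw [← Finset.prod_mul_distrib]
    refine Finset.prod_congr rfl fun i _ => ?_
    rw [← Real.rpow_add (ht i)]
    ring_nf
  rw [Real.mul_rpow hR0.le hP.le, hprod, hRq, hprod2, hprod3]
  field_simp

end GaussianSimplex

/-! ### The sphere as a limit of beta densities -/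

section SphereLimit

variable {E : Type} [NormedAddCommGroup E] [InnerProductSpace ℝ E] [FiniteDimensional ℝ E]
  [MeasurableSpace E] [BorelSpace E] [Nontrivial E] {n : ℕ}

/-- The product of the surface measure with the uniform measure on `(0, 1)`. -/
def sphereUnif (E : Type) [NormedAddCommGroup E] [InnerProductSpace ℝ E] [FiniteDimensional ℝ E]
    [MeasurableSpace E] [BorelSpace E] : Measure (sphere (0 : E) 1 × ℝ) :=
  (volume : Measure E).toSphere.prod (volume.restrict (Set.Ioo 0 1))

instance : IsFiniteMeasure (sphereUnif E) := by
  unfold sphereUnif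
  have : IsFiniteMeasure (volume.restrict (Set.Ioo (0 : ℝ) 1)) := ⟨by simp⟩
  infer_instance

/-- The point at radius `√(1 - v ^ (k + 1))` in direction `ω`. -/
def radialPoint (k : ℕ) (z : sphere (0 : E) 1 × ℝ) : E := √(1 - z.2 ^ (k + 1)) • (z.1 : E)

/-- The density of the radial variable `v`. -/
def radialDensity (E : Type) [NormedAddCommGroup E] [InnerProductSpace ℝ E] (k : ℕ) (v : ℝ) :
    ℝ≥0∞ :=
  ENNReal.ofReal (1 / 2 * (1 - v ^ (k + 1)) ^ ((Module.finrank ℝ E : ℝ) / 2 - 1))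

omit [Nontrivial E] [FiniteDimensional ℝ E] in
@[fun_prop]
theorem measurable_radialPoint [SecondCountableTopology E] (k : ℕ) :
    Measurable (radialPoint (E := E) k) := by
  unfold radialPoint; fun_prop

omit [Nontrivial E] [FiniteDimensional ℝ E] [MeasurableSpace E] [BorelSpace E] in
@[fun_prop]
theorem measurable_radialDensity (k : ℕ) : Measurable (radialDensity E k) := by
  unfold radialDensity; fun_prop

/-- The substitution `r = √(1 - v^{k+1})` resolves the singularity at `r = 1`: with `b = 1/(k+1)`
the weight is `v^{-k}`, which cancels the `v^k` of the Jacobian. What is left is `(k + 1) / 2` times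
`r^{d-2}`. -/
theorem lintegral_Ioi_betaWeight_sq (d k : ℕ) (hd : 0 < d) (g : ℝ → ℝ≥0∞) :
    ∫⁻ r in Set.Ioi (0 : ℝ), ENNReal.ofReal (r ^ (d - 1)) *
      (betaWeight (1 / (k + 1 : ℝ)) (r ^ 2) * g r) =
    ∫⁻ v in Set.Ioo (0 : ℝ) 1, ENNReal.ofReal (k + 1) *
      (ENNReal.ofReal (1 / 2 * (1 - v ^ (k + 1)) ^ ((d : ℝ) / 2 - 1)) *
        g (√(1 - v ^ (k + 1)))) := by
  set ψ : ℝ → ℝ := fun v => √(1 - v ^ (k + 1)) with hψ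
  have hk : (0 : ℝ) < k + 1 := by positivity
  have hv : ∀ v ∈ Set.Ioo (0 : ℝ) 1, 0 < v ^ (k + 1) ∧ v ^ (k + 1) < 1 := fun v hv =>
    ⟨pow_pos hv.1 _, pow_lt_one₀ hv.1.le hv.2 (by omega)⟩
  have himg : ψ '' Set.Ioo 0 1 = Set.Ioo 0 1 := by
    ext r
    constructor
    · rintro ⟨v, h, rfl⟩
      obtain ⟨h1, h2⟩ := hv v h
      refine ⟨Real.sqrt_pos.2 (by linarith), ?_⟩
      rw [hψ, Real.sqrt_lt' one_pos]
      linarith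
    · rintro ⟨h0, h1⟩
      have h2 : 0 < 1 - r ^ 2 := by nlinarith
      refine ⟨(1 - r ^ 2) ^ (1 / (k + 1 : ℝ)), ⟨Real.rpow_pos_of_pos h2 _,
        Real.rpow_lt_one h2.le (by nlinarith) (by positivity)⟩, ?_⟩
      simp only [hψ]
      rw [← Real.rpow_natCast, ← Real.rpow_mul h2.le]
      push_cast
      rw [one_div_mul_cancel hk.ne', Real.rpow_one, sub_sub_cancel, Real.sqrt_sq h0.le]
  have hinj : Set.InjOn ψ (Set.Ioo 0 1) := by
    intro a ha b hb hab
    have h := (Real.sqrt_inj (by linarith [(hv a ha).2]) (by linarith [(hv b hb).2])).1 hab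
    exact (pow_left_inj₀ ha.1.le hb.1.le (by omega)).1 (by linarith : a ^ (k + 1) = b ^ (k + 1))
  have hder : ∀ v ∈ Set.Ioo (0 : ℝ) 1, HasDerivWithinAt ψ
      (-((k + 1 : ℕ) * v ^ k) / (2 * √(1 - v ^ (k + 1)))) (Set.Ioo 0 1) v := by
    intro v h
    have h1 := (hasDerivAt_pow (k + 1) v).const_sub 1
    exact (h1.sqrt (by linarith [(hv v h).2])).hasDerivWithinAt
  have hI : ∫⁻ r in Set.Ioi (0 : ℝ), ENNReal.ofReal (r ^ (d - 1)) *
      (betaWeight (1 / (k + 1 : ℝ)) (r ^ 2) * g r) =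
      ∫⁻ r in Set.Ioo (0 : ℝ) 1, ENNReal.ofReal (r ^ (d - 1)) *
      (betaWeight (1 / (k + 1 : ℝ)) (r ^ 2) * g r) := by
    rw [← lintegral_indicator measurableSet_Ioi, ← lintegral_indicator measurableSet_Ioo]
    refine lintegral_congr fun r => ?_
    by_cases h0 : 0 < r
    · by_cases h1 : r < 1
      · rw [Set.indicator_of_mem (show r ∈ Set.Ioi 0 from h0),
          Set.indicator_of_mem (show r ∈ Set.Ioo 0 1 from ⟨h0, h1⟩)]
      · rw [Set.indicator_of_mem (show r ∈ Set.Ioi 0 from h0),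
          Set.indicator_of_notMem (fun h => h1 h.2), betaWeight_of_le (by nlinarith)]
        simp
    · rw [Set.indicator_of_notMem (show r ∉ Set.Ioi 0 from h0),
        Set.indicator_of_notMem (fun h => h0 h.1)]
  rw [hI, ← himg, lintegral_image_eq_lintegral_abs_deriv_mul measurableSet_Ioo hder hinj, himg]
  refine setLIntegral_congr_fun measurableSet_Ioo fun v h => ?_
  obtain ⟨h1, h2⟩ := hv v h
  have h3 : 0 < 1 - v ^ (k + 1) := by linarith
  have hs : 0 < ψ v := Real.sqrt_pos.2 h3
  have hv0 := h.1
  have hsq : ψ v ^ 2 = 1 - v ^ (k + 1) := Real.sq_sqrt h3.le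
  rw [hsq, betaWeight_of_lt (by linarith), sub_sub_cancel, ← mul_assoc, ← mul_assoc, ← mul_assoc,
    ← ENNReal.ofReal_mul (abs_nonneg _), ← ENNReal.ofReal_mul (by positivity),
    ← ENNReal.ofReal_mul hk.le]
  congr 2
  have e1 : (v ^ (k + 1)) ^ (1 / (k + 1 : ℝ) - 1) = (v ^ k)⁻¹ := by
    rw [← Real.rpow_natCast, ← Real.rpow_mul hv0.le, ← Real.rpow_natCast, ← Real.rpow_neg hv0.le]
    congr 1
    push_cast
    field_simp
    ring
  have e2 : (1 - v ^ (k + 1)) ^ ((d : ℝ) / 2 - 1) = ψ v ^ (d - 1) / ψ v := by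
    rw [← hsq, ← Real.rpow_natCast (ψ v) 2, ← Real.rpow_mul hs.le,
      ← Real.rpow_natCast (ψ v) (d - 1),
      ← Real.rpow_sub_one hs.ne', Nat.cast_pred hd]
    congr 1
    push_cast
    ring
  rw [e1, e2, neg_div, abs_neg, abs_of_pos (by positivity)]
  simp only [hψ]
  push_cast
  field_simp

theorem lintegral_betaWeight_norm_sq (k : ℕ) {f : E → ℝ≥0∞} (hf : Measurable f) :
    ∫⁻ x, betaWeight (1 / (k + 1 : ℝ)) (‖x‖ ^ 2) * f x =
      ∫⁻ z, ENNReal.ofReal (k + 1) * radialDensity E k z.2 * f (radialPoint k z)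
        ∂(sphereUnif E) := by
  have hm : Measurable fun z : sphere (0 : E) 1 × ℝ =>
      ENNReal.ofReal (k + 1) * radialDensity E k z.2 * f (radialPoint k z) := by fun_prop
  rw [lintegral_eq_lintegral_toSphere (by fun_prop), sphereUnif, lintegral_prod _ hm.aemeasurable]
  refine lintegral_congr fun ω => ?_
  have h := lintegral_Ioi_betaWeight_sq (Module.finrank ℝ E) k Module.finrank_pos
    fun r => f (r • (ω : E))
  have e : ∀ r ∈ Set.Ioi (0 : ℝ), ENNReal.ofReal (r ^ (Module.finrank ℝ E - 1)) *
      (betaWeight (1 / (k + 1 : ℝ)) (‖r • (ω : E)‖ ^ 2) * f (r • (ω : E))) =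
      ENNReal.ofReal (r ^ (Module.finrank ℝ E - 1)) *
      (betaWeight (1 / (k + 1 : ℝ)) (r ^ 2) * f (r • (ω : E))) := fun r hr => by
    have : ‖r • (ω : E)‖ = r := by simp [norm_smul, abs_of_pos (show 0 < r from hr)]
    rw [this]
  rw [setLIntegral_congr_fun measurableSet_Ioi e, h]
  simp only [radialDensity, radialPoint, mul_assoc]

theorem withDensity_betaWeight_norm_sq (k : ℕ) :
    (volume : Measure E).withDensity (fun x => betaWeight (1 / (k + 1 : ℝ)) (‖x‖ ^ 2)) =
      ((sphereUnif E).withDensity fun z =>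
        ENNReal.ofReal (k + 1) * radialDensity E k z.2).map (radialPoint k) := by
  refine Measure.ext_of_lintegral _ fun f hf => ?_
  have hm : Measurable fun z : sphere (0 : E) 1 × ℝ =>
      ENNReal.ofReal (k + 1) * radialDensity E k z.2 := by fun_prop
  have hfk : Measurable fun z => f (radialPoint k z) := hf.comp (by fun_prop)
  rw [lintegral_withDensity_eq_lintegral_mul _ (by fun_prop) hf,
    lintegral_map hf (by fun_prop), lintegral_withDensity_eq_lintegral_mul _ hm hfk]
  exact lintegral_betaWeight_norm_sq k hf

/-- All the beta moments with `b = 1/(k+1)` now live on one space with one measure, and `k` occurs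
only in the integrand and the prefactor. This form allows the limit `k → ∞`. -/
theorem betaMoment_eq_lintegral_sphereUnif {Δ : (Fin n → E) → ℝ} (hΔ : Measurable Δ) (q : ℝ)
    (k : ℕ) :
    betaMoment Δ q (1 / (k + 1 : ℝ)) = ENNReal.ofReal (k + 1) ^ n *
      ∫⁻ z, (∏ i, radialDensity E k (z i).2) * ENNReal.ofReal (Δ fun i => radialPoint k (z i)) ^ q
        ∂(Measure.pi fun _ : Fin n => sphereUnif E) := by
  set w : E → ℝ≥0∞ := fun x => betaWeight (1 / (k + 1 : ℝ)) (‖x‖ ^ 2) with hw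
  set h : sphere (0 : E) 1 × ℝ → ℝ≥0∞ := fun z =>
    ENNReal.ofReal (k + 1) * radialDensity E k z.2 with hh
  have hwm : Measurable w := by fun_prop
  have hhm : Measurable h := by fun_prop
  have hE := withDensity_betaWeight_norm_sq (E := E) k
  have s1 : SigmaFinite ((volume : Measure E).withDensity w) :=
    SigmaFinite.withDensity_of_ne_top (ae_of_all _ fun x => by
      simp only [hw, betaWeight, Set.indicator_apply]
      split_ifs <;> simp)
  have s2 : SigmaFinite ((sphereUnif E).withDensity h) :=
    SigmaFinite.withDensity_of_ne_top (ae_of_all _ fun x =>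
      ENNReal.mul_ne_top ENNReal.ofReal_ne_top ENNReal.ofReal_ne_top)
  have s3 : SigmaFinite (((sphereUnif E).withDensity h).map (radialPoint k)) := hE ▸ s1
  have hF : Measurable fun m : Fin n → E => ENNReal.ofReal (Δ m) ^ q := by fun_prop
  have hwp : Measurable fun m : Fin n → E => ∏ i, w (m i) :=
    Finset.measurable_prod _ fun i _ => by fun_prop
  have hhp : Measurable fun z : Fin n → sphere (0 : E) 1 × ℝ => ∏ i, h (z i) :=
    Finset.measurable_prod _ fun i _ => by fun_prop
  have h1 : betaMoment Δ q (1 / (k + 1 : ℝ)) =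
      ∫⁻ m, ENNReal.ofReal (Δ m) ^ q ∂(Measure.pi fun _ : Fin n => volume.withDensity w) := by
    rw [pi_withDensity volume w hwm, lintegral_withDensity_eq_lintegral_mul _ hwp hF]
    rfl
  have h2 : (Measure.pi fun _ : Fin n => volume.withDensity w) =
      (Measure.pi fun _ : Fin n => (sphereUnif E).withDensity h).map
        fun z i => radialPoint k (z i) := by
    rw [Measure.pi_map_pi (μ := fun _ : Fin n => (sphereUnif E).withDensity h)
      (f := fun _ => radialPoint k) fun i => by fun_prop, hE]
  have hFk : Measurable fun z : Fin n → sphere (0 : E) 1 × ℝ =>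
      ENNReal.ofReal (Δ fun i => radialPoint k (z i)) ^ q := hF.comp (by fun_prop)
  rw [h1, h2, lintegral_map hF (by fun_prop), pi_withDensity _ h hhm,
    lintegral_withDensity_eq_lintegral_mul _ hhp hFk,
    ← lintegral_const_mul' _ _ (ENNReal.pow_ne_top ENNReal.ofReal_ne_top)]
  refine lintegral_congr fun z => ?_
  simp [hh, Finset.prod_mul_distrib, mul_assoc]

end SphereLimit

section SphereLimit

variable {E : Type} [NormedAddCommGroup E] [InnerProductSpace ℝ E] [FiniteDimensional ℝ E]
  [MeasurableSpace E] [BorelSpace E] [Nontrivial E] {n : ℕ}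

/-- The (unnormalised) `q`-th moment of `Δ` for independent points on the unit sphere. -/
def surfaceMoment (Δ : (Fin n → E) → ℝ) (q : ℝ) : ℝ≥0∞ :=
  ∫⁻ ω : Fin n → sphere (0 : E) 1, ENNReal.ofReal (Δ fun i => (ω i : E)) ^ q
    ∂(Measure.pi fun _ => (volume : Measure E).toSphere)

omit [Nontrivial E] in
theorem map_fst_sphereUnif : (sphereUnif E).map Prod.fst = (volume : Measure E).toSphere := by
  rw [sphereUnif, Measure.map_fst_prod]
  simp

omit [Nontrivial E] in
theorem lintegral_pi_sphereUnif_fst {f : (Fin n → sphere (0 : E) 1) → ℝ≥0∞} (hf : Measurable f) :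
    ∫⁻ z, f (fun i => (z i).1) ∂(Measure.pi fun _ : Fin n => sphereUnif E) =
      ∫⁻ ω, f ω ∂(Measure.pi fun _ => (volume : Measure E).toSphere) := by
  have s : SigmaFinite ((sphereUnif E).map Prod.fst) := by
    rw [map_fst_sphereUnif]; infer_instance
  have h : (Measure.pi fun _ : Fin n => (volume : Measure E).toSphere) =
      (Measure.pi fun _ : Fin n => sphereUnif E).map fun z i => (z i).1 := by
    rw [Measure.pi_map_pi (μ := fun _ : Fin n => sphereUnif E)
      (f := fun _ => Prod.fst) fun i => by fun_prop, map_fst_sphereUnif]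
  rw [h, lintegral_map hf (by fun_prop)]

omit [Nontrivial E] in
theorem lintegral_pi_sphereUnif_eq_surfaceMoment {Δ : (Fin n → E) → ℝ} (hΔ : Measurable Δ)
    (q : ℝ) : ∫⁻ z, ENNReal.ofReal (Δ fun i => ((z i).1 : E)) ^ q
      ∂(Measure.pi fun _ : Fin n => sphereUnif E) = surfaceMoment Δ q := by
  have hm : Measurable fun ω : Fin n → sphere (0 : E) 1 =>
      ENNReal.ofReal (Δ fun i => (ω i : E)) ^ q := by fun_prop
  exact lintegral_pi_sphereUnif_fst hm

omit [Nontrivial E] in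
theorem ae_pi_sphereUnif : ∀ᵐ z ∂(Measure.pi fun _ : Fin n => sphereUnif E),
    ∀ i, (z i).2 ∈ Set.Ioo (0 : ℝ) 1 :=
  ae_all_iff.2 fun i =>
    (Measure.quasiMeasurePreserving_eval (fun _ : Fin n => sphereUnif E) i).ae
      (p := fun z => z.2 ∈ Set.Ioo (0 : ℝ) 1)
      (Measure.quasiMeasurePreserving_snd.ae (ae_restrict_mem measurableSet_Ioo))

omit [FiniteDimensional ℝ E] [MeasurableSpace E] [BorelSpace E] [Nontrivial E] in
theorem tendsto_radialPoint {z : sphere (0 : E) 1 × ℝ} (hz : z.2 ∈ Set.Ioo (0 : ℝ) 1) :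
    Tendsto (fun k => radialPoint k z) atTop (𝓝 (z.1 : E)) := by
  have h : Tendsto (fun k : ℕ => z.2 ^ (k + 1)) atTop (𝓝 0) :=
    (tendsto_add_atTop_iff_nat 1).2 (tendsto_pow_atTop_nhds_zero_of_lt_one hz.1.le hz.2)
  simpa [radialPoint] using ((h.const_sub 1).sqrt).smul_const (z.1 : E)

omit [FiniteDimensional ℝ E] [MeasurableSpace E] [BorelSpace E] [Nontrivial E] in
theorem tendsto_prod_radialDensity {v : Fin n → ℝ} (hv : ∀ i, v i ∈ Set.Ioo (0 : ℝ) 1) :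
    Tendsto (fun k => ∏ i, radialDensity E k (v i)) atTop (𝓝 (ENNReal.ofReal ((1 / 2) ^ n))) := by
  have h : ∀ i, Tendsto (fun k : ℕ => 1 / 2 * (1 - v i ^ (k + 1)) ^
      ((Module.finrank ℝ E : ℝ) / 2 - 1)) atTop (𝓝 (1 / 2)) := fun i => by
    have h : Tendsto (fun k : ℕ => v i ^ (k + 1)) atTop (𝓝 0) :=
      (tendsto_add_atTop_iff_nat 1).2 (tendsto_pow_atTop_nhds_zero_of_lt_one (hv i).1.le (hv i).2)
    have h2 := ((h.const_sub 1).rpow_const (p := (Module.finrank ℝ E : ℝ) / 2 - 1)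
      (Or.inl (by norm_num))).const_mul (1 / 2)
    simpa using h2
  have h3 := ENNReal.tendsto_ofReal (tendsto_finsetProd Finset.univ fun i _ => h i)
  have e : ∀ k : ℕ, ENNReal.ofReal (∏ i, 1 / 2 * (1 - v i ^ (k + 1)) ^
      ((Module.finrank ℝ E : ℝ) / 2 - 1)) = ∏ i, radialDensity E k (v i) := fun k => by
    rw [ENNReal.ofReal_prod_of_nonneg fun i _ => ?_]
    · rfl
    · have : 0 ≤ 1 - v i ^ (k + 1) := by
        linarith [pow_le_one₀ (n := k + 1) (hv i).1.le (hv i).2.le]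
      positivity
  simp_rw [e] at h3
  simpa using h3

omit [FiniteDimensional ℝ E] [MeasurableSpace E] [BorelSpace E] [Nontrivial E] in
theorem tendsto_sphereUnif_integrand {Δ : (Fin n → E) → ℝ} (hΔ : Continuous Δ) (q : ℝ)
    {z : Fin n → sphere (0 : E) 1 × ℝ} (hz : ∀ i, (z i).2 ∈ Set.Ioo (0 : ℝ) 1) :
    Tendsto (fun k => (∏ i, radialDensity E k (z i).2) *
      ENNReal.ofReal (Δ fun i => radialPoint k (z i)) ^ q) atTop
      (𝓝 (ENNReal.ofReal ((1 / 2) ^ n) * ENNReal.ofReal (Δ fun i => ((z i).1 : E)) ^ q)) := by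
  have h1 : Tendsto (fun k => Δ fun i => radialPoint k (z i)) atTop
      (𝓝 (Δ fun i => ((z i).1 : E))) :=
    (hΔ.tendsto _).comp (tendsto_pi_nhds.2 fun i => tendsto_radialPoint (hz i))
  -- In `ℝ≥0∞` the power is continuous for every real exponent, with `0 ^ q = ∞` for `q < 0`, so
  -- zeros of `Δ` need no separate treatment.
  have h2 := (ENNReal.continuous_rpow_const (y := q)).tendsto _ |>.comp (ENNReal.tendsto_ofReal h1)
  refine ENNReal.Tendsto.mul (tendsto_prod_radialDensity hz) (Or.inl ?_) h2 (Or.inr ?_)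
  · exact (ENNReal.ofReal_pos.2 (by positivity)).ne'
  · exact ENNReal.ofReal_ne_top

/-- By `b Γ(b) = Γ(b + 1)`, the quantity `b B(a, b)` equals `Γ(a) Γ(b + 1) / Γ(a + b)`, which is
continuous at `b = 0`. -/
theorem tendsto_mul_beta {a : ℝ} (ha : 0 < a) :
    Tendsto (fun k : ℕ => 1 / (k + 1 : ℝ) * ProbabilityTheory.beta a (1 / (k + 1 : ℝ))) atTop
      (𝓝 1) := by
  have hb : Tendsto (fun k : ℕ => 1 / (k + 1 : ℝ)) atTop (𝓝 0) :=
    tendsto_one_div_add_atTop_nhds_zero_nat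
  have c : ∀ {x : ℝ}, 0 < x → ContinuousAt Real.Gamma x := fun {x} hx =>
    (Real.differentiableAt_Gamma fun m => by
      have : (0 : ℝ) ≤ m := m.cast_nonneg
      linarith).continuousAt
  have h1 : Tendsto (fun k : ℕ => Real.Gamma (1 / (k + 1 : ℝ) + 1)) atTop (𝓝 1) := by
    have := (c (x := 0 + 1) (by norm_num)).tendsto.comp (hb.add_const 1)
    simpa [Function.comp_def] using this
  have h2 : Tendsto (fun k : ℕ => Real.Gamma (a + 1 / (k + 1 : ℝ))) atTop (𝓝 (Real.Gamma a)) := by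
    have := (c (x := a + 0) (by simpa)).tendsto.comp (hb.const_add a)
    simpa [Function.comp_def] using this
  have hG := (Real.Gamma_pos_of_pos ha).ne'
  have h3 := (h1.const_mul (Real.Gamma a)).div h2 hG
  rw [mul_one, div_self hG] at h3
  refine h3.congr fun k => ?_
  rw [ProbabilityTheory.beta, Pi.div_apply, Real.Gamma_add_one (by positivity)]
  ring

theorem tendsto_beta {p y : ℝ} (hy : 0 < y) (hp : 0 < p) {u : ℕ → ℝ}
    (hu : Tendsto u atTop (𝓝 y)) :
    Tendsto (fun k => ProbabilityTheory.beta p (u k)) atTop (𝓝 (ProbabilityTheory.beta p y)) := by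
  have c : ∀ {x : ℝ}, 0 < x → ContinuousAt Real.Gamma x := fun {x} hx =>
    (Real.differentiableAt_Gamma fun m => by
      have : (0 : ℝ) ≤ m := m.cast_nonneg
      linarith).continuousAt
  exact (((c hy).tendsto.comp hu).const_mul _).div
    ((c (add_pos hp hy)).tendsto.comp (hu.const_add p)) (Real.Gamma_pos_of_pos (add_pos hp hy)).ne'

theorem lintegral_sphereUnif_eq {Δ : (Fin n → E) → ℝ} (hΔ : Measurable Δ) (q : ℝ) (k : ℕ) :
    ∫⁻ z, (∏ i, radialDensity E k (z i).2) * ENNReal.ofReal (Δ fun i => radialPoint k (z i)) ^ q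
        ∂(Measure.pi fun _ : Fin n => sphereUnif E) =
      ENNReal.ofReal (1 / (k + 1 : ℝ)) ^ n * betaMoment Δ q (1 / (k + 1 : ℝ)) := by
  have hk : (0 : ℝ) < k + 1 := by positivity
  rw [betaMoment_eq_lintegral_sphereUnif hΔ, ← mul_assoc, ← mul_pow,
    ← ENNReal.ofReal_mul (by positivity), one_div_mul_cancel hk.ne']
  simp

/-- For `q < 0` the integrand need not be bounded, so the limit `b → 0` is taken by Fatou. The
inequality suffices: the value at negative `q` comes later from continuation, which requires only
finiteness here. -/
theorem HasGaussianMoment.surfaceMoment_lt_top {Δ : (Fin n → E) → ℝ} {C q : ℝ}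
    (h : HasGaussianMoment Δ C q) (hΔ : Continuous Δ) (hC : 0 < C) (hn : 0 < n) (hq : q < 0)
    (ha : 0 < (Module.finrank ℝ E + q) / 2)
    (hy : 0 < n * ((Module.finrank ℝ E + q) / 2 - 1) + 1) : surfaceMoment Δ q < ∞ := by
  set a := (Module.finrank ℝ E + q) / 2
  have hb : Tendsto (fun k : ℕ => 1 / (k + 1 : ℝ)) atTop (𝓝 0) :=
    tendsto_one_div_add_atTop_nhds_zero_nat
  have hI := lintegral_liminf_le (u := atTop) (μ := Measure.pi fun _ : Fin n => sphereUnif E)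
    (f := fun (k : ℕ) z => (∏ i, radialDensity E k (z i).2) *
      ENNReal.ofReal (Δ fun i => radialPoint k (z i)) ^ q) fun k =>
      (Finset.measurable_prod _ fun i _ => by fun_prop).mul
        ((hΔ.measurable.comp (by fun_prop)).ennreal_ofReal.pow_const q)
  have hlim : ∫⁻ z, liminf (fun k => (∏ i, radialDensity E k (z i).2) *
      ENNReal.ofReal (Δ fun i => radialPoint k (z i)) ^ q) atTop
      ∂(Measure.pi fun _ : Fin n => sphereUnif E) =
      ENNReal.ofReal ((1 / 2) ^ n) * surfaceMoment Δ q := by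
    rw [← lintegral_pi_sphereUnif_eq_surfaceMoment hΔ.measurable,
      ← lintegral_const_mul' _ _ ENNReal.ofReal_ne_top]
    refine lintegral_congr_ae (ae_pi_sphereUnif.mono fun z hz => ?_)
    exact (tendsto_sphereUnif_integrand hΔ q hz).liminf_eq
  have hval : ∀ k : ℕ, ∫⁻ z, (∏ i, radialDensity E k (z i).2) *
      ENNReal.ofReal (Δ fun i => radialPoint k (z i)) ^ q
      ∂(Measure.pi fun _ : Fin n => sphereUnif E) =
      ENNReal.ofReal (C / (Real.Gamma a ^ n * Real.Gamma (-q / 2)) *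
        ((1 / (k + 1 : ℝ) * ProbabilityTheory.beta a (1 / (k + 1 : ℝ))) ^ n *
        ProbabilityTheory.beta (-q / 2) (n * (a + 1 / (k + 1 : ℝ) - 1) + 1))) := fun k => by
    have hk : 0 < 1 / (k + 1 : ℝ) := by positivity
    have hB := ProbabilityTheory.beta_pos ha hk
    have hGa := Real.Gamma_pos_of_pos ha
    have hGq : 0 < Real.Gamma (-q / 2) := Real.Gamma_pos_of_pos (by linarith)
    rw [lintegral_sphereUnif_eq hΔ.measurable, h.betaMoment_of_neg hΔ.measurable hC hn hq ha hk
      (by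
        have : 0 < n * (1 / (k + 1 : ℝ)) := by positivity
        change 0 < n * (a + 1 / (k + 1 : ℝ) - 1) + 1
        linarith), ENNReal.ofReal_mul (by positivity),
        ENNReal.ofReal_mul (by positivity), ENNReal.ofReal_pow (by positivity),
        ENNReal.ofReal_mul hk.le, mul_pow]
    ring
  simp_rw [hlim, hval] at hI
  have ht : Tendsto (fun k : ℕ => ENNReal.ofReal (C / (Real.Gamma a ^ n * Real.Gamma (-q / 2)) *
        ((1 / (k + 1 : ℝ) * ProbabilityTheory.beta a (1 / (k + 1 : ℝ))) ^ n *
        ProbabilityTheory.beta (-q / 2) (n * (a + 1 / (k + 1 : ℝ) - 1) + 1)))) atTop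
      (𝓝 (ENNReal.ofReal (C / (Real.Gamma a ^ n * Real.Gamma (-q / 2)) *
        (1 ^ n * ProbabilityTheory.beta (-q / 2) (n * (a - 1) + 1))))) := by
    refine ENNReal.tendsto_ofReal ((((tendsto_mul_beta ha).pow n).mul
      (tendsto_beta hy (by linarith) ?_)).const_mul _)
    have := (((hb.const_add a).sub_const 1).const_mul (n : ℝ)).add_const 1
    simpa using this
  rw [ht.liminf_eq] at hI
  have h2 := lt_of_le_of_lt hI ENNReal.ofReal_lt_top
  by_contra hc
  rw [not_lt, top_le_iff] at hc
  rw [hc, ENNReal.mul_top (ENNReal.ofReal_pos.2 (by positivity)).ne'] at h2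
  exact lt_irrefl _ h2

omit [Nontrivial E] in
theorem lintegral_sphereUnif_rpow_lt_top :
    ∫⁻ z, ENNReal.ofReal ((1 - z.2) ^ (-1 / 2 : ℝ)) ∂(sphereUnif E) < ∞ := by
  have h := lintegral_betaWeight (a := 1) (b := 1 / 2) one_pos (by norm_num)
  have h1 : ∫⁻ v in Set.Ioo (0 : ℝ) 1, ENNReal.ofReal ((1 - v) ^ (-1 / 2 : ℝ)) < ∞ := by
    refine lt_of_le_of_lt ?_ (h ▸ ENNReal.ofReal_lt_top)
    rw [lintegral_powMeasure 1 (by fun_prop)]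
    refine le_trans (le_of_eq ?_) (lintegral_mono_set (s := Set.Ioo (0 : ℝ) 1) Set.Ioo_subset_Ioi_self)
    refine setLIntegral_congr_fun measurableSet_Ioo fun v hv => ?_
    simp only [sub_self, Real.rpow_zero, ENNReal.ofReal_one, one_mul]
    rw [betaWeight_of_lt hv.2]
    norm_num
  rw [sphereUnif, lintegral_prod _ (by fun_prop)]
  simp only [lintegral_const]
  exact ENNReal.mul_lt_top h1 (measure_lt_top _ _)

-- The exponent `d/2 - 1` is at least `-1/2`, with equality in dimension one, and `v^{k+1} ≤ v`. The
-- bound is integrable and independent of `k`, as domination requires.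
omit [MeasurableSpace E] [BorelSpace E] in
theorem radialDensity_le (k : ℕ) {v : ℝ} (hv : v ∈ Set.Ioo (0 : ℝ) 1) :
    radialDensity E k v ≤ ENNReal.ofReal ((1 - v) ^ (-1 / 2 : ℝ)) := by
  have h1 : v ^ (k + 1) ≤ v := pow_le_of_le_one hv.1.le hv.2.le (by omega)
  have h2 : 0 < v ^ (k + 1) := pow_pos hv.1 _
  have h3 : 0 < 1 - v := by linarith [hv.2]
  have hd : (1 : ℝ) ≤ Module.finrank ℝ E := by exact_mod_cast Module.finrank_pos (R := ℝ) (M := E)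
  refine ENNReal.ofReal_le_ofReal ?_
  have h4 : (1 - v ^ (k + 1)) ^ ((Module.finrank ℝ E : ℝ) / 2 - 1) ≤
      (1 - v ^ (k + 1)) ^ (-1 / 2 : ℝ) :=
    Real.rpow_le_rpow_of_exponent_ge (by linarith) (by linarith) (by linarith)
  have h5 : (1 - v ^ (k + 1)) ^ (-1 / 2 : ℝ) ≤ (1 - v) ^ (-1 / 2 : ℝ) :=
    Real.rpow_le_rpow_of_nonpos h3 (by linarith) (by norm_num)
  have h6 : 0 ≤ (1 - v) ^ (-1 / 2 : ℝ) := by positivity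
  linarith

omit [Nontrivial E] [MeasurableSpace E] [BorelSpace E] in
theorem exists_bound_of_norm_le_one {Δ : (Fin n → E) → ℝ} (hΔ : Continuous Δ) :
    ∃ M, ∀ m, (∀ i, ‖m i‖ ≤ 1) → Δ m ≤ M := by
  have hK : IsCompact (Set.univ.pi fun _ : Fin n => closedBall (0 : E) 1) :=
    isCompact_univ_pi fun _ => isCompact_closedBall _ _
  obtain ⟨M, hM⟩ := hK.bddAbove_image hΔ.continuousOn
  exact ⟨M, fun m hm => hM ⟨m, by simpa using hm, rfl⟩⟩

/-- For `q > 0` the function `Δ^q` is bounded on the product of unit balls and the radial densities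
have an integrable majorant, so dominated convergence passes to `b = 0` in the identity for beta
moments. The factor `(1/2)^n` is the limit of the radial densities. -/
theorem HasGaussianMoment.surfaceMoment_mul_of_pos {Δ : (Fin n → E) → ℝ} {C q : ℝ} {N : ℕ}
    (h : HasGaussianMoment Δ C q) (hΔ : Continuous Δ)
    (hhom : ∀ (c : ℝ) m, 0 ≤ c → Δ (c • m) = c ^ N * Δ m)
    (hC : 0 < C) (hn : 0 < n) (hq : 0 < q)
    (hy : 0 < N * q / 2 + n * ((Module.finrank ℝ E : ℝ) / 2 - 1) + 1) :
    ENNReal.ofReal ((1 / 2) ^ n) * surfaceMoment Δ q * ENNReal.ofReal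
      (ProbabilityTheory.beta (q / 2) (N * q / 2 + n * ((Module.finrank ℝ E : ℝ) / 2 - 1) + 1)) =
      ENNReal.ofReal (C * Real.Gamma (q / 2) /
        Real.Gamma ((Module.finrank ℝ E + q) / 2) ^ n) := by
  have ha : 0 < (Module.finrank ℝ E + q) / 2 := by positivity
  set a := (Module.finrank ℝ E + q) / 2
  have hb : Tendsto (fun k : ℕ => 1 / (k + 1 : ℝ)) atTop (𝓝 0) :=
    tendsto_one_div_add_atTop_nhds_zero_nat
  obtain ⟨M, hM⟩ := exists_bound_of_norm_le_one hΔ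
  have hΔm := hΔ.measurable
  have hlim := tendsto_lintegral_of_dominated_convergence
    (μ := Measure.pi fun _ : Fin n => sphereUnif E)
    (F := fun k z => (∏ i, radialDensity E k (z i).2) *
      ENNReal.ofReal (Δ fun i => radialPoint k (z i)) ^ q)
    (f := fun z => ENNReal.ofReal ((1 / 2) ^ n) *
      ENNReal.ofReal (Δ fun i => ((z i).1 : E)) ^ q)
    (fun z => (∏ i, ENNReal.ofReal ((1 - (z i).2) ^ (-1 / 2 : ℝ))) * ENNReal.ofReal M ^ q)
    (fun k => (Finset.measurable_prod _ fun i _ => by fun_prop).mul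
        ((hΔm.comp (by fun_prop)).ennreal_ofReal.pow_const q))
    (fun k => ae_pi_sphereUnif.mono fun z hz => by
      refine mul_le_mul' (Finset.prod_le_prod' fun i _ => radialDensity_le k (hz i))
        (ENNReal.rpow_le_rpow (ENNReal.ofReal_le_ofReal (hM _ fun i => ?_)) hq.le)
      rw [radialPoint, norm_smul, Real.norm_of_nonneg (Real.sqrt_nonneg _),
        norm_eq_of_mem_sphere, mul_one, Real.sqrt_le_one]
      linarith [pow_pos (hz i).1 (k + 1)])
    (by
      rw [lintegral_mul_const' _ _ (ENNReal.rpow_ne_top_of_nonneg hq.le ENNReal.ofReal_ne_top),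
        lintegral_pi_prod (sphereUnif E) (fun _ z => ENNReal.ofReal ((1 - z.2) ^ (-1 / 2 : ℝ)))
          fun i => by fun_prop]
      exact ENNReal.mul_ne_top (ENNReal.prod_ne_top fun i _ => lintegral_sphereUnif_rpow_lt_top.ne)
        (ENNReal.rpow_ne_top_of_nonneg hq.le ENNReal.ofReal_ne_top))
    (ae_pi_sphereUnif.mono fun z hz => tendsto_sphereUnif_integrand hΔ q hz)
  rw [lintegral_const_mul' _ _ ENNReal.ofReal_ne_top,
    lintegral_pi_sphereUnif_eq_surfaceMoment hΔm] at hlim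
  have hyk : ∀ k : ℕ, 0 < N * q / 2 + n *
      ((Module.finrank ℝ E : ℝ) / 2 + 1 / (k + 1 : ℝ) - 1) + 1 := fun k => by
    have : 0 < n * (1 / (k + 1 : ℝ)) := by positivity
    linarith
  have ht : Tendsto (fun k : ℕ => ENNReal.ofReal (ProbabilityTheory.beta (q / 2)
      (N * q / 2 + n * ((Module.finrank ℝ E : ℝ) / 2 + 1 / (k + 1 : ℝ) - 1) + 1))) atTop
      (𝓝 (ENNReal.ofReal (ProbabilityTheory.beta (q / 2)
        (N * q / 2 + n * ((Module.finrank ℝ E : ℝ) / 2 - 1) + 1)))) := by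
    refine ENNReal.tendsto_ofReal (tendsto_beta hy (by linarith) ?_)
    have := ((((hb.const_add ((Module.finrank ℝ E : ℝ) / 2)).sub_const 1).const_mul
      (n : ℝ)).const_add (N * q / 2)).add_const 1
    simpa using this
  have h1 := ENNReal.Tendsto.mul hlim
    (Or.inr ENNReal.ofReal_ne_top) ht (Or.inl (ENNReal.ofReal_pos.2
      (ProbabilityTheory.beta_pos (by linarith) hy)).ne')
  have h2 : Tendsto (fun k : ℕ => ENNReal.ofReal (C * Real.Gamma (q / 2) / Real.Gamma a ^ n *
      (1 / (k + 1 : ℝ) * ProbabilityTheory.beta a (1 / (k + 1 : ℝ))) ^ n)) atTop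
      (𝓝 (ENNReal.ofReal (C * Real.Gamma (q / 2) / Real.Gamma a ^ n * 1 ^ n))) :=
    ENNReal.tendsto_ofReal (((tendsto_mul_beta ha).pow n).const_mul _)
  rw [one_pow, mul_one] at h2
  refine tendsto_nhds_unique h1 (h2.congr fun k => ?_)
  have hk : 0 < 1 / (k + 1 : ℝ) := by positivity
  have hB := ProbabilityTheory.beta_pos ha hk
  have hGa := Real.Gamma_pos_of_pos ha
  have hGq : 0 < Real.Gamma (q / 2) := Real.Gamma_pos_of_pos (by linarith)
  rw [lintegral_sphereUnif_eq hΔm, mul_assoc,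
    h.betaMoment_mul_of_pos hΔm hhom hC hn hq hk (hyk k), ENNReal.ofReal_mul (by positivity),
    ENNReal.ofReal_pow (by positivity), ENNReal.ofReal_mul hk.le, mul_pow]
  ring

end SphereLimit

/-! ### From real moments to complex moments, by analytic continuation. -/

section MellinContinuation

open ProbabilityTheory

variable {α : Type*} {mα : MeasurableSpace α} {μ : Measure α} {X : α → ℝ} {a : ℝ}

theorem lintegral_ofReal_exp_mul_log (hX : Measurable X) (s : ℝ) :
    ∫⁻ x in {x | 0 < X x}, ENNReal.ofReal (Real.exp (s * Real.log (X x))) ∂μ =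
      ∫⁻ x in {x | 0 < X x}, ENNReal.ofReal (X x) ^ s ∂μ := by
  refine setLIntegral_congr_fun (measurableSet_lt measurable_const hX) fun x (hx : 0 < X x) => ?_
  rw [ENNReal.ofReal_rpow_of_pos hx, Real.rpow_def_of_pos hx, mul_comm]

/-- The moment of order `s` over `{X > 0}` is the moment generating function of `log X` at `s`. The
order `0` is not assumed finite; it follows from its neighbours because the set of admissible
exponents is convex. -/
theorem Ioi_subset_integrableExpSet_log (hX : Measurable X)
    (hfin : ∀ s : ℝ, a < s → s ≠ 0 → ∫⁻ x, ENNReal.ofReal (X x) ^ s ∂μ < ∞) :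
    Set.Ioi a ⊆ integrableExpSet (fun x => Real.log (X x)) (μ.restrict {x | 0 < X x}) := by
  have h0 : ∀ s : ℝ, a < s → s ≠ 0 →
      s ∈ integrableExpSet (fun x => Real.log (X x)) (μ.restrict {x | 0 < X x}) := by
    intro s hs hs0
    refine ⟨Measurable.aestronglyMeasurable (by fun_prop), ?_⟩
    rw [hasFiniteIntegral_iff_ofReal (ae_of_all _ fun x => (Real.exp_pos _).le),
      lintegral_ofReal_exp_mul_log hX]
    exact lt_of_le_of_lt (setLIntegral_le_lintegral _ _) (hfin s hs hs0)
  intro s hs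
  by_cases hs0 : s = 0
  · have ha : a < 0 := hs0 ▸ hs
    have h := convex_integrableExpSet (h0 (a / 2) (by linarith) (by linarith))
      (h0 (-a / 2) (by linarith) (by linarith)) (a := 1 / 2) (b := 1 / 2)
      (by norm_num) (by norm_num) (by norm_num)
    rw [hs0]
    convert h using 1
    simp only [smul_eq_mul]
    ring
  · exact h0 s hs hs0

/-- The hypothesis rules out the convention `0 ^ 0 = 1`, the only case in which the zero set of `X`
would contribute. -/
theorem ofReal_cpow_eq_indicator {q : ℂ} {x : ℝ} (hx : 0 ≤ x) (h : q ≠ 0 ∨ 0 < x) :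
    (x : ℂ) ^ q = if 0 < x then Complex.exp (q * Real.log x) else 0 := by
  rcases hx.eq_or_lt with rfl | hx
  · have : q ≠ 0 := h.resolve_right (lt_irrefl _)
    simp [this]
  · rw [if_pos hx, Complex.cpow_def_of_ne_zero (by exact_mod_cast hx.ne'),
      Complex.ofReal_log hx.le, mul_comm]

/-- Real moments determine complex moments. -/
theorem integral_cpow_of_real_moments (hX : Measurable X) (h0 : ∀ x, 0 ≤ X x) {G : ℂ → ℂ}
    (hfin : ∀ s : ℝ, a < s → s ≠ 0 → ∫⁻ x, ENNReal.ofReal (X x) ^ s ∂μ < ∞)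
    (hval : ∀ s : ℝ, a < s → 0 < s → ((∫⁻ x, ENNReal.ofReal (X x) ^ s ∂μ).toReal : ℂ) = G s)
    (hG : DifferentiableOn ℂ G {q | a < q.re}) {q : ℂ} (hq : a < q.re)
    (hq0 : q ≠ 0 ∨ ∀ᵐ x ∂μ, 0 < X x) :
    Integrable (fun x => (X x : ℂ) ^ q) μ ∧ ∫ x, (X x : ℂ) ^ q ∂μ = G q := by
  set S : Set α := {x | 0 < X x} with hS
  have hSm : MeasurableSet S := measurableSet_lt measurable_const hX
  set Y : α → ℝ := fun x => Real.log (X x) with hY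
  have hI := Ioi_subset_integrableExpSet_log hX hfin
  have hint : Set.Ioi a ⊆ interior (integrableExpSet Y (μ.restrict S)) :=
    interior_maximal hI isOpen_Ioi
  have hopen : IsOpen {q : ℂ | a < q.re} := isOpen_lt continuous_const Complex.continuous_re
  have hconn : IsPreconnected {q : ℂ | a < q.re} := (convex_halfSpace_re_gt a).isPreconnected
  have h1 : AnalyticOnNhd ℂ (complexMGF Y (μ.restrict S)) {q | a < q.re} :=
    analyticOnNhd_complexMGF.mono fun z hz => hint hz
  have h2 : AnalyticOnNhd ℂ G {q | a < q.re} := hG.analyticOnNhd hopen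
  -- For `s > 0` the set `{X = 0}` contributes nothing, so restricting to `{X > 0}` loses nothing.
  have hreal : ∀ s : ℝ, a < s → 0 < s → complexMGF Y (μ.restrict S) s = G s := by
    intro s hs hs0
    rw [complexMGF_ofReal, ← hval s hs hs0, mgf,
      integral_eq_lintegral_of_nonneg_ae (ae_of_all _ fun x => (Real.exp_pos _).le) (by fun_prop),
      lintegral_ofReal_exp_mul_log hX, ← lintegral_indicator hSm]
    congr 3
    funext x
    by_cases hx : x ∈ S
    · rw [Set.indicator_of_mem hx]
    · rw [Set.indicator_of_notMem hx, ENNReal.ofReal_of_nonpos (not_lt.1 hx),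
        ENNReal.zero_rpow_of_pos hs0]
  -- Identity theorem on a connected half-plane: both sides are analytic and agree on a real
  -- interval around `max a 0 + 1`, a point chosen to lie in the half-plane and to be positive.
  have heq : Set.EqOn (complexMGF Y (μ.restrict S)) G {q | a < q.re} := by
    refine AnalyticOnNhd.eqOn_of_preconnected_of_frequently_eq h1 h2 hconn
      (z₀ := ((max a 0 + 1 : ℝ) : ℂ))
      (show a < (((max a 0 + 1 : ℝ) : ℂ)).re by
        rw [Complex.ofReal_re]
        linarith [le_max_left a 0]) ?_
    have h_real : ∃ᶠ s : ℝ in 𝓝[≠] (max a 0 + 1), complexMGF Y (μ.restrict S) s = G s := by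
      refine Eventually.frequently (eventually_nhdsWithin_of_eventually_nhds ?_)
      filter_upwards [Ioi_mem_nhds (show max a 0 < max a 0 + 1 by linarith)] with s hs
      exact hreal s (lt_of_le_of_lt (le_max_left _ _) hs) (lt_of_le_of_lt (le_max_right _ _) hs)
    rw [frequently_iff_seq_forall] at h_real ⊢
    obtain ⟨xs, hx_tendsto, hx_eq⟩ := h_real
    refine ⟨fun n ↦ xs n, ?_, hx_eq⟩
    rw [tendsto_nhdsWithin_iff] at hx_tendsto ⊢
    exact ⟨(Complex.continuous_ofReal.tendsto _).comp hx_tendsto.1,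
      hx_tendsto.2.mono fun n hn h => hn (Complex.ofReal_injective h)⟩
  have hae : (fun x => (X x : ℂ) ^ q) =ᵐ[μ] S.indicator fun x => Complex.exp (q * Y x) := by
    have hor : ∀ᵐ x ∂μ, q ≠ 0 ∨ 0 < X x := by
      rcases hq0 with h | h
      · exact ae_of_all _ fun x => Or.inl h
      · exact h.mono fun x hx => Or.inr hx
    filter_upwards [hor] with x hx
    rw [ofReal_cpow_eq_indicator (h0 x) hx, Set.indicator_apply]
    rfl
  constructor
  · rw [integrable_congr hae, integrable_indicator_iff hSm]
    exact integrable_cexp_mul_of_re_mem_integrableExpSet (by fun_prop) (hI hq)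
  · rw [integral_congr_ae hae, integral_indicator hSm]
    exact heq hq

/-- In `ℝ≥0∞` one has `0 ^ s = ∞` for `s < 0`, so a finite negative moment forces the zero set to be
null. -/
theorem ae_pos_of_lintegral_rpow_neg (hX : Measurable X) {s : ℝ} (hs : s < 0)
    (h : ∫⁻ x, ENNReal.ofReal (X x) ^ s ∂μ < ∞) : ∀ᵐ x ∂μ, 0 < X x := by
  filter_upwards [ae_lt_top (by fun_prop) h.ne] with x hx
  by_contra hc
  rw [ENNReal.ofReal_of_nonpos (not_lt.1 hc), ENNReal.zero_rpow_of_neg hs] at hx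
  exact lt_irrefl _ hx

end MellinContinuation

/-! ### Complex moments for Gaussian points, the ball and the sphere. -/

section ComplexMoments

theorem differentiableAt_Gamma_comp {f : ℂ → ℂ} {q : ℂ} (hf : DifferentiableAt ℂ f q)
    (h : 0 < (f q).re) : DifferentiableAt ℂ (fun z => Complex.Gamma (f z)) q := by
  refine DifferentiableAt.comp (g := Complex.Gamma) q (Complex.differentiableAt_Gamma _ ?_) hf
  intro m hm
  have h1 : (f q).re = -(m : ℝ) := by rw [hm]; simp
  have h2 : (0 : ℝ) ≤ m := m.cast_nonneg
  linarith

theorem differentiable_inv_Gamma_comp {f : ℂ → ℂ} (hf : Differentiable ℂ f) :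
    Differentiable ℂ (fun z => (Complex.Gamma (f z))⁻¹) :=
  Complex.differentiable_one_div_Gamma.comp hf

theorem eq_ofReal_div_of_mul_ofReal_eq {x : ℝ≥0∞} {k r : ℝ} (hk : 0 < k)
    (h : x * ENNReal.ofReal k = ENNReal.ofReal r) : x = ENNReal.ofReal (r / k) := by
  rw [ENNReal.ofReal_div_of_pos hk]
  exact (ENNReal.eq_div_iff (ENNReal.ofReal_pos.2 hk).ne' ENNReal.ofReal_ne_top).2
    ((mul_comm _ _).trans h)

variable {E : Type} [NormedAddCommGroup E] [InnerProductSpace ℝ E] [FiniteDimensional ℝ E]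
  [MeasurableSpace E] [BorelSpace E] {N : ℕ}

/-- A continuous nonnegative function, homogeneous of degree `N`, all of whose moments of order
greater than `-β` under Gaussians of arbitrary variances are given by constants `c` with an
analytic extension `C`. -/
structure HasGaussianMoments (Δ : (Fin (N + 1) → E) → ℝ) (β : ℝ) (c : ℝ → ℝ) (C : ℂ → ℂ) :
    Prop where
  continuous : Continuous Δ
  nonneg : ∀ m, 0 ≤ Δ m
  homogeneous : ∀ (r : ℝ) m, 0 ≤ r → Δ (r • m) = r ^ N * Δ m
  pos : 0 < β
  le_finrank : β ≤ Module.finrank ℝ E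
  dim_pos : 0 < N
  dim_le : N ≤ Module.finrank ℝ E
  moment : ∀ s : ℝ, -β < s → HasGaussianMoment Δ (c s) s
  const_pos : ∀ s : ℝ, -β < s → 0 < c s
  const_eq : ∀ s : ℝ, -β < s → C s = c s
  differentiableOn : DifferentiableOn ℂ C {q | -β < q.re}

namespace HasGaussianMoments

variable {Δ : (Fin (N + 1) → E) → ℝ} {β : ℝ} {c : ℝ → ℝ} {C : ℂ → ℂ}

theorem lintegral_gaussian (h : HasGaussianMoments Δ β c C) {s : ℝ} (hs : -β < s) :
    ∫⁻ m, ENNReal.ofReal (Real.exp (-∑ i, ‖m i‖ ^ 2)) * ENNReal.ofReal (Δ m) ^ s =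
      ENNReal.ofReal (c s * ((N + 1 : ℕ) : ℝ) ^ (s / 2)) := by
  have := h.moment s hs (fun _ => 1) fun _ => one_pos
  simpa using this

/-- The Gaussian measure of density `exp (-∑ ‖m i‖²)`. -/
def gaussianMeasure (E : Type) [NormedAddCommGroup E] [InnerProductSpace ℝ E]
    [FiniteDimensional ℝ E] [MeasurableSpace E] [BorelSpace E] (n : ℕ) : Measure (Fin n → E) :=
  volume.withDensity fun m => ENNReal.ofReal (Real.exp (-∑ i, ‖m i‖ ^ 2))

theorem lintegral_gaussianMeasure (h : HasGaussianMoments Δ β c C) {s : ℝ} (hs : -β < s) :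
    ∫⁻ m, ENNReal.ofReal (Δ m) ^ s ∂(gaussianMeasure E (N + 1)) =
      ENNReal.ofReal (c s * ((N + 1 : ℕ) : ℝ) ^ (s / 2)) := by
  have hm := h.continuous.measurable
  rw [gaussianMeasure, lintegral_withDensity_eq_lintegral_mul _ (by fun_prop) (by fun_prop)]
  exact h.lintegral_gaussian hs

/-- The Gaussian moment of order `-β/2` is finite, so `Δ > 0` almost everywhere for the Gaussian
measure. Its density is positive, so the same holds for Lebesgue measure. -/
theorem ae_pos (h : HasGaussianMoments Δ β c C) : ∀ᵐ m, 0 < Δ m := by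
  have hm := h.continuous.measurable
  have hβ := h.pos
  have h1 : ∀ᵐ m ∂(gaussianMeasure E (N + 1)), 0 < Δ m :=
    ae_pos_of_lintegral_rpow_neg hm (s := -β / 2) (by linarith)
      (by rw [h.lintegral_gaussianMeasure (by linarith)]; exact ENNReal.ofReal_lt_top)
  refine (withDensity_absolutelyContinuous' (Measurable.aemeasurable (by fun_prop)) (ae_of_all _ fun m => ?_)).ae_le h1
  exact (ENNReal.ofReal_pos.2 (Real.exp_pos _)).ne'

theorem integral_gaussianMeasure (h : HasGaussianMoments Δ β c C) {q : ℂ} (hq : -β < q.re) :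
    Integrable (fun m => (Δ m : ℂ) ^ q) (gaussianMeasure E (N + 1)) ∧
      ∫ m, (Δ m : ℂ) ^ q ∂(gaussianMeasure E (N + 1)) = C q * ((N + 1 : ℕ) : ℂ) ^ (q / 2) := by
  refine integral_cpow_of_real_moments (a := -β) h.continuous.measurable h.nonneg
    (G := fun q => C q * ((N + 1 : ℕ) : ℂ) ^ (q / 2)) (fun s hs _ => ?_) (fun s hs _ => ?_) ?_ hq
    (Or.inr ((withDensity_absolutelyContinuous _ _).ae_le h.ae_pos))
  · rw [h.lintegral_gaussianMeasure hs]
    exact ENNReal.ofReal_lt_top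
  · have hc := h.const_pos s hs
    rw [h.lintegral_gaussianMeasure hs, ENNReal.toReal_ofReal (by positivity), h.const_eq s hs]
    push_cast
    rw [Complex.ofReal_cpow (by positivity)]
    push_cast
    rfl
  · refine h.differentiableOn.mul (Differentiable.differentiableOn ?_)
    have : ((N + 1 : ℕ) : ℂ) ≠ 0 := by exact_mod_cast N.succ_ne_zero
    intro q
    exact DifferentiableAt.const_cpow (by fun_prop) (Or.inl this)

theorem integral_gaussian (h : HasGaussianMoments Δ β c C) {q : ℂ} (hq : -β < q.re) :
    Integrable (fun m => (Real.exp (-∑ i, ‖m i‖ ^ 2) : ℂ) * (Δ m : ℂ) ^ q) ∧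
      ∫ m, (Real.exp (-∑ i, ‖m i‖ ^ 2) : ℂ) * (Δ m : ℂ) ^ q =
        C q * ((N + 1 : ℕ) : ℂ) ^ (q / 2) := by
  obtain ⟨h1, h2⟩ := h.integral_gaussianMeasure hq
  have hm : Measurable fun m : Fin (N + 1) → E =>
      (Real.exp (-∑ i, ‖m i‖ ^ 2)).toNNReal := by fun_prop
  have e : ∀ m : Fin (N + 1) → E, (Real.exp (-∑ i, ‖m i‖ ^ 2)).toNNReal • (Δ m : ℂ) ^ q =
      (Real.exp (-∑ i, ‖m i‖ ^ 2) : ℂ) * (Δ m : ℂ) ^ q := fun m => by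
    rw [NNReal.smul_def, Real.coe_toNNReal _ (Real.exp_pos _).le, Complex.real_smul]
  constructor
  · have := (integrable_withDensity_iff_integrable_smul hm).1 h1
    simpa only [e] using this
  · have := integral_withDensity_eq_integral_smul (μ := volume) hm fun m => (Δ m : ℂ) ^ q
    simp only [e] at this
    rw [← this]
    exact h2

/-- On the product of balls the Gaussian weight is at least `e^{-(N+1)}`, so the Gaussian moment
dominates, for every `s > -β` of either sign. -/
theorem lintegral_ball_lt_top (h : HasGaussianMoments Δ β c C) {s : ℝ} (hs : -β < s) :
    ∫⁻ m in {m : Fin (N + 1) → E | ∀ i, ‖m i‖ ≤ 1}, ENNReal.ofReal (Δ m) ^ s < ∞ := by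
  have hm := h.continuous.measurable
  have hB : MeasurableSet {m : Fin (N + 1) → E | ∀ i, ‖m i‖ ≤ 1} := by measurability
  have h1 : ∫⁻ m in {m : Fin (N + 1) → E | ∀ i, ‖m i‖ ≤ 1}, ENNReal.ofReal (Δ m) ^ s ≤
      ∫⁻ m, ENNReal.ofReal (Real.exp (N + 1)) *
        (ENNReal.ofReal (Real.exp (-∑ i, ‖m i‖ ^ 2)) * ENNReal.ofReal (Δ m) ^ s) := by
    refine le_trans (setLIntegral_mono (by fun_prop) fun m hm => ?_) (setLIntegral_le_lintegral _ _)
    rw [← mul_assoc, ← ENNReal.ofReal_mul (Real.exp_pos _).le, ← Real.exp_add]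
    refine le_mul_of_one_le_left' ?_
    rw [ENNReal.one_le_ofReal, Real.one_le_exp_iff]
    have : ∑ i, ‖m i‖ ^ 2 ≤ ∑ _i : Fin (N + 1), (1 : ℝ) :=
      Finset.sum_le_sum fun i _ => pow_le_one₀ (norm_nonneg _) (hm i)
    simp at this
    linarith
  refine lt_of_le_of_lt h1 ?_
  rw [lintegral_const_mul' _ _ ENNReal.ofReal_ne_top, h.lintegral_gaussian hs]
  exact ENNReal.mul_lt_top ENNReal.ofReal_lt_top ENNReal.ofReal_lt_top

/-- For `b = 1` the weight is the indicator of the open ball; closed and open ball differ by a null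
sphere. -/
theorem _root_.SimplexMoment.lintegral_ball_eq_betaMoment [Nontrivial E]
    (Δ : (Fin (N + 1) → E) → ℝ) (s : ℝ) :
    ∫⁻ m in {m : Fin (N + 1) → E | ∀ i, ‖m i‖ ≤ 1}, ENNReal.ofReal (Δ m) ^ s =
      betaMoment Δ s 1 := by
  have hB : MeasurableSet {m : Fin (N + 1) → E | ∀ i, ‖m i‖ ≤ 1} := by measurability
  have hS : ∀ᵐ m : Fin (N + 1) → E, ∀ i, ‖m i‖ ≠ 1 := by
    refine ae_all_iff.2 fun i => (Measure.quasiMeasurePreserving_eval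
      (fun _ : Fin (N + 1) => (volume : Measure E)) i).ae (p := fun x => ‖x‖ ≠ 1) ?_
    have := Measure.addHaar_sphere (volume : Measure E) 0 1
    refine (measure_eq_zero_iff_ae_notMem.1 this).mono fun x hx hx1 => hx (by simpa using hx1)
  rw [betaMoment, ← lintegral_indicator hB]
  refine lintegral_congr_ae (hS.mono fun m hm => ?_)
  by_cases hx : ∀ i, ‖m i‖ ≤ 1
  · rw [Set.indicator_of_mem (show m ∈ {m : Fin (N + 1) → E | ∀ i, ‖m i‖ ≤ 1} from hx)]
    have e : ∀ i, betaWeight 1 (‖m i‖ ^ 2) = 1 := fun i => by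
      rw [betaWeight_of_lt (pow_lt_one₀ (norm_nonneg _) (lt_of_le_of_ne (hx i) (hm i)) two_ne_zero)]
      simp
    simp [e]
  · rw [Set.indicator_of_notMem (show m ∉ {m : Fin (N + 1) → E | ∀ i, ‖m i‖ ≤ 1} from hx)]
    push Not at hx
    obtain ⟨i, hi⟩ := hx
    have e : betaWeight 1 (‖m i‖ ^ 2) = 0 := betaWeight_of_le (by nlinarith)
    exact (mul_eq_zero_of_left (Finset.prod_eq_zero (Finset.mem_univ i) e) _).symm

/-- The factor `Γ(s/2)` cancels between the two sides of the beta-moment identity. Denominators are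
written as reciprocals of `Γ`, which are entire, so the expression extends analytically as it
stands. -/
theorem betaMoment_one (h : HasGaussianMoments Δ β c C) {s : ℝ} (hs : 0 < s) :
    betaMoment Δ s 1 = ENNReal.ofReal (c s *
      Real.Gamma ((N + 1) * ((Module.finrank ℝ E + s) / 2) + 1) *
      ((Real.Gamma (N * s / 2 + (N + 1) * (Module.finrank ℝ E / 2) + 1))⁻¹ *
        (Real.Gamma ((Module.finrank ℝ E + s) / 2 + 1))⁻¹ ^ (N + 1))) := by
  have hβ := h.pos
  have hc := h.const_pos s (by linarith)
  have ha : 0 < (Module.finrank ℝ E + s) / 2 := by positivity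
  have hy : 0 < N * s / 2 + (N + 1 : ℕ) * ((Module.finrank ℝ E : ℝ) / 2 + 1 - 1) + 1 := by
    rw [add_sub_cancel_right]
    positivity
  have key := (h.moment s (by linarith)).betaMoment_mul_of_pos h.continuous.measurable
    h.homogeneous hc N.succ_pos hs one_pos hy
  have hB := ProbabilityTheory.beta_pos ha one_pos
  have hG1 := Real.Gamma_pos_of_pos ha
  have hG2 := Real.Gamma_pos_of_pos (half_pos hs)
  have hG3 := Real.Gamma_pos_of_pos hy
  have hG4 := Real.Gamma_pos_of_pos (add_pos (half_pos hs) hy)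
  have hG5 := Real.Gamma_pos_of_pos (add_pos ha one_pos)
  rw [← ENNReal.ofReal_pow hB.le, ← ENNReal.ofReal_mul (by positivity)] at key
  rw [eq_ofReal_div_of_mul_ofReal_eq (ProbabilityTheory.beta_pos (half_pos hs) hy) key]
  congr 1
  have e1 : (N : ℝ) * s / 2 + (N + 1) * (Module.finrank ℝ E / 2) + 1 =
      N * s / 2 + (N + 1 : ℕ) * ((Module.finrank ℝ E : ℝ) / 2 + 1 - 1) + 1 := by
    push_cast; ring
  have e2 : ((N : ℝ) + 1) * ((Module.finrank ℝ E + s) / 2) + 1 = s / 2 +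
      (N * s / 2 + (N + 1 : ℕ) * ((Module.finrank ℝ E : ℝ) / 2 + 1 - 1) + 1) := by
    push_cast; ring
  rw [e1, e2]
  simp only [ProbabilityTheory.beta, Real.Gamma_one, mul_one, div_pow, inv_pow]
  generalize Real.Gamma ((Module.finrank ℝ E + s) / 2) = g1 at hG1 ⊢
  generalize Real.Gamma (s / 2) = g2 at hG2 ⊢
  generalize Real.Gamma ((Module.finrank ℝ E + s) / 2 + 1) = g5 at hG5 ⊢
  generalize Real.Gamma (s / 2 + (N * s / 2 + (N + 1 : ℕ) *
    ((Module.finrank ℝ E : ℝ) / 2 + 1 - 1) + 1)) = g4 at hG4 ⊢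
  generalize Real.Gamma (N * s / 2 + (N + 1 : ℕ) *
    ((Module.finrank ℝ E : ℝ) / 2 + 1 - 1) + 1) = g3 at hG3 ⊢
  field_simp

/-- Moments for points in the unit ball. -/
theorem integral_ball [Nontrivial E] (h : HasGaussianMoments Δ β c C) {q : ℂ} (hq : -β < q.re) :
    IntegrableOn (fun m => (Δ m : ℂ) ^ q) {m : Fin (N + 1) → E | ∀ i, ‖m i‖ ≤ 1} ∧
      ∫ m in {m : Fin (N + 1) → E | ∀ i, ‖m i‖ ≤ 1}, (Δ m : ℂ) ^ q =
        C q * Complex.Gamma ((N + 1) * ((Module.finrank ℝ E + q) / 2) + 1) *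
          ((Complex.Gamma (N * q / 2 + (N + 1) * (Module.finrank ℝ E / 2) + 1))⁻¹ *
            (Complex.Gamma ((Module.finrank ℝ E + q) / 2 + 1))⁻¹ ^ (N + 1)) := by
  have hd := h.le_finrank
  refine integral_cpow_of_real_moments (a := -β) h.continuous.measurable h.nonneg
    (G := fun q => C q * Complex.Gamma ((N + 1) * ((Module.finrank ℝ E + q) / 2) + 1) *
          ((Complex.Gamma (N * q / 2 + (N + 1) * (Module.finrank ℝ E / 2) + 1))⁻¹ *
            (Complex.Gamma ((Module.finrank ℝ E + q) / 2 + 1))⁻¹ ^ (N + 1)))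
    (fun s hs _ => h.lintegral_ball_lt_top hs) (fun s hs hs0 => ?_) ?_ hq
    (Or.inr (ae_restrict_of_ae h.ae_pos))
  · have hc := h.const_pos s hs
    have hG1 : 0 < Real.Gamma ((N + 1) * ((Module.finrank ℝ E + s) / 2) + 1) :=
      Real.Gamma_pos_of_pos (by positivity)
    have hG2 : 0 < Real.Gamma (N * s / 2 + (N + 1) * (Module.finrank ℝ E / 2) + 1) :=
      Real.Gamma_pos_of_pos (by positivity)
    have hG3 : 0 < Real.Gamma ((Module.finrank ℝ E + s) / 2 + 1) :=
      Real.Gamma_pos_of_pos (by positivity)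
    rw [lintegral_ball_eq_betaMoment, h.betaMoment_one hs0,
      ENNReal.toReal_ofReal (by positivity), h.const_eq s hs]
    simp only [Complex.ofReal_mul, Complex.ofReal_inv, Complex.ofReal_pow, ← Complex.Gamma_ofReal]
    push_cast
    rfl
  · refine (h.differentiableOn.mul fun z hz => ?_).mul (Differentiable.differentiableOn ?_)
    · refine (differentiableAt_Gamma_comp (by fun_prop) ?_).differentiableWithinAt
      have hz' : -β < z.re := hz
      have e : (((N : ℂ) + 1) * ((Module.finrank ℝ E + z) / 2) + 1).re =
          ((N : ℝ) + 1) * ((Module.finrank ℝ E + z.re) / 2) + 1 := by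
        simp [Complex.add_re, Complex.mul_re]
      rw [e]
      have : 0 < Module.finrank ℝ E + z.re := by linarith
      positivity
    · exact (differentiable_inv_Gamma_comp (by fun_prop)).mul
        ((differentiable_inv_Gamma_comp (by fun_prop)).pow _)

theorem surfaceMoment_eq [Nontrivial E] (h : HasGaussianMoments Δ β c C) {s : ℝ} (hs : 0 < s) :
    surfaceMoment Δ s = ENNReal.ofReal (2 ^ (N + 1) * (c s *
      Real.Gamma ((N + 1) * ((Module.finrank ℝ E + s) / 2) - N) *
      ((Real.Gamma (N * s / 2 + (N + 1) * (Module.finrank ℝ E / 2) - N))⁻¹ *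
        (Real.Gamma ((Module.finrank ℝ E + s) / 2))⁻¹ ^ (N + 1)))) := by
  have hβ := h.pos
  have hc := h.const_pos s (by linarith)
  have ha : 0 < (Module.finrank ℝ E + s) / 2 := by positivity
  have hN : (1 : ℝ) ≤ N := by exact_mod_cast h.dim_pos
  have hNd : (N : ℝ) ≤ Module.finrank ℝ E := by exact_mod_cast h.dim_le
  -- Here `d ≥ N ≥ 1` gives `(N + 1) d / 2 ≥ N`, and `N s / 2 > 0` makes the inequality strict.
  have hy : 0 < N * s / 2 + (N + 1 : ℕ) * ((Module.finrank ℝ E : ℝ) / 2 - 1) + 1 := by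
    push_cast
    have : 0 < N * s := by positivity
    nlinarith
  have key := (h.moment s (by linarith)).surfaceMoment_mul_of_pos h.continuous
    h.homogeneous hc N.succ_pos hs hy
  have hG1 := Real.Gamma_pos_of_pos ha
  have hG2 := Real.Gamma_pos_of_pos (half_pos hs)
  have hG3 := Real.Gamma_pos_of_pos hy
  have hG4 := Real.Gamma_pos_of_pos (add_pos (half_pos hs) hy)
  have hB := ProbabilityTheory.beta_pos (half_pos hs) hy
  rw [mul_comm (ENNReal.ofReal _), mul_assoc, ← ENNReal.ofReal_mul (by positivity)] at key
  rw [eq_ofReal_div_of_mul_ofReal_eq (by positivity) key]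
  congr 1
  have e1 : (N : ℝ) * s / 2 + (N + 1) * (Module.finrank ℝ E / 2) - N =
      N * s / 2 + (N + 1 : ℕ) * ((Module.finrank ℝ E : ℝ) / 2 - 1) + 1 := by
    push_cast; ring
  have e2 : ((N : ℝ) + 1) * ((Module.finrank ℝ E + s) / 2) - N = s / 2 +
      (N * s / 2 + (N + 1 : ℕ) * ((Module.finrank ℝ E : ℝ) / 2 - 1) + 1) := by
    push_cast; ring
  rw [e1, e2]
  simp only [ProbabilityTheory.beta, div_pow, inv_pow, one_pow]
  generalize Real.Gamma ((Module.finrank ℝ E + s) / 2) = g1 at hG1 ⊢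
  generalize Real.Gamma (s / 2) = g2 at hG2 ⊢
  generalize Real.Gamma (s / 2 + (N * s / 2 + (N + 1 : ℕ) *
    ((Module.finrank ℝ E : ℝ) / 2 - 1) + 1)) = g4 at hG4 ⊢
  generalize Real.Gamma (N * s / 2 + (N + 1 : ℕ) *
    ((Module.finrank ℝ E : ℝ) / 2 - 1) + 1) = g3 at hG3 ⊢
  field_simp

/-- Moments for points on the unit sphere. -/
theorem integral_sphere [Nontrivial E] (h : HasGaussianMoments Δ β c C) {q : ℂ} (hq : -β < q.re)
    (hq' : 2 * (N : ℝ) < (N + 1) * (q.re + Module.finrank ℝ E)) (hq0 : q ≠ 0) :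
    Integrable (fun m : Fin (N + 1) → sphere (0 : E) 1 => (Δ fun i => (m i : E) : ℂ) ^ q)
        (Measure.pi fun _ => (volume : Measure E).toSphere) ∧
      ∫ m : Fin (N + 1) → sphere (0 : E) 1, (Δ fun i => (m i : E) : ℂ) ^ q
        ∂(Measure.pi fun _ => (volume : Measure E).toSphere) =
        2 ^ (N + 1) * (C q * Complex.Gamma ((N + 1) * ((Module.finrank ℝ E + q) / 2) - N) *
          ((Complex.Gamma (N * q / 2 + (N + 1) * (Module.finrank ℝ E / 2) - N))⁻¹ *
            (Complex.Gamma ((Module.finrank ℝ E + q) / 2))⁻¹ ^ (N + 1))) := by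
  have hd := h.le_finrank
  have hN : (1 : ℝ) ≤ N := by exact_mod_cast h.dim_pos
  have hNd : (N : ℝ) ≤ Module.finrank ℝ E := by exact_mod_cast h.dim_le
  -- The convergence threshold on the sphere is exactly positivity of the argument of the remaining
  -- gamma factor in the numerator, so the domain of analyticity is the half-plane beyond both
  -- thresholds.
  have hth : ∀ s : ℝ, 2 * (N : ℝ) / (N + 1) - Module.finrank ℝ E < s ↔
      0 < (N + 1) * ((Module.finrank ℝ E + s) / 2) - N := fun s => by
    rw [sub_lt_iff_lt_add, div_lt_iff₀ (by positivity)]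
    constructor <;> intro <;> linarith
  have hm := h.continuous.measurable
  refine integral_cpow_of_real_moments
    (a := max (-β) (2 * (N : ℝ) / (N + 1) - Module.finrank ℝ E))
    (X := fun m : Fin (N + 1) → sphere (0 : E) 1 => Δ fun i => (m i : E)) (by fun_prop)
    (fun _ => h.nonneg _)
    (G := fun q => 2 ^ (N + 1) *
        (C q * Complex.Gamma ((N + 1) * ((Module.finrank ℝ E + q) / 2) - N) *
          ((Complex.Gamma (N * q / 2 + (N + 1) * (Module.finrank ℝ E / 2) - N))⁻¹ *
            (Complex.Gamma ((Module.finrank ℝ E + q) / 2))⁻¹ ^ (N + 1))))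
    (fun s hs hs0 => ?_) (fun s hs hs0 => ?_) ?_ (max_lt hq ((hth _).2 (by linarith)))
    -- Positivity of `Δ` almost everywhere for Lebesgue measure says nothing about the sphere, so `q
    -- ≠ 0` is used instead.
    (Or.inl hq0)
  · change surfaceMoment Δ s < ∞
    rw [max_lt_iff, hth] at hs
    rcases lt_or_gt_of_ne hs0 with hneg | hpos
    · refine (h.moment s hs.1).surfaceMoment_lt_top h.continuous (h.const_pos s hs.1) N.succ_pos
        hneg (by linarith) ?_
      push_cast
      linarith [hs.2]
    · rw [h.surfaceMoment_eq hpos]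
      exact ENNReal.ofReal_lt_top
  · change ((surfaceMoment Δ s).toReal : ℂ) = _
    rw [max_lt_iff, hth] at hs
    have hc := h.const_pos s hs.1
    have hG1 := Real.Gamma_pos_of_pos hs.2
    have hG2 : 0 < Real.Gamma (N * s / 2 + (N + 1) * (Module.finrank ℝ E / 2) - N) := by
      refine Real.Gamma_pos_of_pos ?_
      have : 0 < N * s := by positivity
      nlinarith
    have hG3 : 0 < Real.Gamma ((Module.finrank ℝ E + s) / 2) :=
      Real.Gamma_pos_of_pos (by positivity)
    rw [h.surfaceMoment_eq hs0, ENNReal.toReal_ofReal (by positivity), h.const_eq s hs.1]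
    simp only [Complex.ofReal_mul, Complex.ofReal_inv, Complex.ofReal_pow, ← Complex.Gamma_ofReal]
    push_cast
    rfl
  · refine DifferentiableOn.const_mul (((h.differentiableOn.mono fun z hz => ?_).mul fun z hz => ?_).mul
      (Differentiable.differentiableOn ?_)) _
    · have hz' : max (-β) (2 * (N : ℝ) / (N + 1) - Module.finrank ℝ E) < z.re := hz
      exact (max_lt_iff.1 hz').1
    · refine (differentiableAt_Gamma_comp (by fun_prop) ?_).differentiableWithinAt
      have e : (((N : ℂ) + 1) * ((Module.finrank ℝ E + z) / 2) - N).re =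
          ((N : ℝ) + 1) * ((Module.finrank ℝ E + z.re) / 2) - N := by
        simp [Complex.add_re, Complex.mul_re]
      have hz' : max (-β) (2 * (N : ℝ) / (N + 1) - Module.finrank ℝ E) < z.re := hz
      rw [e]
      exact (hth _).1 (max_lt_iff.1 hz').2
    · exact (differentiable_inv_Gamma_comp (by fun_prop)).mul
        ((differentiable_inv_Gamma_comp (by fun_prop)).pow _)

end HasGaussianMoments

end ComplexMoments

/-! ### Matching the gamma-function values with the stated closed forms. -/

section ClosedForms

/-- The product `∏_{j=1}^N Γ((βj + q)/2) / Γ(βj/2)`. -/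
def gammaProd (β N : ℕ) (q : ℂ) : ℂ :=
  ∏ i ∈ Finset.range N, Complex.Gamma ((((i + 1 : ℕ) : ℂ) * β + q) / 2) /
    Complex.Gamma ((((i + 1 : ℕ) : ℂ) * β) / 2)

/-- The analytic extension of the Gaussian moments. -/
def gaussianConst (β N : ℕ) (q : ℂ) : ℂ :=
  (Real.pi : ℂ) ^ ((N * β * (N + 1) : ℂ) / 2) * gammaProd β N q

theorem pi_rpow_mul_gaussianDetValue (β N : ℕ) (q : ℝ) :
    Real.pi ^ ((N * β : ℝ) / 2) * gaussianDetValue β N q =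
      Real.pi ^ ((N * β * (N + 1) : ℝ) / 2) * ∏ i ∈ Finset.range N,
        Real.Gamma (((i + 1 : ℕ) * β + q) / 2) / Real.Gamma (((i + 1 : ℕ) * β : ℝ) / 2) := by
  have hp := Real.pi_pos
  induction N with
  | zero => simp [gaussianDetValue]
  | succ N ih =>
    rw [gaussianDetValue, Finset.prod_range_succ, Finset.prod_range_succ, ← gaussianDetValue]
    generalize Real.Gamma (((N + 1 : ℕ) * β + q) / 2) / Real.Gamma (((N + 1 : ℕ) * β : ℝ) / 2) = R
    have e1 : Real.pi ^ ((((N + 1 : ℕ) : ℝ) * β) / 2) =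
        Real.pi ^ ((N * β : ℝ) / 2) * Real.pi ^ ((β : ℝ) / 2) := by
      rw [← Real.rpow_add hp]; congr 1; push_cast; ring
    have e2 : Real.pi ^ ((((N + 1 : ℕ) : ℝ) * β * ((N + 1 : ℕ) + 1)) / 2) =
        Real.pi ^ ((N * β * (N + 1) : ℝ) / 2) * (Real.pi ^ ((N * β : ℝ) / 2) *
          Real.pi ^ ((N * β : ℝ) / 2) * Real.pi ^ ((β : ℝ) / 2) * Real.pi ^ ((β : ℝ) / 2)) := by
      simp only [← Real.rpow_add hp]; congr 1; push_cast; ring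
    have e3 : (Real.pi ^ ((β : ℝ) / 2)) ^ N = Real.pi ^ ((N * β : ℝ) / 2) := by
      rw [← Real.rpow_natCast, ← Real.rpow_mul hp.le]; congr 1; ring
    rw [e1, e2, e3]
    linear_combination ((Real.pi ^ ((N * β : ℝ) / 2)) ^ 2 *
      (Real.pi ^ ((β : ℝ) / 2)) ^ 2 * R) * ih

theorem gaussianConst_ofReal (β N : ℕ) (s : ℝ) :
    gaussianConst β N s =
      ((Real.pi ^ ((N * β : ℝ) / 2) * gaussianDetValue β N s : ℝ) : ℂ) := by
  rw [pi_rpow_mul_gaussianDetValue, gaussianConst, gammaProd]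
  push_cast
  rw [Complex.ofReal_cpow Real.pi_pos.le]
  simp only [← Complex.Gamma_ofReal]
  push_cast
  rfl

theorem differentiableOn_gaussianConst {β : ℕ} (N : ℕ) :
    DifferentiableOn ℂ (gaussianConst β N) {q | -(β : ℝ) < q.re} := by
  unfold gaussianConst gammaProd
  refine DifferentiableOn.const_mul (DifferentiableOn.fun_finsetProd fun i _ => ?_) _
  refine DifferentiableOn.div_const (fun z hz => ?_) _
  refine (differentiableAt_Gamma_comp (by fun_prop) ?_).differentiableWithinAt
  have hz' : -(β : ℝ) < z.re := hz
  have e : (((((i + 1 : ℕ) : ℂ) * β + z) / 2)).re = ((i + 1 : ℕ) * β + z.re) / 2 := by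
    simp [Complex.add_re, Complex.mul_re]
  rw [e]
  have : (0 : ℝ) ≤ i * β := by positivity
  push_cast
  linarith

theorem pi_cpow (x : ℂ) : (Real.pi : ℂ) ^ x = Complex.exp (x * Real.log Real.pi) := by
  rw [Complex.cpow_def_of_ne_zero (by exact_mod_cast Real.pi_ne_zero),
    Complex.ofReal_log Real.pi_pos.le, mul_comm]

theorem div_pi_cpow {r : ℝ} (hr : 0 ≤ r) (x : ℂ) :
    ((r : ℂ) / Real.pi) ^ x = (r : ℂ) ^ x * Complex.exp (-x * Real.log Real.pi) := by
  rw [div_eq_mul_inv, ← Complex.ofReal_inv,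
    Complex.mul_cpow_ofReal_nonneg hr (inv_nonneg.2 Real.pi_pos.le),
    Complex.cpow_def_of_ne_zero (x := ((Real.pi⁻¹ : ℝ) : ℂ))
      (by exact_mod_cast inv_ne_zero Real.pi_ne_zero),
    ← Complex.ofReal_log (inv_nonneg.2 Real.pi_pos.le), Real.log_inv]
  push_cast
  ring_nf

theorem one_div_pi_cpow (x : ℂ) :
    (1 / Real.pi : ℂ) ^ x = Complex.exp (-x * Real.log Real.pi) := by
  simpa using div_pi_cpow zero_le_one x

/-- No gamma factor need be assumed nonzero: if one of them vanishes, division by zero makes both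
sides `0`. -/
theorem sphereArea_div (a q : ℂ) :
    sphereArea a / sphereArea (a + q) = Complex.exp (-(q / 2) * Real.log Real.pi) *
      (Complex.Gamma ((a + q) / 2) / Complex.Gamma (a / 2)) := by
  have e : Complex.exp ((a + q) / 2 * Real.log Real.pi) =
      Complex.exp (a / 2 * Real.log Real.pi) * Complex.exp (q / 2 * Real.log Real.pi) := by
    rw [← Complex.exp_add]; ring_nf
  rw [sphereArea, sphereArea, div_div_div_eq, pi_cpow, pi_cpow, e, neg_mul, Complex.exp_neg]
  have h1 := Complex.exp_ne_zero (a / 2 * Real.log Real.pi)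
  have h2 := Complex.exp_ne_zero (q / 2 * Real.log Real.pi)
  generalize Complex.exp (a / 2 * Real.log Real.pi) = x at *
  generalize Complex.exp (q / 2 * Real.log Real.pi) = y at *
  rcases eq_or_ne (Complex.Gamma (a / 2)) 0 with h | h
  · simp [h]
  · field_simp

/-- The reindexing `i ↦ N - i` reverses the product, and `β (n - i + 1)` is `β (N - i + 1) + q`, so
each factor is an instance of `sphereArea_div`. -/
theorem areaRatio_eq {β : ℕ} (hβ : 0 < β) (N : ℕ) (q : ℂ) :
    areaRatio β N (N + q / β) =
      Complex.exp (-(q / 2) * Real.log Real.pi) ^ N * gammaProd β N q := by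
  have hβ' : (β : ℂ) ≠ 0 := by exact_mod_cast hβ.ne'
  have h : areaRatio β N (N + q / β) = ∏ j ∈ Finset.range N,
      (Complex.exp (-(q / 2) * Real.log Real.pi) *
      (Complex.Gamma ((((j + 1 : ℕ) : ℂ) * β + q) / 2) /
        Complex.Gamma ((((j + 1 : ℕ) : ℂ) * β) / 2))) := by
    rw [areaRatio]
    refine Finset.prod_nbij' (fun i => N - i) (fun j => N - j) ?_ ?_ ?_ ?_ ?_
    · intro i hi; simp at hi ⊢; omega
    · intro i hi; simp at hi ⊢; omega
    · intro i hi; simp at hi ⊢; omega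
    · intro i hi; simp at hi ⊢; omega
    · intro i hi
      rw [Finset.mem_Icc] at hi
      rw [← sphereArea_div]
      have e : (((N - i + 1 : ℕ) : ℂ)) = N - i + 1 := by
        push_cast [Nat.cast_sub hi.2]; ring
      rw [e]
      congr 2
      · ring
      · field_simp
        ring
  rw [h, Finset.prod_mul_distrib, Finset.prod_const, Finset.card_range, gammaProd]

theorem gaussian_closed_form {β : ℕ} (hβ : 0 < β) (N : ℕ) (q : ℂ) :
    (1 / Real.pi : ℂ) ^ ((β * N * (N + 1) : ℂ) / 2) *
        (gaussianConst β N q * ((N + 1 : ℕ) : ℂ) ^ (q / 2)) =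
      ((N + 1) / Real.pi : ℂ) ^ (β * ((N + q / β : ℂ) - N) / 2) *
        areaRatio β N (N + q / β) *
        (1 / Real.pi : ℂ) ^ (β * (N + 1) * (N - (N + q / β : ℂ)) / 2) := by
  have hβ' : (β : ℂ) ≠ 0 := by exact_mod_cast hβ.ne'
  have e1 : (β * ((N + q / β : ℂ) - N) / 2) = q / 2 := by field_simp; ring
  have e2 : (β * (N + 1) * (N - (N + q / β : ℂ)) / 2) = -((N + 1) * (q / 2)) := by
    field_simp; ring
  have e3 : ((N + 1 : ℂ)) = ((N + 1 : ℝ) : ℂ) := by push_cast; rfl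
  rw [areaRatio_eq hβ, e1, e2, e3, div_pi_cpow (by positivity), one_div_pi_cpow, one_div_pi_cpow,
    gaussianConst, pi_cpow, ← Complex.exp_nat_mul]
  push_cast
  have e4 : Complex.exp (-((β * N * (N + 1) : ℂ) / 2) * Real.log Real.pi) *
      Complex.exp ((N * β * (N + 1) : ℂ) / 2 * Real.log Real.pi) =
      Complex.exp (-(q / 2) * Real.log Real.pi) *
        Complex.exp (N * (-(q / 2) * Real.log Real.pi)) *
        Complex.exp (- -((N + 1) * (q / 2)) * Real.log Real.pi) := by
    simp only [← Complex.exp_add]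
    congr 1
    ring
  linear_combination (gammaProd β N q * (N + 1 : ℂ) ^ (q / 2)) * e4

/-- `Γ(q/2)` is in the denominator of the sphere area and in the numerator of the beta function. The
hypothesis on `q` avoids its poles, where its assigned value `0` would block the cancellation. -/
theorem two_div_sphereArea_mul_eulerBeta {q y : ℂ} (hq : ∀ k : ℕ, q ≠ -2 * (k : ℂ)) :
    2 / (sphereArea q * eulerBeta (q / 2) y) =
      Complex.exp (-(q / 2) * Real.log Real.pi) *
        (Complex.Gamma (q / 2 + y) * (Complex.Gamma y)⁻¹) := by
  have hg : Complex.Gamma (q / 2) ≠ 0 := Complex.Gamma_ne_zero fun m hm => hq m (by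
    linear_combination 2 * hm)
  rw [sphereArea, eulerBeta, pi_cpow, neg_mul, Complex.exp_neg]
  have hx := Complex.exp_ne_zero (q / 2 * Real.log Real.pi)
  generalize Complex.exp (q / 2 * Real.log Real.pi) = x at *
  rcases eq_or_ne (Complex.Gamma y) 0 with h | h
  · simp [h]
  rcases eq_or_ne (Complex.Gamma (q / 2 + y)) 0 with h' | h'
  · simp [h']
  field_simp

variable {β N : ℕ} {q : ℂ}

theorem gaussianConst_eq_pow (β N : ℕ) (q : ℂ) :
    gaussianConst β N q =
      Complex.exp ((β * N : ℂ) / 2 * Real.log Real.pi) ^ (N + 1) * gammaProd β N q := by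
  rw [gaussianConst, pi_cpow, ← Complex.exp_nat_mul]
  congr 2
  push_cast
  ring

theorem dim_add_re_pos (hβ : 0 < β) (hN : 0 < N) (hq : -(β : ℝ) < q.re) :
    0 < ((β * N + q : ℂ) / 2).re := by
  have h1 : ((β * N + q : ℂ) / 2).re = (β * N + q.re) / 2 := by
    simp [Complex.add_re, Complex.mul_re]
  have h2 : (1 : ℝ) ≤ N := by exact_mod_cast hN
  have h3 : (0 : ℝ) < β := by exact_mod_cast hβ
  rw [h1]
  nlinarith

/-- After `Γ(q/2)` has cancelled, the formula is the `(N + 1)`-st power of the one-point identity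
`base`, times common factors. The powers of `π^{-q/2}` match: `N` from `areaRatio` and one from the
beta factor, one for each of the `N + 1` points. -/
theorem ball_closed_form (hβ : 0 < β) (hN : 0 < N) (hq : -(β : ℝ) < q.re)
    (hq0 : ∀ k : ℕ, q ≠ -2 * (k : ℂ)) :
    ((β * N : ℂ) / sphereArea (β * N)) ^ (N + 1) *
      (gaussianConst β N q * Complex.Gamma ((N + 1) * ((((N * β : ℕ) : ℂ) + q) / 2) + 1) *
          ((Complex.Gamma (N * q / 2 + (N + 1) * (((N * β : ℕ) : ℂ) / 2) + 1))⁻¹ *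
            (Complex.Gamma ((((N * β : ℕ) : ℂ) + q) / 2 + 1))⁻¹ ^ (N + 1))) =
    2 / (sphereArea (β * ((N + q / β : ℂ) - N)) *
        eulerBeta (β / 2 * ((N + q / β : ℂ) - N)) (β / 2 * N * ((N + q / β : ℂ) + 1) + 1)) *
      areaRatio β N (N + q / β) *
      (N * sphereArea (β * (N + q / β : ℂ)) / ((N + q / β : ℂ) * sphereArea (β * N))) ^ (N + 1) := by
  have hβ' : (β : ℂ) ≠ 0 := by exact_mod_cast hβ.ne'
  have hN' : (N : ℂ) ≠ 0 := by exact_mod_cast hN.ne'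
  have hw := dim_add_re_pos hβ hN hq
  have hw0 : (β * N + q : ℂ) / 2 ≠ 0 := fun h => by rw [h] at hw; simp at hw
  have hd : 0 < ((β * N : ℂ) / 2).re := by
    simpa using dim_add_re_pos (q := 0) hβ hN (by simpa using hβ)
  have hGw := Complex.Gamma_ne_zero_of_re_pos hw
  have hGd := Complex.Gamma_ne_zero_of_re_pos hd
  have a1 : β * ((N + q / β : ℂ) - N) = q := by field_simp; ring
  have a2 : β / 2 * ((N + q / β : ℂ) - N) = q / 2 := by field_simp; ring
  have a3 : (N * q / 2 + (N + 1) * (((N * β : ℕ) : ℂ) / 2) + 1) =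
      β / 2 * N * ((N + q / β : ℂ) + 1) + 1 := by push_cast; field_simp; ring
  have a4 : ((N : ℂ) + 1) * ((((N * β : ℕ) : ℂ) + q) / 2) + 1 =
      q / 2 + (β / 2 * N * ((N + q / β : ℂ) + 1) + 1) := by push_cast; field_simp; ring
  have a5 : (((N * β : ℕ) : ℂ) + q) / 2 = (β * N + q : ℂ) / 2 := by push_cast; ring
  have a6 : β * (N + q / β : ℂ) = β * N + q := by field_simp
  have a7 : (N + q / β : ℂ) = (β * N + q) / β := by field_simp
  have base : (β * N : ℂ) / sphereArea (β * N) *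
        Complex.exp ((β * N : ℂ) / 2 * Real.log Real.pi) *
        (Complex.Gamma ((β * N + q : ℂ) / 2 + 1))⁻¹ =
      N * sphereArea (β * (N + q / β : ℂ)) / ((N + q / β : ℂ) * sphereArea (β * N)) *
        Complex.exp (-(q / 2) * Real.log Real.pi) := by
    have e : Complex.exp ((β * N + q : ℂ) / 2 * Real.log Real.pi) =
        Complex.exp ((β * N : ℂ) / 2 * Real.log Real.pi) *
          Complex.exp (q / 2 * Real.log Real.pi) := by
      rw [← Complex.exp_add]; ring_nf
    rw [a6, a7, Complex.Gamma_add_one _ hw0, sphereArea, sphereArea, pi_cpow, pi_cpow, e, neg_mul,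
      Complex.exp_neg]
    have h1 := Complex.exp_ne_zero ((β * N : ℂ) / 2 * Real.log Real.pi)
    have h2 := Complex.exp_ne_zero (q / 2 * Real.log Real.pi)
    have hw1 : (β * N + q : ℂ) ≠ 0 := fun h => hw0 (by simp [h])
    generalize Complex.exp ((β * N : ℂ) / 2 * Real.log Real.pi) = x at *
    generalize Complex.exp (q / 2 * Real.log Real.pi) = z at *
    generalize Complex.Gamma ((β * N + q : ℂ) / 2) = g at *
    generalize Complex.Gamma ((β * N : ℂ) / 2) = g' at *
    field_simp
  rw [a1, a2, two_div_sphereArea_mul_eulerBeta hq0, a3, a4, a5, areaRatio_eq hβ,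
    gaussianConst_eq_pow]
  have hp := congrArg (· ^ (N + 1)) base
  simp only [mul_pow] at hp
  generalize Complex.Gamma (q / 2 + (β / 2 * N * ((N + q / β : ℂ) + 1) + 1)) = u
  generalize (Complex.Gamma (β / 2 * N * ((N + q / β : ℂ) + 1) + 1))⁻¹ = y
  linear_combination (gammaProd β N q * u * y) * hp

theorem sphere_closed_form (hβ : 0 < β) (hN : 0 < N) (hq : -(β : ℝ) < q.re)
    (hq0 : ∀ k : ℕ, q ≠ -2 * (k : ℂ)) :
    (1 / sphereArea (β * N)) ^ (N + 1) *
      (2 ^ (N + 1) * (gaussianConst β N q *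
          Complex.Gamma ((N + 1) * ((((N * β : ℕ) : ℂ) + q) / 2) - N) *
          ((Complex.Gamma (N * q / 2 + (N + 1) * (((N * β : ℕ) : ℂ) / 2) - N))⁻¹ *
            (Complex.Gamma ((((N * β : ℕ) : ℂ) + q) / 2))⁻¹ ^ (N + 1)))) =
    2 / (sphereArea (β * ((N + q / β : ℂ) - N)) *
        eulerBeta (β / 2 * ((N + q / β : ℂ) - N)) (β / 2 * N * ((N + q / β : ℂ) + 1) - N)) *
      areaRatio β N (N + q / β) *
      (sphereArea (β * (N + q / β : ℂ)) / sphereArea (β * N)) ^ (N + 1) := by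
  have hβ' : (β : ℂ) ≠ 0 := by exact_mod_cast hβ.ne'
  have hw := dim_add_re_pos hβ hN hq
  have hd : 0 < ((β * N : ℂ) / 2).re := by
    simpa using dim_add_re_pos (q := 0) hβ hN (by simpa using hβ)
  have hGw := Complex.Gamma_ne_zero_of_re_pos hw
  have hGd := Complex.Gamma_ne_zero_of_re_pos hd
  have a1 : β * ((N + q / β : ℂ) - N) = q := by field_simp; ring
  have a2 : β / 2 * ((N + q / β : ℂ) - N) = q / 2 := by field_simp; ring
  have a3 : (N * q / 2 + (N + 1) * (((N * β : ℕ) : ℂ) / 2) - N) =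
      β / 2 * N * ((N + q / β : ℂ) + 1) - N := by push_cast; field_simp; ring
  have a4 : ((N : ℂ) + 1) * ((((N * β : ℕ) : ℂ) + q) / 2) - N =
      q / 2 + (β / 2 * N * ((N + q / β : ℂ) + 1) - N) := by push_cast; field_simp; ring
  have a5 : (((N * β : ℕ) : ℂ) + q) / 2 = (β * N + q : ℂ) / 2 := by push_cast; ring
  have a6 : β * (N + q / β : ℂ) = β * N + q := by field_simp
  have base : 1 / sphereArea (β * N) * 2 *
        Complex.exp ((β * N : ℂ) / 2 * Real.log Real.pi) *
        (Complex.Gamma ((β * N + q : ℂ) / 2))⁻¹ =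
      sphereArea (β * (N + q / β : ℂ)) / sphereArea (β * N) *
        Complex.exp (-(q / 2) * Real.log Real.pi) := by
    have e : Complex.exp ((β * N + q : ℂ) / 2 * Real.log Real.pi) =
        Complex.exp ((β * N : ℂ) / 2 * Real.log Real.pi) *
          Complex.exp (q / 2 * Real.log Real.pi) := by
      rw [← Complex.exp_add]; ring_nf
    rw [a6, sphereArea, sphereArea, pi_cpow, pi_cpow, e, neg_mul, Complex.exp_neg]
    have h1 := Complex.exp_ne_zero ((β * N : ℂ) / 2 * Real.log Real.pi)
    have h2 := Complex.exp_ne_zero (q / 2 * Real.log Real.pi)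
    generalize Complex.exp ((β * N : ℂ) / 2 * Real.log Real.pi) = x at *
    generalize Complex.exp (q / 2 * Real.log Real.pi) = z at *
    generalize Complex.Gamma ((β * N + q : ℂ) / 2) = g at *
    generalize Complex.Gamma ((β * N : ℂ) / 2) = g' at *
    field_simp
  rw [a1, a2, two_div_sphereArea_mul_eulerBeta hq0, a3, a4, a5, areaRatio_eq hβ,
    gaussianConst_eq_pow]
  have hp := congrArg (· ^ (N + 1)) base
  simp only [mul_pow] at hp
  generalize Complex.Gamma (q / 2 + (β / 2 * N * ((N + q / β : ℂ) + 1) - N)) = u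
  generalize (Complex.Gamma (β / 2 * N * ((N + q / β : ℂ) + 1) - N))⁻¹ = y
  linear_combination (gammaProd β N q * u * y) * hp

end ClosedForms

/-! ### Moment formulas for any absolute determinant satisfying the axioms. -/

section Assembly

variable {F : Type} [NormedDivisionRing F] [StarRing F] [InnerProductSpace ℝ F]
  [FiniteDimensional ℝ F] [SecondCountableTopology F] [MeasurableSpace F] [BorelSpace F]
  {D : ∀ n : ℕ, Matrix (Fin n) (Fin n) F → ℝ}

namespace IsAbsDet

-- Scaling by `r` is multiplication by a real scalar matrix, so multiplicativity and the value of
-- `D` on real matrices give the degree `N`.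
omit [FiniteDimensional ℝ F] [SecondCountableTopology F] [MeasurableSpace F] [BorelSpace F] in
theorem map_simplexMatrix_smul (hD : IsAbsDet D) {N : ℕ} {r : ℝ} (hr : 0 ≤ r)
    (m : Fin (N + 1) → EuclideanSpace F (Fin N)) :
    D N (simplexMatrix (r • m)) = r ^ N * D N (simplexMatrix m) := by
  have h : simplexMatrix (r • m) =
      ((r • (1 : Matrix (Fin N) (Fin N) ℝ)).map fun r => r • (1 : F)) * simplexMatrix m := by
    ext i k
    rw [Matrix.mul_apply, Finset.sum_eq_single i]
    · simp [simplexMatrix, hD.smul_mul, smul_sub]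
    · intro j _ hj
      simp [Matrix.one_apply_ne hj.symm]
    · simp
  rw [h, hD.map_mul, hD.map_real, Matrix.det_smul, Matrix.det_one, mul_one, Fintype.card_fin,
    abs_of_nonneg (by positivity)]

theorem hasGaussianMoments (hD : IsAbsDet D) {N : ℕ} (hN : 0 < N) :
    HasGaussianMoments (fun m : Fin (N + 1) → EuclideanSpace F (Fin N) => D N (simplexMatrix m))
      (Module.finrank ℝ F)
      (fun s => Real.pi ^ ((N * Module.finrank ℝ F : ℝ) / 2) *
        gaussianDetValue (Module.finrank ℝ F) N s)
      (gaussianConst (Module.finrank ℝ F) N) := by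
  have hβ : 0 < Module.finrank ℝ F := Module.finrank_pos
  refine ⟨(hD.continuous N).comp (continuous_simplexMatrix N), fun m => hD.nonneg _ _,
    fun r m hr => hD.map_simplexMatrix_smul hr m, by exact_mod_cast hβ, ?_, hN, ?_,
    fun s hs => hasGaussianMoment_simplexMatrix hD N hs, fun s hs => ?_,
    fun s _ => gaussianConst_ofReal _ _ _, differentiableOn_gaussianConst N⟩
  · rw [finrank_euclideanSpace_real]
    exact_mod_cast Nat.le_mul_of_pos_left _ hN
  · rw [finrank_euclideanSpace_real]
    exact Nat.le_mul_of_pos_right _ hβ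
  · have := gaussianDetValue_pos hβ N hs
    have := Real.pi_pos
    positivity

theorem momentFormulas (hD : IsAbsDet D) {β : ℕ} (hβ : Module.finrank ℝ F = β) {N : ℕ}
    (hN : 0 < N) (q : ℂ) : MomentFormulas F β N (D N) q := by
  intro hq
  have h := hD.hasGaussianMoments hN
  have hd : Module.finrank ℝ (EuclideanSpace F (Fin N)) = N * β := by
    rw [finrank_euclideanSpace_real, hβ]
  have hβ0 : 0 < β := hβ ▸ Module.finrank_pos
  rw [hβ] at h
  have : Nontrivial (EuclideanSpace F (Fin N)) :=
    Module.nontrivial_of_finrank_pos (R := ℝ) (by rw [hd]; positivity)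
  refine ⟨fun hq0 => ?_, fun hq0 hq1 => ?_, ?_⟩
  · obtain ⟨h1, h2⟩ := h.integral_ball hq
    refine ⟨h1, ?_⟩
    intro n
    rw [h2, hd]
    exact ball_closed_form hβ0 hN hq hq0
  · obtain ⟨h1, h2⟩ := h.integral_sphere hq (by
      rw [hd]
      push_cast
      linarith) (by simpa using hq0 0)
    refine ⟨h1, ?_⟩
    intro n
    rw [h2, hd]
    exact sphere_closed_form hβ0 hN hq hq0
  · obtain ⟨h1, h2⟩ := h.integral_gaussian hq
    refine ⟨h1, ?_⟩
    intro n
    rw [h2]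
    exact gaussian_closed_form hβ0 N q

end IsAbsDet

end Assembly

/-! ### The axioms for the real, complex and quaternionic determinants. -/

section Instances

theorem det_eq_of_first_column {R : Type*} [CommRing R] {n : ℕ}
    (M : Matrix (Fin (n + 1)) (Fin (n + 1)) R) (h : ∀ i : Fin n, M i.succ 0 = 0) :
    M.det = M 0 0 * (M.submatrix Fin.succ Fin.succ).det := by
  rw [Matrix.det_succ_column_zero, Fin.sum_univ_succ]
  simp [h]

theorem isAbsDet_real : IsAbsDet (F := ℝ) fun _ M => |M.det| where
  inner_mul_left a b c := by simp; ring
  smul_mul r a b := by simp; ring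
  mul_smul r a b := by simp; ring
  star_smul r a := by simp
  star_mul_self a := by simp; ring
  continuous n := (continuous_id.matrix_det).abs
  nonneg n M := abs_nonneg _
  of_isEmpty M := by simp
  map_mul n M M' := by rw [Matrix.det_mul, abs_mul]
  map_real n S := by simp
  expand n M h := by rw [det_eq_of_first_column M h, abs_mul, Real.norm_eq_abs]

theorem isAbsDet_complex : IsAbsDet (F := ℂ) fun _ M => ‖M.det‖ where
  inner_mul_left a b c := by
    simp only [Complex.inner]
    simp; ring
  smul_mul r a b := smul_mul_assoc r a b
  mul_smul r a b := mul_smul_comm r a b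
  star_smul r a := by simp
  star_mul_self a := by
    have := Complex.conj_mul' a
    simpa using this
  continuous n := (continuous_id.matrix_det).norm
  nonneg n M := norm_nonneg _
  of_isEmpty M := by simp
  map_mul n M M' := by rw [Matrix.det_mul, norm_mul]
  map_real n S := by
    have h : (S.map fun r => r • (1 : ℂ)) = (Complex.ofRealHom).mapMatrix S := by
      ext i j; simp
    rw [h, ← RingHom.map_det]
    simp
  expand n M h := by rw [det_eq_of_first_column M h, norm_mul]

/-- The embedding of the quaternions in the `2 × 2` complex matrices. -/
def quaternionBlock : ℍ[ℝ] →+* Matrix (Fin 2) (Fin 2) ℂ where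
  toFun x :=
    let z : ℂ := ⟨x.re, x.imI⟩
    let w : ℂ := ⟨x.imJ, x.imK⟩
    !![z, w; -conj w, conj z]
  map_one' := by
    ext i j; fin_cases i <;> fin_cases j <;> simp [Complex.ext_iff]
  map_zero' := by
    ext i j; fin_cases i <;> fin_cases j <;> simp [Complex.ext_iff]
  map_add' x y := by
    ext i j; fin_cases i <;> fin_cases j <;> simp [Complex.ext_iff] <;> abel
  map_mul' x y := by
    ext i j
    fin_cases i <;> fin_cases j <;> simp [Complex.ext_iff, Matrix.mul_apply] <;>
      constructor <;> ring

theorem det_quaternionBlock (x : ℍ[ℝ]) : (quaternionBlock x).det = ((‖x‖ ^ 2 : ℝ) : ℂ) := by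
  have h : ‖x‖ ^ 2 = x.re ^ 2 + x.imI ^ 2 + x.imJ ^ 2 + x.imK ^ 2 := by
    rw [sq, ← Quaternion.normSq_eq_norm_mul_self, Quaternion.normSq_def']
  rw [h, quaternionBlock, Matrix.det_fin_two]
  simp only [Complex.ext_iff, Complex.ofReal_re, Complex.ofReal_im]
  simp
  constructor <;> ring

theorem quaternionToComplex_eq {n : ℕ} (M : Matrix (Fin n) (Fin n) ℍ[ℝ]) :
    quaternionToComplex M = Matrix.compRingEquiv (Fin n) (Fin 2) ℂ (quaternionBlock.mapMatrix M) :=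
  rfl

/-- Splitting off the two complex indices that belong to the first quaternionic index makes the
complex matrix block upper triangular. Its corner block has determinant `‖M 0 0‖²`. -/
theorem det_quaternionToComplex_expand {n : ℕ} (M : Matrix (Fin (n + 1)) (Fin (n + 1)) ℍ[ℝ])
    (h : ∀ i : Fin n, M i.succ 0 = 0) :
    (quaternionToComplex M).det = ((‖M 0 0‖ ^ 2 : ℝ) : ℂ) *
      (quaternionToComplex (M.submatrix Fin.succ Fin.succ)).det := by
  set f : Fin 2 ⊕ Fin n × Fin 2 → Fin (n + 1) × Fin 2 :=
    Sum.elim (fun j => (0, j)) fun p => (p.1.succ, p.2) with hf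
  have hbij : Function.Bijective f := by
    constructor
    · rintro (a | a) (b | b) hab <;> simp [hf, Prod.ext_iff, Fin.succ_ne_zero] at hab ⊢
      · exact hab
      · exact absurd hab.1 (Fin.succ_ne_zero _).symm
      · exact hab
    · rintro ⟨i, j⟩
      refine Fin.cases ⟨Sum.inl j, rfl⟩ (fun i => ⟨Sum.inr (i, j), rfl⟩) i
  rw [← Matrix.det_submatrix_equiv_self (Equiv.ofBijective f hbij)]
  have hb : (quaternionToComplex M).submatrix (Equiv.ofBijective f hbij)
      (Equiv.ofBijective f hbij) =
      Matrix.fromBlocks (quaternionBlock (M 0 0))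
        (Matrix.of fun i p => quaternionBlock (M 0 p.1.succ) i p.2) 0
        (quaternionToComplex (M.submatrix Fin.succ Fin.succ)) := by
    ext a b
    rcases a with a | a <;> rcases b with b | b
    · rfl
    · rfl
    · have : quaternionBlock (M a.1.succ 0) a.2 b = 0 := by rw [h, map_zero]; rfl
      exact this
    · rfl
  rw [hb, Matrix.det_fromBlocks_zero₂₁, det_quaternionBlock]

theorem continuous_quaternionBlock : Continuous quaternionBlock := by
  have e : ∀ a b : ℝ, (⟨a, b⟩ : ℂ) = a + b * Complex.I := fun a b => (Complex.mk_eq_add_mul_I a b)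
  refine continuous_matrix fun i j => ?_
  have hr := Quaternion.continuous_re
  have hi := Quaternion.continuous_imI
  have hj := Quaternion.continuous_imJ
  have hk := Quaternion.continuous_imK
  fin_cases i <;> fin_cases j <;> simp [quaternionBlock, e] <;> fun_prop

theorem isAbsDet_quaternion : IsAbsDet (F := ℍ[ℝ]) fun _ M => quaternionAbsDet M where
  inner_mul_left a b c := by
    simp only [Quaternion.inner_def]
    simp; ring
  smul_mul r a b := smul_mul_assoc r a b
  mul_smul r a b := mul_smul_comm r a b
  star_smul r a := by simp
  star_mul_self a := by
    rw [Quaternion.star_mul_self, Quaternion.normSq_eq_norm_mul_self, ← sq,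
      ← mul_one (((‖a‖ ^ 2 : ℝ) : ℍ[ℝ])), Quaternion.coe_mul_eq_smul]
  continuous n := by
    have : Continuous fun M : Matrix (Fin n) (Fin n) ℍ[ℝ] => quaternionToComplex M := by
      refine continuous_matrix fun i j => ?_
      have h1 : Continuous fun M : Matrix (Fin n) (Fin n) ℍ[ℝ] => quaternionBlock (M i.1 j.1) :=
        continuous_quaternionBlock.comp (by fun_prop)
      exact h1.matrix_elem i.2 j.2
    exact (this.matrix_det.norm).sqrt
  nonneg n M := Real.sqrt_nonneg _
  of_isEmpty M := by simp [quaternionAbsDet]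
  map_mul n M M' := by
    simp only [quaternionAbsDet]
    rw [quaternionToComplex_eq, map_mul, map_mul, Matrix.det_mul, norm_mul,
      Real.sqrt_mul (norm_nonneg _)]
    rfl
  map_real n S := by
    -- A real matrix becomes the Kronecker product of `S` with the `2 × 2` identity, of determinant
    -- `(det S)²`; the square root then returns `|det S|`.
    have h : quaternionToComplex (S.map fun r => r • (1 : ℍ[ℝ])) =
        Matrix.kroneckerMap (· * ·) (Complex.ofRealHom.mapMatrix S)
          (1 : Matrix (Fin 2) (Fin 2) ℂ) := by
      ext ⟨i, a⟩ ⟨j, b⟩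
      fin_cases a <;> fin_cases b <;>
        simp [quaternionToComplex, Matrix.kroneckerMap_apply, Complex.ext_iff]
    rw [quaternionAbsDet, h, Matrix.det_kronecker, ← RingHom.map_det]
    simp [Real.sqrt_sq_eq_abs]
  expand n M h := by
    rw [quaternionAbsDet, det_quaternionToComplex_expand M h, norm_mul,
      Real.sqrt_mul (norm_nonneg _), quaternionAbsDet]
    congr 1
    simp

end Instances

end SimplexMoment

end

/-- Moments of `|det [m_k - m_0]|` over `ℝ` (`β = 1`), `ℂ` (`β = 2`) and the real quaternions
(`β = 4`). -/
theorem propositionP8 (N : ℕ) (hN : 1 ≤ N) (q : ℂ) :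
    SimplexMoment.MomentFormulas ℝ 1 N (fun M => |M.det|) q ∧
    SimplexMoment.MomentFormulas ℂ 2 N (fun M => ‖M.det‖) q ∧
    SimplexMoment.MomentFormulas ℍ[ℝ] 4 N (fun M => SimplexMoment.quaternionAbsDet M) q := by
  refine ⟨?_, ?_, ?_⟩
  · exact SimplexMoment.isAbsDet_real.momentFormulas (Module.finrank_self ℝ) hN q
  · exact SimplexMoment.isAbsDet_complex.momentFormulas Complex.finrank_real_complex hN q
  · exact SimplexMoment.isAbsDet_quaternion.momentFormulas (Quaternion.finrank_eq_four) hN q
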